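/- **Setting.** Let $n\ge 0$, let $\mathcal X_t,\mathcal Y_t$ ($t\ge 0$) and $\mathcal Y^{-1}$ be Polish spaces with their Borel $\sigma$-algebras, $\mu$ a probability measure on $\mathcal Y^{-1}$ (the law of the initial data $y^{-1}$), and $P_t(dx_t|x^{t-1})$ the stochastic kernels of the source, with $P_{0,t}(dx^t)=P_0(dx_0)\cdots P_t(dx_t|x^{t-1})$. Write $x^t=(x_0,\dots,x_t)$, $y_0^t=(y_0,\dots,y_t)$, $y^t=(y^{-1},y_0^t)$. Let $\rho_t(x^t,y_0^t)\in[0,\infty]$ be measurable (it may depend on only some of the coordinates), and $d_{0,n}=\sum_{t=0}^n\rho_t$. For stochastic kernels $Q_t(dy_t|y^{t-1},x^t)$ put $\overrightarrow Q_{0,t}(dy_0^t|y^{-1},x^t)=\otimes_{i=0}^tQ_i(dy_i|y^{i-1},x^i)$; the joint law is $\mu(dy^{-1})\otimes P_{0,n}(dx^n)\otimes\overrightarrow Q_{0,n}(dy_0^n|y^{-1},x^n)$, $\mathbf E^{Q}$ is its expectation, $\Pi^{Q}_{0,n}(dy_0^n|y^{-1})$ the conditional law of $y_0^n$ given $y^{-1}$,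 and $\Pi_t^{Q}(dy_t|y^{t-1})$ the regular conditional law of $y_t$ given $y^{t-1}$. Let $$\mathbb I_{0,n}(P_{0,n},\overrightarrow Q_{0,n})=\int\log\frac{d\overrightarrow Q_{0,n}(\cdot|y^{-1},x^n)}{d\Pi^{Q}_{0,n}(\cdot|y^{-1})}(y_0^n)\;d\big(\mu\otimes P_{0,n}\otimes \overrightarrow Q_{0,n}\big)\in[0,\infty]$$ (the relative entropy between $\mu\otimes P_{0,n}\otimes\overrightarrow Q_{0,n}$ and $\mu\otimes(P_{0,n}\times\Pi_{0,n}^{Q})$, equal to $\infty$ without absolute continuity; the same formula is used for any kernel in place of $\overrightarrow Q_{0,n}$), and for $D\ge0$ $$R_{0,n}(D)=\inf\Big\{\mathbb I_{0,n}(P_{0,n},\overrightarrow Q_{0,n}):\ \tfrac1{n+1}\mathbf E^{Q}\{d_{0,n}(X^n,Y^n)\}\le D\Big\}.$$ **Theorem.** Suppose that $Q^*=\{Q_t^*\}$ satisfies the distortion constraint and attains the infimum $R_{0,n}(D)$, and that $\mathbb I_{0,n}(P_{0,n},\cdot)$ is Gâteaux differentiable at $\overrightarrow Q^*_{0,n}$: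 for every causal $\overrightarrow Q_{0,n}$ (it is enough to consider those with $\overrightarrow Q_{0,n}(\cdot|y^{-1},x^n)\le C\,\Pi^{Q^*}_{0,n}(\cdot|y^{-1})$ for a constant $C$ and $\mu\otimes P_{0,n}$-almost all $(y^{-1},x^n)$) the function $\varepsilon\mapsto\mathbb I_{0,n}(P_{0,n},\overrightarrow Q^*_{0,n}+\varepsilon(\overrightarrow Q_{0,n}-\overrightarrow Q^*_{0,n}))$ is finite for small $\varepsilon\ge0$ and has a finite right derivative at $\varepsilon=0$. Then there is a real $s\le0$ which is a Lagrange multiplier of the constraint, i.e. $R_{0,n}(D)\le\mathbb I_{0,n}(P_{0,n},\overrightarrow Q_{0,n})-s\big(\mathbf E^{Q}\{d_{0,n}\}-(n+1)D\big)$ for all causal $Q$, such that, with $g_{n,n}=0$ and, for $t=n-1,\dots,0$, $$g_{t,n}(x^t,y^t)=-\int_{\mathcal X_{t+1}}P_{t+1}(dx_{t+1}|x^t)\,\log\int_{\mathcal Y_{t+1}}e^{s\rho_{t+1}(x^{t+1},y_0^{t+1})-g_{t+1,n}(x^{t+1},y^{t+1})}\,\Pi^{Q^*}_{t+1}(dy_{t+1}|y^t),$$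 all these integrals being well defined and finite for almost all arguments (for the joint law of $Q^*$), the following hold. **(1)** For $t=0,\dots,n$ and almost all $(y^{t-1},x^t)$ (for the joint law of $Q^*$), the denominator below is positive and finite and $$Q_t^*(dy_t|y^{t-1},x^t)=\frac{e^{s\rho_t(x^t,y_0^t)-g_{t,n}(x^t,y^t)}\,\Pi_t^{Q^*}(dy_t|y^{t-1})}{\int_{\mathcal Y_t}e^{s\rho_t(x^t,y_0^t)-g_{t,n}(x^t,y^t)}\,\Pi_t^{Q^*}(dy_t|y^{t-1})}.$$ **(2)** $R_{0,n}(D)<\infty$, and, with integrable integrands, $$\frac{R_{0,n}(D)}{n+1}=sD-\frac1{n+1}\sum_{t=0}^n\int\Big\{\int_{\mathcal Y_t}g_{t,n}(x^t,y^t)\,Q^*_t(dy_t|y^{t-1},x^t)+\log\int_{\mathcal Y_t}e^{s\rho_t(x^t,y_0^t)-g_{t,n}(x^t,y^t)}\,\Pi_t^{Q^*}(dy_t|y^{t-1})\Big\}\,P_t(dx_t|x^{t-1})\otimes(P_{0,t-1}\otimes\overrightarrow Q^*_{0,t-1})(dx^{t-1},dy_0^{t-1}|y^{-1})\otimes\mu(dy^{-1}).$$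 **(3)** If $R_{0,n}(D)>0$, then $s<0$ and $$\frac1{n+1}\sum_{t=0}^n\int\rho_t(x^t,y_0^t)\,(P_{0,t}\otimes\overrightarrow Q^*_{0,t})(dx^t,dy_0^t|y^{-1})\otimes\mu(dy^{-1})=D.$$ -/

import Mathlib

open MeasureTheory ProbabilityTheory Filter Topology
open scoped ENNReal NNReal

noncomputable section

namespace NRDF

universe u v w

/-- `Hist X t = X 0 × ⋯ × X (t - 1)`: the first `t` coordinates. Thus the string
`(x_0, …, x_t)`, usually written `x^t`, is a point of `Hist X (t + 1)`. -/
def Hist (X : ℕ → Type u) : ℕ → Type u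
  | 0 => PUnit
  | t + 1 => Hist X t × X t

/-- Append one coordinate to a history. -/
def Hist.snoc {X : ℕ → Type u} {t : ℕ} (h : Hist X t) (x : X t) : Hist X (t + 1) := (h, x)

/-- Forget the last coordinate of a history. -/
def Hist.init {X : ℕ → Type u} {t : ℕ} (h : Hist X (t + 1)) : Hist X t := Prod.fst h

/-- The last coordinate of a history. -/
def Hist.last {X : ℕ → Type u} {t : ℕ} (h : Hist X (t + 1)) : X t := Prod.snd h

/-- The product σ-algebra on histories. -/
instance Hist.instMeasurableSpace {X : ℕ → Type u} [∀ t, MeasurableSpace (X t)] :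
    ∀ t, MeasurableSpace (Hist X t)
  | 0 => (inferInstance : MeasurableSpace PUnit)
  | t + 1 =>
    letI := Hist.instMeasurableSpace (X := X) t
    (inferInstance : MeasurableSpace (Hist X t × X t))

section basic

variable {X : ℕ → Type u} [∀ t, MeasurableSpace (X t)]

theorem Hist.measurable_init {t : ℕ} : Measurable (Hist.init : Hist X (t + 1) → Hist X t) :=
  measurable_fst

theorem Hist.measurable_last {t : ℕ} : Measurable (Hist.last : Hist X (t + 1) → X t) :=
  measurable_snd

theorem Hist.measurable_snoc {t : ℕ} :
    Measurable (fun p : Hist X t × X t => Hist.snoc p.1 p.2) :=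
  measurable_id

end basic

/-- A source: the conditional distributions `P_t(dx_t | x^{t-1})` for `t = 0, 1, …`
(for `t = 0` the conditioning history is the unique point of `Hist X 0`, so that `P_0` is a
probability measure on `X 0`). -/
structure Source (X : ℕ → Type u) [∀ t, MeasurableSpace (X t)] where
  kernel : ∀ t, Kernel (Hist X t) (X t)
  markov : ∀ t, IsMarkovKernel (kernel t)

/-- A causal reproduction: the conditional distributions `Q_t(dy_t | y^{t-1}, x^t)` for
`t = 0, 1, …`, where `y^{t-1} = (y^{-1}, y_0, …, y_{t-1})` is a point of `W × Hist Y t`, the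
space `W` being the one of the initial data `y^{-1}`. -/
structure Reproduction (W : Type w) (X : ℕ → Type u) (Y : ℕ → Type v) [MeasurableSpace W]
    [∀ t, MeasurableSpace (X t)] [∀ t, MeasurableSpace (Y t)] where
  kernel : ∀ t, Kernel ((W × Hist Y t) × Hist X (t + 1)) (Y t)
  markov : ∀ t, IsMarkovKernel (kernel t)

attribute [instance] Source.markov Reproduction.markov

/-- A distortion function, given by measurable functions `ρ_t(x^t, y_0^t) ∈ [0, ∞]`. -/
structure Distortion (X : ℕ → Type u) (Y : ℕ → Type v)
    [∀ t, MeasurableSpace (X t)] [∀ t, MeasurableSpace (Y t)] where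
  rho : ∀ t, Hist X (t + 1) → Hist Y (t + 1) → ℝ≥0∞
  measurable : ∀ t, Measurable (Function.uncurry (rho t))

variable {W : Type w} {X : ℕ → Type u} {Y : ℕ → Type v} [MeasurableSpace W]
  [∀ t, MeasurableSpace (X t)] [∀ t, MeasurableSpace (Y t)]

/-- `P.law t` is the law of `(x_0, …, x_{t-1})`; in particular `P_{0,n} = P.law (n + 1)`. -/
def Source.law (P : Source X) : ∀ t, Measure (Hist X t)
  | 0 => (Measure.dirac PUnit.unit : Measure PUnit)
  | t + 1 => (P.law t ⊗ₘ P.kernel t : Measure (Hist X t × X t))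

instance Source.instLaw (P : Source X) : ∀ t, IsProbabilityMeasure (P.law t)
  | 0 => (inferInstance : IsProbabilityMeasure (Measure.dirac PUnit.unit : Measure PUnit))
  | t + 1 =>
    haveI := P.instLaw t
    (inferInstance : IsProbabilityMeasure (P.law t ⊗ₘ P.kernel t))

/-- `Q.causal t` is the conditional distribution
`Q_0(dy_0 | y^{-1}, x_0) ⋯ Q_{t-1}(dy_{t-1} | y^{t-2}, x^{t-1})` of `(y_0, …, y_{t-1})` given
`y^{-1}` and `(x_0, …, x_{t-1})`; the kernel `Q⃗_{0,n}` is `Q.causal (n + 1)`. -/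
def Reproduction.causal (Q : Reproduction W X Y) : ∀ t, Kernel (W × Hist X t) (Hist Y t)
  | 0 => (Kernel.const _ (Measure.dirac PUnit.unit) : Kernel (W × Hist X 0) PUnit)
  | t + 1 =>
    ((Q.causal t).comap (fun a : W × Hist X (t + 1) => (a.1, a.2.init))
        (measurable_fst.prodMk (Hist.measurable_init.comp measurable_snd)) ⊗ₖ
      (Q.kernel t).comap
        (fun a : (W × Hist X (t + 1)) × Hist Y t => ((a.1.1, a.2), a.1.2)) (by fun_prop) :
      Kernel (W × Hist X (t + 1)) (Hist Y t × Y t))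

instance Reproduction.instCausal (Q : Reproduction W X Y) : ∀ t, IsMarkovKernel (Q.causal t)
  | 0 => (inferInstance : IsMarkovKernel
      (Kernel.const (W × Hist X 0) (Measure.dirac PUnit.unit) : Kernel (W × Hist X 0) PUnit))
  | t + 1 =>
    haveI := Q.instCausal t
    (inferInstance : IsMarkovKernel
      ((Q.causal t).comap (fun a : W × Hist X (t + 1) => (a.1, a.2.init))
          (measurable_fst.prodMk (Hist.measurable_init.comp measurable_snd)) ⊗ₖ
        (Q.kernel t).comap
          (fun a : (W × Hist X (t + 1)) × Hist Y t => ((a.1.1, a.2), a.1.2)) (by fun_prop)))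

/-- The joint distribution `P_{0,n} ⊗ K` of `(x^n, y_0^n)` given `y^{-1}`
(with `N = n + 1` coordinates). -/
def jointKernel (P : Source X) {N : ℕ} (K : Kernel (W × Hist X N) (Hist Y N)) :
    Kernel W (Hist X N × Hist Y N) :=
  Kernel.const W (P.law N) ⊗ₖ K

/-- The marginal distribution `Π_{0,n}(dy_0^n | y^{-1})` of `y_0^n` given `y^{-1}`. -/
def outputLaw (P : Source X) {N : ℕ} (K : Kernel (W × Hist X N) (Hist Y N)) :
    Kernel W (Hist Y N) :=
  (jointKernel P K).snd

/-- The product distribution `P_{0,n} × Π_{0,n}` of `(x^n, y_0^n)` given `y^{-1}`. -/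
def productKernel (P : Source X) {N : ℕ} (K : Kernel (W × Hist X N) (Hist Y N)) :
    Kernel W (Hist X N × Hist Y N) :=
  Kernel.const W (P.law N) ×ₖ outputLaw P K

/-- The functional `𝕀_{0,n}(P_{0,n}, K)`: the relative entropy (natural logarithm) between the
joint distribution `P_{0,n} ⊗ K` and the product distribution `P_{0,n} × Π_{0,n}`, both
conditional on `y^{-1}`, with `y^{-1}` distributed according to `μ`. -/
def info (μ : Measure W) (P : Source X) {N : ℕ} (K : Kernel (W × Hist X N) (Hist Y N)) : ℝ≥0∞ :=
  InformationTheory.klDiv (μ ⊗ₘ jointKernel P K) (μ ⊗ₘ productKernel P K)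

/-- The law of `(y^{-1}, (x_0, …, x_{t-1}), (y_0, …, y_{t-1}))`. -/
def jointLaw (μ : Measure W) (P : Source X) (Q : Reproduction W X Y) (t : ℕ) :
    Measure (W × (Hist X t × Hist Y t)) :=
  μ ⊗ₘ jointKernel P (Q.causal t)

instance (μ : Measure W) [IsProbabilityMeasure μ] (P : Source X) (Q : Reproduction W X Y) (t : ℕ) :
    IsProbabilityMeasure (jointLaw μ P Q t) := by
  unfold jointLaw jointKernel; infer_instance

/-- The law of `(y^{t-1}, x^t)`, i.e. of everything on which `y_t` depends:
`P_t(dx_t | x^{t-1}) ⊗ (P_{0,t-1} ⊗ Q⃗_{0,t-1})(dx^{t-1}, dy_0^{t-1} | y^{-1}) ⊗ μ(dy^{-1})`. -/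
def pastLaw (μ : Measure W) (P : Source X) (Q : Reproduction W X Y) (t : ℕ) :
    Measure ((W × Hist Y t) × Hist X (t + 1)) :=
  (jointLaw μ P Q t ⊗ₘ (P.kernel t).comap (fun a => a.2.1) (by fun_prop)).map
    (fun a => ((a.1.1, a.1.2.2), a.1.2.1.snoc a.2))

theorem measurable_pastLaw_aux (t : ℕ) :
    Measurable (fun a : (W × (Hist X t × Hist Y t)) × X t =>
      ((a.1.1, a.1.2.2), a.1.2.1.snoc a.2)) :=
  Measurable.prodMk (by fun_prop)
    (Hist.measurable_snoc.comp (f := fun a : (W × (Hist X t × Hist Y t)) × X t =>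
      (a.1.2.1, a.2)) (by fun_prop))

instance (μ : Measure W) [IsProbabilityMeasure μ] (P : Source X) (Q : Reproduction W X Y) (t : ℕ) :
    IsProbabilityMeasure (pastLaw μ P Q t) :=
  Measure.isProbabilityMeasure_map (measurable_pastLaw_aux t).aemeasurable

/-- `Π_t(dy_t | y^{t-1})`: the regular conditional distribution of `y_t` given
`y^{t-1} = (y^{-1}, y_0, …, y_{t-1})` under the joint law. -/
def outputKernel [∀ t, StandardBorelSpace (Y t)] [∀ t, Nonempty (Y t)]
    (μ : Measure W) [IsProbabilityMeasure μ] (P : Source X) (Q : Reproduction W X Y) (t : ℕ) :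
    Kernel (W × Hist Y t) (Y t) :=
  condDistrib (fun a : W × (Hist X (t + 1) × Hist Y (t + 1)) => a.2.2.last)
    (fun a => (a.1, a.2.2.init)) (jointLaw μ P Q (t + 1))

/-- `d.total (n + 1)` is `d_{0,n}(x^n, y^n) = ∑_{t ≤ n} ρ_t(x^t, y_0^t)`. -/
def Distortion.total (d : Distortion X Y) : ∀ t, Hist X t → Hist Y t → ℝ≥0∞
  | 0, _, _ => 0
  | t + 1, x, y => d.total t x.init y.init + d.rho t x y

/-- The expected total distortion `E d_{0,n}(X^n, Y^n)`. -/
def expectedDistortion (μ : Measure W) (P : Source X) (d : Distortion X Y) (n : ℕ)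
    (Q : Reproduction W X Y) : ℝ≥0∞ :=
  ∫⁻ a, d.total (n + 1) a.2.1 a.2.2 ∂(jointLaw μ P Q (n + 1))

/-- The fidelity constraint `(n + 1)⁻¹ E d_{0,n}(X^n, Y^n) ≤ D`. -/
def Feasible (μ : Measure W) (P : Source X) (d : Distortion X Y) (n : ℕ) (D : ℝ≥0)
    (Q : Reproduction W X Y) : Prop :=
  ((n : ℝ≥0∞) + 1)⁻¹ * expectedDistortion μ P d n Q ≤ D

/-- The nonanticipative rate distortion function `R_{0,n}(D)`. -/
def nrdf (μ : Measure W) (P : Source X) (d : Distortion X Y) (n : ℕ) (D : ℝ≥0) : ℝ≥0∞ :=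
  ⨅ (Q : Reproduction W X Y) (_ : Feasible μ P d n D Q), info μ P (Q.causal (n + 1))

/-- `Q` attains the infimum that defines `R_{0,n}(D)`. -/
def IsOptimal (μ : Measure W) (P : Source X) (d : Distortion X Y) (n : ℕ) (D : ℝ≥0)
    (Q : Reproduction W X Y) : Prop :=
  Feasible μ P d n D Q ∧ info μ P (Q.causal (n + 1)) = nrdf μ P d n D

/-- The kernel `K + ε (L - K) = (1 - ε) K + ε L` (for `0 ≤ ε ≤ 1`). -/
def mix {α : Type*} {β : Type*} [MeasurableSpace α] [MeasurableSpace β] (ε : ℝ)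
    (K L : Kernel α β) : Kernel α β where
  toFun a := ENNReal.ofReal (1 - ε) • K a + ENNReal.ofReal ε • L a
  measurable' := by
    refine Measure.measurable_of_measurable_coe _ fun s hs => ?_
    simp only [Measure.coe_add, Measure.coe_smul, Pi.add_apply, Pi.smul_apply, smul_eq_mul]
    exact ((K.measurable_coe hs).const_mul _).add ((L.measurable_coe hs).const_mul _)

/-- The functional `𝕀_{0,n}(P_{0,n}, ·)` is finite along the beginning of the segment from `K`
to `L` and has a (finite, one-sided) directional derivative at `K` in the direction `L - K`. -/
def HasGateauxDerivToward (μ : Measure W) (P : Source X) {N : ℕ}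
    (K L : Kernel (W × Hist X N) (Hist Y N)) : Prop :=
  (∀ᶠ ε in 𝓝[≥] (0 : ℝ), info μ P (mix ε K L) ≠ ∞) ∧
    ∃ δ : ℝ, Tendsto
      (fun ε : ℝ => ((info μ P (mix ε K L)).toReal - (info μ P K).toReal) / ε)
      (𝓝[>] 0) (𝓝 δ)

/-- The kernel `L(dy_0^n | y^{-1}, x^n)` has a density bounded by a constant with respect to the
output distribution `Π_{0,n}(dy_0^n | y^{-1})` of `K`, for almost all `(y^{-1}, x^n)`. -/
def BoundedDensity (μ : Measure W) (P : Source X) {N : ℕ}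
    (K L : Kernel (W × Hist X N) (Hist Y N)) : Prop :=
  ∃ C : ℝ≥0, ∀ᵐ a ∂(μ.prod (P.law N)), L a ≤ (C : ℝ≥0∞) • outputLaw P K a.1

/-- Gâteaux differentiability of `𝕀_{0,n}(P_{0,n}, ·)` at `Q⃗_{0,n}`: the directional derivative
exists in the direction of every causal reproduction whose density with respect to the output
distribution of `Q` is bounded. (For those the functional is finite. Asking it of all
directions is a stronger requirement, which fails for continuous alphabets, where the functional
is infinite at some causal reproductions.) -/
def GateauxDifferentiableAt (μ : Measure W) (P : Source X) (n : ℕ) (Q : Reproduction W X Y) :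
    Prop :=
  ∀ Q' : Reproduction W X Y,
    BoundedDensity μ P (Q.causal (n + 1)) (Q'.causal (n + 1)) →
      HasGateauxDerivToward μ P (Q.causal (n + 1)) (Q'.causal (n + 1))

/-- `s ≤ 0` is a Lagrange multiplier of the fidelity constraint:
`R_{0,n}(D) ≤ 𝕀_{0,n}(P_{0,n}, Q⃗_{0,n}) - s (E d_{0,n}(X^n, Y^n) - (n + 1) D)`
for every causal reproduction. -/
def IsLagrangeMultiplier (μ : Measure W) (P : Source X) (d : Distortion X Y) (n : ℕ) (D : ℝ≥0)
    (s : ℝ) : Prop :=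
  s ≤ 0 ∧ ∀ Q : Reproduction W X Y,
    nrdf μ P d n D + ENNReal.ofReal (-s) * (((n : ℝ≥0∞) + 1) * D) ≤
      info μ P (Q.causal (n + 1)) + ENNReal.ofReal (-s) * expectedDistortion μ P d n Q

/-- `y^t = (y^{t-1}, y_t)`. -/
def extend {t : ℕ} (y : W × Hist Y t) (yt : Y t) : W × Hist Y (t + 1) := (y.1, y.2.snoc yt)

/-- The weight `exp (s ρ_t(x^t, y_0^t) - g(x^t, y^t)) ∈ [0, ∞]`, with `s · ∞ = -∞` if `s < 0` and
`0 · ∞ = 0`. -/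
def weight (d : Distortion X Y) (s : ℝ) (t : ℕ)
    (g : W × Hist Y (t + 1) → Hist X (t + 1) → ℝ) (y : W × Hist Y (t + 1))
    (x : Hist X (t + 1)) : ℝ≥0∞ :=
  EReal.exp ((s : EReal) * (d.rho t x y.2 : EReal) - (g y x : EReal))

/-- The partition function
`∫ exp (s ρ_t(x^t, y_0^t) - g(x^t, y^t)) Π_t(dy_t | y^{t-1})` at `p = (y^{t-1}, x^t)`. -/
def partition (d : Distortion X Y) (s : ℝ) (t : ℕ)
    (g : W × Hist Y (t + 1) → Hist X (t + 1) → ℝ) (Pi : Kernel (W × Hist Y t) (Y t))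
    (p : (W × Hist Y t) × Hist X (t + 1)) : ℝ≥0∞ :=
  ∫⁻ yt, weight d s t g (extend p.1 yt) p.2 ∂(Pi p.1)

/-- The logarithm of the partition function. -/
def logPartition (d : Distortion X Y) (s : ℝ) (t : ℕ)
    (g : W × Hist Y (t + 1) → Hist X (t + 1) → ℝ) (Pi : Kernel (W × Hist Y t) (Y t))
    (p : (W × Hist Y t) × Hist X (t + 1)) : ℝ :=
  Real.log (partition d s t g Pi p).toReal

/-- The recursion that determines `g_{t,n}(x^t, y^t)`, backwards from `g_{n,n} = 0`. -/
def BackwardRecursion (P : Source X) (d : Distortion X Y) (n : ℕ) (s : ℝ)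
    (Pi : ∀ t, Kernel (W × Hist Y t) (Y t))
    (g : ∀ t, W × Hist Y (t + 1) → Hist X (t + 1) → ℝ) : Prop :=
  (∀ y x, g n y x = 0) ∧
    ∀ t < n, ∀ y x, g t y x =
      -∫ x', logPartition d s (t + 1) (g (t + 1)) (Pi (t + 1)) (y, x.snoc x')
        ∂(P.kernel (t + 1) x)

end NRDF

end

/-!
Write `Π` for the output kernel of the optimal `Q*`. The slope of `x log x` at `0` is `-∞`, so a
finite one-sided derivative of the information at `Q*` in the direction of the output product law
`μ ⊗ P ⊗ Π` forces that law to be absolutely continuous with respect to the joint law of `Q*`;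
hence almost everywhere statements transfer from the optimal joint law to `Π`.

The constrained problem is convex. If some `Q` of finite information has distortion strictly below
the level, a supporting line of the value function gives a multiplier `s ≤ 0`. Otherwise the cost
to go under `Q*` is almost surely equal to its conditional mean, since drawing once more whenever
the mean is exceeded would produce such a `Q`; hence the product law has the same distortion as
`Q*`, the rate vanishes, and `s = 0` is a multiplier.

The information of `Q` is the least relative entropy of its joint law to a product law, attained at
its own output kernel. With the reference fixed at `Π`, the optimal `Q*` therefore minimizes the
free energy: relative entropy to `μ ⊗ P ⊗ Π` plus `-s` times distortion. Backwards in time,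
the Gibbs variational principle splits the free energy of any `Q` into a constant plus the relative
entropy of `Q` to the reproduction that consists of the Gibbs kernels. At the minimizer that
relative entropy is zero, so `Q*` consists of the Gibbs kernels, and the constant is the value.

For `s ≤ 0` the costs `-s ρ_t` and `g_{t,n}` take values in `[0, ∞]`; all of these identities hold
there without integrability conditions, and finiteness of the free energy brings them back to `ℝ`.
-/

noncomputable section

namespace NRDF

universe u v w

section Histories

@[simp]
theorem Hist.init_snoc {X : ℕ → Type u} {t : ℕ} (h : Hist X t) (x : X t) : (h.snoc x).init = h :=
  rfl

variable {W : Type w} {X : ℕ → Type u} {Y : ℕ → Type v} [MeasurableSpace W]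
  [∀ t, MeasurableSpace (X t)] [∀ t, MeasurableSpace (Y t)]

attribute [fun_prop] Hist.measurable_init Hist.measurable_last Hist.measurable_snoc

@[fun_prop]
theorem measurable_lintegral_kernel_comp {α β γ : Type*} [MeasurableSpace α] [MeasurableSpace β]
    [MeasurableSpace γ] {κ : Kernel β γ} [IsSFiniteKernel κ] {g : α → β} (hg : Measurable g)
    {f : α → γ → ℝ≥0∞} (hf : Measurable (Function.uncurry f)) :
    Measurable fun a => ∫⁻ c, f a c ∂κ (g a) :=
  Measurable.lintegral_kernel_prod_right (κ := κ.comap g hg) hf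

/-- The rearrangement `((y^{t-1}, x^t), y_t) ↦ (y^{-1}, x^t, y_0^t)`, under which the joint law at
time `t + 1` is the past law at time `t` followed by the reproduction kernel. -/
def jointEquiv (t : ℕ) : (((W × Hist Y t) × Hist X (t + 1)) × Y t) ≃ᵐ
    (W × (Hist X (t + 1) × Hist Y (t + 1))) where
  toFun q := (q.1.1.1, (q.1.2, q.1.1.2.snoc q.2))
  invFun a := (((a.1, a.2.2.init), a.2.1), a.2.2.last)
  left_inv _ := rfl
  right_inv _ := rfl
  measurable_toFun := (by fun_prop : Measurable fun q : ((W × Hist Y t) × Hist X (t + 1)) × Y t =>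
    (q.1.1.1, (q.1.2, q.1.1.2.snoc q.2)))
  measurable_invFun := (by fun_prop : Measurable fun a : W × (Hist X (t + 1) × Hist Y (t + 1)) =>
    (((a.1, a.2.2.init), a.2.1), a.2.2.last))

/-- The rearrangement `((y^{-1}, x^{t-1}, y_0^{t-1}), x_t) ↦ (y^{t-1}, x^t)`, under which the past
law at time `t` is the joint law at time `t` followed by the source kernel. -/
def pastEquiv (t : ℕ) : ((W × (Hist X t × Hist Y t)) × X t) ≃ᵐ
    ((W × Hist Y t) × Hist X (t + 1)) where
  toFun a := ((a.1.1, a.1.2.2), a.1.2.1.snoc a.2)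
  invFun p := ((p.1.1, (p.2.init, p.1.2)), p.2.last)
  left_inv _ := rfl
  right_inv _ := rfl
  measurable_toFun := measurable_pastLaw_aux t
  measurable_invFun := (by fun_prop : Measurable fun p : (W × Hist Y t) × Hist X (t + 1) =>
    ((p.1.1, (p.2.init, p.1.2)), p.2.last))

theorem Source.lintegral_law_zero (P : Source X) (f : Hist X 0 → ℝ≥0∞) :
    ∫⁻ x, f x ∂P.law 0 = f PUnit.unit :=
  lintegral_dirac PUnit.unit f

theorem Source.lintegral_law_succ (P : Source X) (t : ℕ) {f : Hist X (t + 1) → ℝ≥0∞}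
    (hf : Measurable f) :
    ∫⁻ x, f x ∂P.law (t + 1) = ∫⁻ x, ∫⁻ x', f (x.snoc x') ∂P.kernel t x ∂P.law t :=
  Measure.lintegral_compProd (μ := P.law t) (κ := P.kernel t) (f := f) hf

theorem Reproduction.lintegral_causal_zero (Q : Reproduction W X Y) (p : W × Hist X 0)
    (f : Hist Y 0 → ℝ≥0∞) : ∫⁻ y, f y ∂Q.causal 0 p = f PUnit.unit :=
  lintegral_dirac PUnit.unit f

theorem Reproduction.lintegral_causal_succ (Q : Reproduction W X Y) (t : ℕ) (w : W)
    (x : Hist X (t + 1)) {f : Hist Y (t + 1) → ℝ≥0∞} (hf : Measurable f) :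
    ∫⁻ y, f y ∂Q.causal (t + 1) (w, x) =
      ∫⁻ y, ∫⁻ y', f (y.snoc y') ∂Q.kernel t ((w, y), x) ∂Q.causal t (w, x.init) :=
  Kernel.lintegral_compProd _ _ (w, x) (f := f) hf

theorem lintegral_compProd_jointKernel (μ : Measure W) [SFinite μ] (P : Source X)
    {N : ℕ} (K : Kernel (W × Hist X N) (Hist Y N)) [IsSFiniteKernel K]
    {f : W × (Hist X N × Hist Y N) → ℝ≥0∞} (hf : Measurable f) :
    ∫⁻ a, f a ∂(μ ⊗ₘ jointKernel P K) =
      ∫⁻ w, ∫⁻ x, ∫⁻ y, f (w, (x, y)) ∂K (w, x) ∂P.law N ∂μ := by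
  unfold jointKernel
  rw [Measure.lintegral_compProd hf]
  exact lintegral_congr fun w => Kernel.lintegral_compProd _ _ _ (by fun_prop)

theorem lintegral_jointLaw (μ : Measure W) [SFinite μ] (P : Source X)
    (Q : Reproduction W X Y) (t : ℕ) {f : W × (Hist X t × Hist Y t) → ℝ≥0∞} (hf : Measurable f) :
    ∫⁻ a, f a ∂jointLaw μ P Q t =
      ∫⁻ w, ∫⁻ x, ∫⁻ y, f (w, (x, y)) ∂Q.causal t (w, x) ∂P.law t ∂μ :=
  lintegral_compProd_jointKernel μ P _ hf

variable (μ : Measure W) [IsProbabilityMeasure μ] (P : Source X) (Q : Reproduction W X Y)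

theorem lintegral_pastLaw (t : ℕ) {f : (W × Hist Y t) × Hist X (t + 1) → ℝ≥0∞}
    (hf : Measurable f) :
    ∫⁻ p, f p ∂pastLaw μ P Q t =
      ∫⁻ a, ∫⁻ x', f ((a.1, a.2.2), a.2.1.snoc x') ∂P.kernel t a.2.1 ∂jointLaw μ P Q t := by
  unfold pastLaw
  rw [lintegral_map hf (measurable_pastLaw_aux t)]
  exact Measure.lintegral_compProd (hf.comp (measurable_pastLaw_aux t))

theorem lintegral_jointLaw_succ (t : ℕ) {f : W × (Hist X (t + 1) × Hist Y (t + 1)) → ℝ≥0∞}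
    (hf : Measurable f) :
    ∫⁻ a, f a ∂jointLaw μ P Q (t + 1) =
      ∫⁻ p, ∫⁻ y, f (p.1.1, (p.2, p.1.2.snoc y)) ∂Q.kernel t p ∂pastLaw μ P Q t := by
  rw [lintegral_pastLaw μ P Q t (by fun_prop), lintegral_jointLaw μ P Q t (by fun_prop),
    lintegral_jointLaw μ P Q _ hf]
  refine lintegral_congr fun w => ?_
  rw [P.lintegral_law_succ t (by fun_prop)]
  refine lintegral_congr fun x => ?_
  calc ∫⁻ x', ∫⁻ y, f (w, (x.snoc x', y)) ∂Q.causal (t + 1) (w, x.snoc x') ∂P.kernel t x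
      = ∫⁻ x', ∫⁻ y, ∫⁻ y', f (w, (x.snoc x', y.snoc y')) ∂Q.kernel t ((w, y), x.snoc x')
          ∂Q.causal t (w, x) ∂P.kernel t x :=
        lintegral_congr fun x' => Q.lintegral_causal_succ t w _ (by fun_prop)
    _ = _ := lintegral_lintegral_swap
        (Measurable.aemeasurable (by unfold Function.uncurry; fun_prop))

theorem jointLaw_succ (t : ℕ) :
    jointLaw μ P Q (t + 1) = (pastLaw μ P Q t ⊗ₘ Q.kernel t).map (jointEquiv t) := by
  refine Measure.ext_of_lintegral _ fun f hf => ?_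
  rw [lintegral_jointLaw_succ μ P Q t hf, lintegral_map hf (jointEquiv t).measurable]
  exact (Measure.lintegral_compProd (hf.comp (jointEquiv t).measurable)).symm

theorem lintegral_jointLaw_succ_init (t : ℕ) {f : W × (Hist X t × Hist Y t) → ℝ≥0∞}
    (hf : Measurable f) :
    ∫⁻ a, f (a.1, (a.2.1.init, a.2.2.init)) ∂jointLaw μ P Q (t + 1) =
      ∫⁻ a, f a ∂jointLaw μ P Q t := by
  rw [lintegral_jointLaw_succ μ P Q t (by fun_prop)]
  simp only [Hist.init_snoc, lintegral_const, measure_univ, mul_one]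
  rw [lintegral_pastLaw μ P Q t (by fun_prop)]
  simp [Hist.init_snoc]

end Histories

section RelativeEntropy

open InformationTheory

variable {α β : Type*} [MeasurableSpace α] [MeasurableSpace β]

theorem klDiv_map_measurableEquiv (M N : Measure α) [IsFiniteMeasure M] [IsFiniteMeasure N]
    (e : α ≃ᵐ β) : klDiv (M.map e) (N.map e) = klDiv M N := by
  refine le_antisymm (klDiv_map_le _ _ e.measurable) ?_
  have h := klDiv_map_le (M.map e) (N.map e) e.symm.measurable
  rwa [e.map_symm_map, e.map_symm_map] at h

theorem klDiv_compProd_right_eq_add [StandardBorelSpace β] [Nonempty β] (M : Measure (α × β))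
    [IsFiniteMeasure M] (ν : Measure α) [IsFiniteMeasure ν] (κ : Kernel α β) [IsMarkovKernel κ] :
    klDiv M (ν ⊗ₘ κ) = klDiv M.fst ν + klDiv M (M.fst ⊗ₘ κ) := by
  simpa only [M.disintegrate M.condKernel] using klDiv_compProd_eq_add M.fst ν M.condKernel κ

theorem ofReal_klFun_convexCombination_le {a b x y : ℝ≥0∞} (hab : a + b = 1)
    (hx : a * x ≠ ∞) (hy : b * y ≠ ∞) :
    ENNReal.ofReal (klFun (a * x + b * y).toReal) ≤
      a * ENNReal.ofReal (klFun x.toReal) + b * ENNReal.ofReal (klFun y.toReal) := by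
  have ha : a ≠ ∞ := ne_top_of_le_ne_top ENNReal.one_ne_top (hab ▸ le_self_add)
  have hb : b ≠ ∞ := ne_top_of_le_ne_top ENNReal.one_ne_top (hab ▸ le_add_self)
  have habR : a.toReal + b.toReal = 1 := by rw [← ENNReal.toReal_add ha hb, hab, ENNReal.toReal_one]
  have hconv := convexOn_klFun.2 (x := x.toReal) (y := y.toReal) ENNReal.toReal_nonneg
    ENNReal.toReal_nonneg ENNReal.toReal_nonneg ENNReal.toReal_nonneg habR
  simp only [smul_eq_mul, ← ENNReal.toReal_mul, ← ENNReal.toReal_add hx hy] at hconv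
  refine (ENNReal.ofReal_le_ofReal hconv).trans (ENNReal.ofReal_add_le.trans_eq ?_)
  rw [ENNReal.ofReal_mul ENNReal.toReal_nonneg, ENNReal.ofReal_mul ENNReal.toReal_nonneg,
    ENNReal.ofReal_toReal ha, ENNReal.ofReal_toReal hb]

theorem klDiv_add_le (M₁ M₂ N₁ N₂ : Measure α) [IsFiniteMeasure M₁] [IsFiniteMeasure M₂]
    [IsFiniteMeasure N₁] [IsFiniteMeasure N₂] :
    klDiv (M₁ + M₂) (N₁ + N₂) ≤ klDiv M₁ N₁ + klDiv M₂ N₂ := by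
  by_cases h₁ : M₁ ≪ N₁
  swap; · simp [klDiv_of_not_ac h₁]
  by_cases h₂ : M₂ ≪ N₂
  swap; · simp [klDiv_of_not_ac h₂]
  set N := N₁ + N₂ with hN
  have hN₁ : N₁ ≪ N := Measure.absolutelyContinuous_of_le (Measure.le_add_right le_rfl)
  have hN₂ : N₂ ≪ N := Measure.absolutelyContinuous_of_le (Measure.le_add_left le_rfl)
  rw [klDiv_eq_lintegral_klFun_of_ac ((h₁.trans hN₁).add_left (h₂.trans hN₂)),
    klDiv_eq_lintegral_klFun_of_ac h₁,
    klDiv_eq_lintegral_klFun_of_ac h₂, ← lintegral_rnDeriv_mul hN₁ (by fun_prop),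
    ← lintegral_rnDeriv_mul hN₂ (by fun_prop), ← lintegral_add_left (by fun_prop)]
  refine lintegral_mono_ae ?_
  have hweights : N₁.rnDeriv N + N₂.rnDeriv N =ᵐ[N] 1 := by
    filter_upwards [Measure.rnDeriv_add N₁ N₂ N, Measure.rnDeriv_self N] with a hadd hself
    rw [← hadd, ← hN, hself, Pi.one_apply]
  filter_upwards [Measure.rnDeriv_add M₁ M₂ N, Measure.rnDeriv_mul_rnDeriv (κ := N) h₁,
    Measure.rnDeriv_mul_rnDeriv (κ := N) h₂, hweights, Measure.rnDeriv_ne_top M₁ N,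
    Measure.rnDeriv_ne_top M₂ N] with a hadd hmul₁ hmul₂ hw htop₁ htop₂
  rw [Pi.mul_apply, mul_comm] at hmul₁ hmul₂
  rw [hadd, Pi.add_apply, ← hmul₁, ← hmul₂]
  exact ofReal_klFun_convexCombination_le hw (hmul₁ ▸ htop₁) (hmul₂ ▸ htop₂)

theorem rnDeriv_le_rnDeriv_of_le {M M' N : Measure α} [IsFiniteMeasure M] [IsFiniteMeasure M']
    [IsFiniteMeasure N] (h : M' ≤ M) (hac : M ≪ N) : M'.rnDeriv N ≤ᵐ[N] M.rnDeriv N := by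
  refine ae_le_of_forall_setLIntegral_le_of_sigmaFinite (Measure.measurable_rnDeriv _ _)
    fun s _ _ => ?_
  rw [Measure.setLIntegral_rnDeriv hac]
  exact (Measure.setLIntegral_rnDeriv_le s).trans (h s)

theorem klFun_le_add_one {x y : ℝ} (hx : 0 ≤ x) (hxy : x ≤ y) : klFun x ≤ klFun y + 1 := by
  have hmax := convexOn_klFun.le_max_of_mem_Icc (x := 0) (y := y) (z := x) Set.self_mem_Ici
    (hx.trans hxy) ⟨hx, hxy⟩
  rw [klFun_zero] at hmax
  exact hmax.trans (max_le (by linarith [klFun_nonneg (hx.trans hxy)]) (by linarith))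

theorem klDiv_le_add_of_le {M M' N : Measure α} [IsFiniteMeasure M] [IsFiniteMeasure M']
    [IsFiniteMeasure N] (h : M' ≤ M) : klDiv M' N ≤ klDiv M N + N Set.univ := by
  by_cases hac : M ≪ N
  swap; · simp [klDiv_of_not_ac hac]
  rw [klDiv_eq_lintegral_klFun_of_ac hac,
    klDiv_eq_lintegral_klFun_of_ac ((Measure.absolutelyContinuous_of_le h).trans hac),
    ← lintegral_one, ← lintegral_add_left (by fun_prop)]
  refine lintegral_mono_ae ?_
  filter_upwards [rnDeriv_le_rnDeriv_of_le h hac, Measure.rnDeriv_ne_top M N] with a hle htop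
  rw [← ENNReal.ofReal_one, ← ENNReal.ofReal_add (klFun_nonneg ENNReal.toReal_nonneg) zero_le_one]
  exact ENNReal.ofReal_le_ofReal
    (klFun_le_add_one ENNReal.toReal_nonneg (ENNReal.toReal_mono htop hle))

theorem klDiv_ne_top_of_le_smul {M M' N : Measure α} [IsFiniteMeasure M] [IsFiniteMeasure M']
    [IsFiniteMeasure N] {c : ℝ≥0} (h : M' ≤ c • M) (hkl : klDiv M N ≠ ∞) : klDiv M' N ≠ ∞ := by
  suffices klDiv (c • M) N ≠ ∞ from
    ne_top_of_le_ne_top (ENNReal.add_ne_top.mpr ⟨this, measure_ne_top N _⟩) (klDiv_le_add_of_le h)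
  obtain ⟨hac, h_int⟩ := klDiv_ne_top_iff.mp hkl
  rcases eq_or_ne c 0 with rfl | hc
  · simp [klDiv_zero_left]
  have hllr : llr (c • M) N =ᵐ[M] fun a => llr M N a + Real.log c := by
    simpa using llr_smul_left hac c (by simpa using hc) ENNReal.coe_ne_top
  refine klDiv_ne_top (hac.smul_left (c : ℝ≥0∞)) ?_
  exact ((integrable_congr hllr).mpr (h_int.add (integrable_const _))).smul_measure_nnreal

theorem ofReal_klFun_segment_add_indicator_le {ε : ℝ} (h0 : 0 ≤ ε) (h1 : ε ≤ 1) {x : ℝ≥0∞}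
    (hx : x ≠ ∞) :
    ENNReal.ofReal (klFun (ENNReal.ofReal (1 - ε) * x + ENNReal.ofReal ε).toReal) +
      ({0} : Set ℝ≥0∞).indicator (fun _ => ENNReal.ofReal (1 - klFun ε)) x ≤
        ENNReal.ofReal (klFun x.toReal) := by
  by_cases h : x = 0
  · have hle : klFun ε ≤ 1 := by
      rw [klFun_apply]; nlinarith [Real.log_nonpos h0 h1, mul_nonneg h0 h0]
    simp only [h, mul_zero, zero_add, ENNReal.toReal_ofReal h0, Set.indicator_of_mem,
      Set.mem_singleton_iff, ENNReal.toReal_zero, klFun_zero]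
    rw [← ENNReal.ofReal_add (klFun_nonneg h0) (by linarith)]
    simp
  · have hone : ENNReal.ofReal (1 - ε) + ENNReal.ofReal ε = 1 := by
      rw [← ENNReal.ofReal_add (by linarith) h0]; simp
    have hconv := ofReal_klFun_convexCombination_le (x := x) (y := 1) hone (by finiteness)
      (by finiteness)
    simp only [mul_one, ENNReal.toReal_one, klFun_one, ENNReal.ofReal_zero, mul_zero,
      add_zero] at hconv
    rw [Set.indicator_of_notMem (Set.mem_singleton_iff.not.mpr h), add_zero]
    exact hconv.trans (mul_le_of_le_one_left' (hone ▸ le_self_add))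

theorem klDiv_segment_add_le {J m : Measure α} [IsFiniteMeasure J] [IsFiniteMeasure m]
    (hJm : J ≪ m) {ε : ℝ} (h0 : 0 ≤ ε) (h1 : ε ≤ 1) :
    klDiv (ENNReal.ofReal (1 - ε) • J + ENNReal.ofReal ε • m) m +
      ENNReal.ofReal (1 - klFun ε) * m {a | J.rnDeriv m a = 0} ≤ klDiv J m := by
  have hA : MeasurableSet {a | J.rnDeriv m a = 0} :=
    Measure.measurable_rnDeriv J m (measurableSet_singleton 0)
  have : IsFiniteMeasure (ENNReal.ofReal (1 - ε) • J) := Measure.smul_finite _ (by simp)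
  have : IsFiniteMeasure (ENNReal.ofReal ε • m) := Measure.smul_finite _ (by simp)
  rw [klDiv_eq_lintegral_klFun_of_ac
      ((hJm.smul_left _).add_left (Measure.AbsolutelyContinuous.rfl.smul_left _)),
    klDiv_eq_lintegral_klFun_of_ac hJm, ← lintegral_indicator_const hA,
    ← lintegral_add_left (by fun_prop)]
  refine lintegral_mono_ae ?_
  filter_upwards [Measure.rnDeriv_add (ENNReal.ofReal (1 - ε) • J) (ENNReal.ofReal ε • m) m,
    Measure.rnDeriv_smul_left_of_ne_top J m (r := ENNReal.ofReal (1 - ε)) (by simp),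
    Measure.rnDeriv_smul_left_of_ne_top m m (r := ENNReal.ofReal ε) (by simp),
    Measure.rnDeriv_self m, Measure.rnDeriv_ne_top J m] with a hadd hJ hm hself htop
  have hdensity : (ENNReal.ofReal (1 - ε) • J + ENNReal.ofReal ε • m).rnDeriv m a =
      ENNReal.ofReal (1 - ε) * J.rnDeriv m a + ENNReal.ofReal ε := by
    rw [hadd, Pi.add_apply, hJ, hm, Pi.smul_apply, Pi.smul_apply, hself, smul_eq_mul, smul_eq_mul,
      mul_one]
  rw [hdensity]
  exact ofReal_klFun_segment_add_indicator_le h0 h1 htop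

theorem absolutelyContinuous_of_measure_rnDeriv_eq_zero {J m : Measure α}
    [J.HaveLebesgueDecomposition m] (hJm : J ≪ m) (h : m {a | J.rnDeriv m a = 0} = 0) :
    m ≪ J := by
  refine Measure.AbsolutelyContinuous.mk fun s hs hs0 => ?_
  rw [← Measure.withDensity_rnDeriv_eq J m hJm, withDensity_apply _ hs,
    setLIntegral_eq_zero_iff hs (Measure.measurable_rnDeriv J m)] at hs0
  exact measure_mono_null_ae hs0 h

/- Off the support of `dJ/dm` the density of `(1 - ε) J + ε m` is `ε`, and the slope of `klFun`
there tends to `-∞`. -/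
theorem absolutelyContinuous_of_tendsto_klDiv_segment {J m : Measure α} [IsFiniteMeasure J]
    [IsFiniteMeasure m] (hkl : klDiv J m ≠ ∞) {δ : ℝ}
    (hδ : Tendsto (fun ε : ℝ => ((klDiv (ENNReal.ofReal (1 - ε) • J + ENNReal.ofReal ε • m)
      m).toReal - (klDiv J m).toReal) / ε) (𝓝[>] 0) (𝓝 δ)) : m ≪ J := by
  have hJm : J ≪ m := (klDiv_ne_top_iff.mp hkl).1
  refine absolutelyContinuous_of_measure_rnDeriv_eq_zero hJm (by_contra fun hA => ?_)
  set A := {a | J.rnDeriv m a = 0}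
  have hpos : 0 < m.real A := ENNReal.toReal_pos hA (measure_ne_top _ _)
  have hbound : ∀ᶠ ε in 𝓝[>] (0 : ℝ), ((klDiv (ENNReal.ofReal (1 - ε) • J + ENNReal.ofReal ε • m)
      m).toReal - (klDiv J m).toReal) / ε ≤ m.real A * (Real.log ε - 1) := by
    filter_upwards [Ioo_mem_nhdsGT one_pos] with ε hε
    have hle := ENNReal.toReal_mono hkl (klDiv_segment_add_le hJm hε.1.le hε.2.le)
    have hmul : (ENNReal.ofReal (1 - klFun ε) * m A).toReal =
        -(m.real A * (Real.log ε - 1)) * ε := by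
      have : 0 ≤ 1 - klFun ε := by
        rw [klFun_apply]; nlinarith [Real.log_nonpos hε.1.le hε.2.le, hε.1]
      rw [ENNReal.toReal_mul, ENNReal.toReal_ofReal this, ← measureReal_def, klFun_apply]
      ring
    rw [ENNReal.toReal_add (ne_top_of_le_ne_top hkl (le_self_add.trans
      (klDiv_segment_add_le hJm hε.1.le hε.2.le))) (by finiteness), hmul] at hle
    rw [div_le_iff₀ hε.1]
    linarith
  have hbot : Tendsto (fun ε : ℝ => m.real A * (Real.log ε - 1)) (𝓝[>] 0) atBot :=
    (tendsto_atBot_add_const_right _ _ Real.tendsto_log_nhdsGT_zero).const_mul_atBot hpos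
  exact not_tendsto_nhds_of_tendsto_atBot (tendsto_atBot_mono' _ hbound hbot) δ hδ

end RelativeEntropy

section Laws

open InformationTheory

variable {W : Type w} {X : ℕ → Type u} {Y : ℕ → Type v} [MeasurableSpace W]
  [∀ t, MeasurableSpace (X t)] [∀ t, MeasurableSpace (Y t)]

theorem Source.nonempty_hist (P : Source X) (t : ℕ) : Nonempty (Hist X t) :=
  nonempty_of_isProbabilityMeasure (P.law t)

instance Hist.instStandardBorelSpace [∀ t, StandardBorelSpace (X t)] :
    ∀ t, StandardBorelSpace (Hist X t)
  | 0 => (inferInstance : StandardBorelSpace PUnit)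
  | t + 1 =>
    haveI := Hist.instStandardBorelSpace t
    (inferInstance : StandardBorelSpace (Hist X t × X t))

section Kernels

variable (μ : Measure W) (P : Source X) {N : ℕ} (K : Kernel (W × Hist X N) (Hist Y N))
  [IsMarkovKernel K]

instance : IsMarkovKernel (jointKernel P K) := by unfold jointKernel; infer_instance

instance : IsMarkovKernel (outputLaw P K) := by unfold outputLaw; infer_instance

instance : IsMarkovKernel (productKernel P K) := by unfold productKernel; infer_instance

theorem map_compProd_jointKernel [SFinite μ] :
    (μ ⊗ₘ jointKernel P K).map (fun a => (a.1, a.2.2)) = μ ⊗ₘ outputLaw P K := by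
  refine Measure.ext_of_lintegral _ fun f hf => ?_
  rw [lintegral_map hf (by fun_prop), Measure.lintegral_compProd (by fun_prop),
    Measure.lintegral_compProd hf]
  exact lintegral_congr fun w => (Kernel.lintegral_snd _ w
    (hf.comp measurable_prodMk_left)).symm

/-- The rearrangement `(y^{-1}, x^{N-1}, y_0^{N-1}) ↦ (y^{N-1}, x^{N-1})`, which turns the law
`μ ⊗ (P × Π)` into a product measure. -/
def outputEquiv (N : ℕ) :
    (W × (Hist X N × Hist Y N)) ≃ᵐ ((W × Hist Y N) × Hist X N) where
  toFun a := ((a.1, a.2.2), a.2.1)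
  invFun b := (b.1.1, (b.2, b.1.2))
  left_inv _ := rfl
  right_inv _ := rfl
  measurable_toFun := (by fun_prop : Measurable fun a : W × (Hist X N × Hist Y N) =>
    ((a.1, a.2.2), a.2.1))
  measurable_invFun := (by fun_prop : Measurable fun b : (W × Hist Y N) × Hist X N =>
    (b.1.1, (b.2, b.1.2)))

theorem productKernel_eq_jointKernel :
    productKernel P K = jointKernel P ((outputLaw P K).comap Prod.fst measurable_fst) := by
  refine Kernel.ext fun w => Measure.ext_of_lintegral _ fun f hf => ?_
  unfold productKernel jointKernel
  rw [Kernel.prod_apply, lintegral_prod _ hf.aemeasurable, Kernel.lintegral_compProd _ _ _ hf]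
  rfl

theorem lintegral_compProd_productKernel [SFinite μ] {f : W × (Hist X N × Hist Y N) → ℝ≥0∞}
    (hf : Measurable f) :
    ∫⁻ a, f a ∂(μ ⊗ₘ productKernel P K) =
      ∫⁻ q, ∫⁻ x, f (q.1, (x, q.2)) ∂P.law N ∂(μ ⊗ₘ outputLaw P K) := by
  rw [Measure.lintegral_compProd hf, Measure.lintegral_compProd (by fun_prop)]
  unfold productKernel
  refine lintegral_congr fun w => ?_
  rw [Kernel.prod_apply, Kernel.const_apply, lintegral_prod_symm' _ (by fun_prop)]

theorem map_compProd_productKernel [SFinite μ] :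
    (μ ⊗ₘ productKernel P K).map (outputEquiv N) = (μ ⊗ₘ outputLaw P K).prod (P.law N) := by
  refine Measure.ext_of_lintegral _ fun f hf => ?_
  rw [lintegral_map hf (outputEquiv N).measurable, lintegral_prod _ hf.aemeasurable]
  exact lintegral_compProd_productKernel μ P K (hf.comp (outputEquiv N).measurable)

theorem compProd_productKernel [SFinite μ] : μ ⊗ₘ productKernel P K =
    ((μ ⊗ₘ outputLaw P K).prod (P.law N)).map (outputEquiv N).symm := by
  rw [← map_compProd_productKernel, MeasurableEquiv.map_symm_map]

theorem info_le_klDiv [∀ t, StandardBorelSpace (X t)]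
    [IsProbabilityMeasure μ] (K' : Kernel (W × Hist X N) (Hist Y N)) [IsMarkovKernel K'] :
    info μ P K ≤ klDiv (μ ⊗ₘ jointKernel P K) (μ ⊗ₘ productKernel P K') := by
  have := P.nonempty_hist N
  set J := (μ ⊗ₘ jointKernel P K).map (outputEquiv N)
  have : IsProbabilityMeasure J :=
    Measure.isProbabilityMeasure_map (outputEquiv N).measurable.aemeasurable
  have hJ : J.fst = μ ⊗ₘ outputLaw P K := by
    rw [← map_compProd_jointKernel, Measure.fst,
      Measure.map_map measurable_fst (outputEquiv N).measurable]
    rfl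
  have hchain (K' : Kernel (W × Hist X N) (Hist Y N)) [IsMarkovKernel K'] :
      klDiv (μ ⊗ₘ jointKernel P K) (μ ⊗ₘ productKernel P K') =
        klDiv J.fst (μ ⊗ₘ outputLaw P K') + klDiv J (J.fst.prod (P.law N)) := by
    rw [← klDiv_map_measurableEquiv _ _ (outputEquiv N), map_compProd_productKernel,
      ← Measure.compProd_const, klDiv_compProd_right_eq_add, Measure.compProd_const]
  rw [info, hchain K, hchain K', hJ, klDiv_self, zero_add]
  exact le_add_self

end Kernels

section JointLaws

theorem jointLaw_zero (μ : Measure W) (P : Source X) (Q Q' : Reproduction W X Y) :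
    jointLaw μ P Q 0 = jointLaw μ P Q' 0 := rfl

theorem pastLaw_eq_map (μ : Measure W) (P : Source X) (Q : Reproduction W X Y) (t : ℕ) :
    pastLaw μ P Q t = (jointLaw μ P Q t ⊗ₘ
      (P.kernel t).comap (fun a => a.2.1) (by fun_prop)).map (pastEquiv t) := rfl

variable {μ : Measure W} [IsProbabilityMeasure μ] {P : Source X} {Q Q' : Reproduction W X Y} {t : ℕ}

theorem pastLaw_congr {μ : Measure W} (h : jointLaw μ P Q t = jointLaw μ P Q' t) :
    pastLaw μ P Q t = pastLaw μ P Q' t := by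
  unfold pastLaw
  rw [h]

variable (μ P Q t) in
theorem jointLaw_succ_map_init :
    (jointLaw μ P Q (t + 1)).map (fun a => (a.1, (a.2.1.init, a.2.2.init))) =
      jointLaw μ P Q t := by
  refine Measure.ext_of_lintegral _ fun f hf => ?_
  rw [lintegral_map hf (by fun_prop), lintegral_jointLaw_succ_init μ P Q t hf]

variable (μ P Q Q' t) in
theorem klDiv_jointLaw_succ :
    klDiv (jointLaw μ P Q (t + 1)) (jointLaw μ P Q' (t + 1)) =
      klDiv (jointLaw μ P Q t) (jointLaw μ P Q' t) +
        klDiv (pastLaw μ P Q t ⊗ₘ Q.kernel t) (pastLaw μ P Q t ⊗ₘ Q'.kernel t) := by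
  rw [jointLaw_succ, jointLaw_succ, klDiv_map_measurableEquiv, klDiv_compProd_eq_add,
    pastLaw_eq_map μ P Q, pastLaw_eq_map μ P Q', klDiv_map_measurableEquiv, klDiv_compProd_left]

theorem pastLaw_absolutelyContinuous (h : jointLaw μ P Q t ≪ jointLaw μ P Q' t) :
    pastLaw μ P Q t ≪ pastLaw μ P Q' t := by
  rw [pastLaw_eq_map, pastLaw_eq_map]
  exact (h.compProd_left _).map (pastEquiv t).measurable

theorem jointLaw_absolutelyContinuous_of_le {N : ℕ} (htN : t ≤ N)
    (h : jointLaw μ P Q N ≪ jointLaw μ P Q' N) : jointLaw μ P Q t ≪ jointLaw μ P Q' t := by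
  induction N, htN using Nat.le_induction with
  | base => exact h
  | succ N _ ih =>
    refine ih ?_
    rw [← jointLaw_succ_map_init μ P Q N, ← jointLaw_succ_map_init μ P Q' N]
    exact h.map (by fun_prop)

end JointLaws

section Output

/-- The reproduction that draws the output at time `t` from `Pi t`, whatever the source. -/
def sourceFreeRep (Pi : ∀ t, Kernel (W × Hist Y t) (Y t)) [∀ t, IsMarkovKernel (Pi t)] :
    Reproduction W X Y where
  kernel t := (Pi t).comap Prod.fst measurable_fst
  markov _ := inferInstance

theorem sourceFreeRep_kernel_apply (Pi : ∀ t, Kernel (W × Hist Y t) (Y t))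
    [∀ t, IsMarkovKernel (Pi t)] (t : ℕ) (p : (W × Hist Y t) × Hist X (t + 1)) :
    (sourceFreeRep Pi : Reproduction W X Y).kernel t p = Pi t p.1 := rfl

variable [∀ t, StandardBorelSpace (Y t)] [∀ t, Nonempty (Y t)] (μ : Measure W)
  [IsProbabilityMeasure μ] (P : Source X) (Q : Reproduction W X Y)

instance (t : ℕ) : IsMarkovKernel (outputKernel μ P Q t) := by
  unfold outputKernel; infer_instance

theorem map_compProd_outputLaw_causal_succ (t : ℕ) :
    (μ ⊗ₘ outputLaw P (Q.causal (t + 1))).map (fun q => ((q.1, q.2.init), q.2.last)) =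
      (μ ⊗ₘ outputLaw P (Q.causal t)) ⊗ₘ outputKernel μ P Q t := by
  have hinit : (jointLaw μ P Q (t + 1)).map (fun a => (a.1, a.2.2.init)) =
      μ ⊗ₘ outputLaw P (Q.causal t) := by
    rw [← map_compProd_jointKernel, ← jointLaw, ← jointLaw_succ_map_init μ P Q t,
      Measure.map_map (by fun_prop) (by fun_prop)]
    rfl
  rw [← map_compProd_jointKernel, ← hinit, Measure.map_map (by fun_prop) (by fun_prop)]
  exact (compProd_map_condDistrib (by fun_prop)).symm

theorem lintegral_compProd_outputLaw_causal_succ (t : ℕ) {f : W × Hist Y (t + 1) → ℝ≥0∞}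
    (hf : Measurable f) :
    ∫⁻ q, f q ∂(μ ⊗ₘ outputLaw P (Q.causal (t + 1))) =
      ∫⁻ q, ∫⁻ y, f (extend q y) ∂outputKernel μ P Q t q ∂(μ ⊗ₘ outputLaw P (Q.causal t)) := by
  have hf' : Measurable fun r : (W × Hist Y t) × Y t => f (extend r.1 r.2) := by
    unfold extend; fun_prop
  rw [← Measure.lintegral_compProd hf', ← map_compProd_outputLaw_causal_succ,
    lintegral_map hf' (by fun_prop)]
  rfl

/-- The reproduction that draws each output from the output kernel of `Q`, whatever the source.
Its joint law is the product of the source law and the output law of `Q`. -/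
abbrev outputRep : Reproduction W X Y := sourceFreeRep (outputKernel μ P Q)

theorem lintegral_jointLaw_outputRep (t : ℕ) {f : W × (Hist X t × Hist Y t) → ℝ≥0∞}
    (hf : Measurable f) :
    ∫⁻ a, f a ∂jointLaw μ P (outputRep μ P Q) t =
      ∫⁻ q, ∫⁻ x, f (q.1, (x, q.2)) ∂P.law t ∂(μ ⊗ₘ outputLaw P (Q.causal t)) := by
  induction t with
  | zero =>
    rw [lintegral_jointLaw μ P _ 0 hf, ← map_compProd_jointKernel, lintegral_map (by fun_prop)
      (by fun_prop), lintegral_compProd_jointKernel μ P _ (by fun_prop)]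
    simp_rw [P.lintegral_law_zero, Reproduction.lintegral_causal_zero]
  | succ t ih =>
    rw [lintegral_jointLaw_succ μ P _ t hf]
    simp_rw [sourceFreeRep_kernel_apply]
    rw [lintegral_pastLaw μ P _ t (by fun_prop), ih (by fun_prop),
      lintegral_compProd_outputLaw_causal_succ μ P Q t (by fun_prop)]
    refine lintegral_congr fun q => ?_
    rw [← P.lintegral_law_succ t (f := fun x => ∫⁻ y, f (q.1, (x, q.2.snoc y))
      ∂outputKernel μ P Q t q) (by fun_prop)]
    exact lintegral_lintegral_swap (Measurable.aemeasurable (by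
      unfold Function.uncurry; fun_prop))

theorem jointLaw_outputRep (t : ℕ) :
    jointLaw μ P (outputRep μ P Q) t = μ ⊗ₘ productKernel P (Q.causal t) := by
  refine Measure.ext_of_lintegral _ fun f hf => ?_
  rw [lintegral_jointLaw_outputRep μ P Q t hf, lintegral_compProd_productKernel μ P _ hf]

theorem info_eq_klDiv_jointLaw (t : ℕ) :
    info μ P (Q.causal t) = klDiv (jointLaw μ P Q t) (jointLaw μ P (outputRep μ P Q) t) := by
  rw [jointLaw_outputRep]
  rfl

variable [∀ t, StandardBorelSpace (X t)]

theorem info_le_klDiv_jointLaw (Q' : Reproduction W X Y) (t : ℕ) :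
    info μ P (Q'.causal t) ≤ klDiv (jointLaw μ P Q' t) (jointLaw μ P (outputRep μ P Q) t) := by
  rw [jointLaw_outputRep]
  exact info_le_klDiv μ P _ _

theorem info_outputRep (t : ℕ) : info μ P ((outputRep μ P Q).causal t) = 0 := by
  simpa using info_le_klDiv_jointLaw μ P Q (outputRep μ P Q) t

end Output

end Laws

section Mixtures

open InformationTheory

section Kernel

variable {α β : Type*} [MeasurableSpace α] [MeasurableSpace β] (ε : ℝ) (K L : Kernel α β)

theorem mix_apply (a : α) :
    mix ε K L a = ENNReal.ofReal (1 - ε) • K a + ENNReal.ofReal ε • L a := rfl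

theorem mix_zero : mix 0 K L = K := by
  ext a : 1
  simp [mix_apply]

theorem isMarkovKernel_mix {ε : ℝ} (h0 : 0 ≤ ε) (h1 : ε ≤ 1) [IsMarkovKernel K]
    [IsMarkovKernel L] : IsMarkovKernel (mix ε K L) := by
  refine ⟨fun a => ⟨?_⟩⟩
  simp [mix_apply, ← ENNReal.ofReal_add (sub_nonneg.mpr h1) h0]

instance [IsFiniteKernel K] [IsFiniteKernel L] : IsFiniteKernel (mix ε K L) := by
  refine ⟨⟨ENNReal.ofReal (1 - ε) * K.bound + ENNReal.ofReal ε * L.bound,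
    ENNReal.add_lt_top.mpr ⟨ENNReal.mul_lt_top ENNReal.ofReal_lt_top K.bound_lt_top,
      ENNReal.mul_lt_top ENNReal.ofReal_lt_top L.bound_lt_top⟩, fun a => ?_⟩⟩
  simp only [mix_apply, Measure.coe_add, Measure.coe_smul, Pi.add_apply, Pi.smul_apply,
    smul_eq_mul]
  gcongr <;> exact Kernel.measure_le_bound _ _ _

theorem compProd_mix (μ : Measure α) [SFinite μ] [IsFiniteKernel K] [IsFiniteKernel L] :
    μ ⊗ₘ mix ε K L = ENNReal.ofReal (1 - ε) • (μ ⊗ₘ K) + ENNReal.ofReal ε • (μ ⊗ₘ L) := by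
  refine Measure.ext_of_lintegral _ fun f hf => ?_
  simp only [lintegral_add_measure, lintegral_smul_measure, Measure.lintegral_compProd hf,
    mix_apply, smul_eq_mul]
  rw [lintegral_add_left (by fun_prop), lintegral_const_mul _ (by fun_prop),
    lintegral_const_mul _ (by fun_prop)]

end Kernel

variable {W : Type w} {X : ℕ → Type u} {Y : ℕ → Type v} [MeasurableSpace W]
  [∀ t, MeasurableSpace (X t)] [∀ t, MeasurableSpace (Y t)]

section Laws

variable (μ : Measure W) (P : Source X) {N : ℕ} (ε : ℝ) (K L : Kernel (W × Hist X N) (Hist Y N))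

theorem compProd_jointKernel [SFinite μ] [IsSFiniteKernel K] :
    μ ⊗ₘ jointKernel P K = ((μ.prod (P.law N)) ⊗ₘ K).map MeasurableEquiv.prodAssoc := by
  rw [← Measure.compProd_const, Measure.compProd_assoc', jointKernel]

theorem compProd_jointKernel_mix [SFinite μ] [IsFiniteKernel K] [IsFiniteKernel L] :
    μ ⊗ₘ jointKernel P (mix ε K L) = ENNReal.ofReal (1 - ε) • (μ ⊗ₘ jointKernel P K) +
      ENNReal.ofReal ε • (μ ⊗ₘ jointKernel P L) := by
  simp only [compProd_jointKernel, compProd_mix]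
  rw [Measure.map_add _ _ (by fun_prop), Measure.map_smul, Measure.map_smul]

variable {ε} [IsMarkovKernel K] [IsMarkovKernel L]

theorem compProd_outputLaw_mix [SFinite μ] (h0 : 0 ≤ ε) (h1 : ε ≤ 1) :
    μ ⊗ₘ outputLaw P (mix ε K L) = ENNReal.ofReal (1 - ε) • (μ ⊗ₘ outputLaw P K) +
      ENNReal.ofReal ε • (μ ⊗ₘ outputLaw P L) := by
  have := isMarkovKernel_mix K L h0 h1
  simp only [← map_compProd_jointKernel, compProd_jointKernel_mix]
  rw [Measure.map_add _ _ (by fun_prop), Measure.map_smul, Measure.map_smul]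

theorem compProd_productKernel_mix [IsFiniteMeasure μ] (h0 : 0 ≤ ε) (h1 : ε ≤ 1) :
    μ ⊗ₘ productKernel P (mix ε K L) = ENNReal.ofReal (1 - ε) • (μ ⊗ₘ productKernel P K) +
      ENNReal.ofReal ε • (μ ⊗ₘ productKernel P L) := by
  have := isMarkovKernel_mix K L h0 h1
  simp only [compProd_productKernel, compProd_outputLaw_mix μ P K L h0 h1]
  rw [Measure.add_prod, Measure.prod_smul_left, Measure.prod_smul_left,
    Measure.map_add _ _ (outputEquiv N).symm.measurable, Measure.map_smul, Measure.map_smul]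

theorem info_mix_le [IsFiniteMeasure μ] (h0 : 0 ≤ ε) (h1 : ε ≤ 1) :
    info μ P (mix ε K L) ≤ ENNReal.ofReal (1 - ε) * info μ P K + ENNReal.ofReal ε * info μ P L := by
  unfold info
  rw [compProd_jointKernel_mix, compProd_productKernel_mix μ P K L h0 h1]
  exact (klDiv_add_le (((1 - ε).toNNReal : ℝ≥0) • _) (ε.toNNReal • _) ((1 - ε).toNNReal • _)
    (ε.toNNReal • _)).trans_eq (congrArg₂ _ (klDiv_smul_same _) (klDiv_smul_same _))

end Laws

theorem Reproduction.causal_succ_map_init (Q : Reproduction W X Y) (t : ℕ) (w : W)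
    (x : Hist X (t + 1)) : (Q.causal (t + 1) (w, x)).map Hist.init = Q.causal t (w, x.init) := by
  refine Measure.ext_of_lintegral _ fun f hf => ?_
  rw [lintegral_map hf (by fun_prop), Q.lintegral_causal_succ t w x (by fun_prop)]
  simp [Hist.init_snoc]

section Reproductions

variable [∀ t, StandardBorelSpace (Y t)] [∀ t, Nonempty (Y t)]

theorem exists_reproduction_of_consistent
    (K : ∀ t, Kernel (W × Hist X t) (Hist Y t)) [∀ t, IsMarkovKernel (K t)]
    (hK : ∀ t (w : W) (x : Hist X (t + 1)),
      (K (t + 1) (w, x)).map Hist.init = K t (w, x.init)) :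
    ∃ Q : Reproduction W X Y, ∀ t, Q.causal t = K t := by
  let K' (t : ℕ) : Kernel (W × Hist X (t + 1)) (Hist Y t × Y t) := K (t + 1)
  have (t : ℕ) : IsMarkovKernel (K' t) := inferInstanceAs (IsMarkovKernel (K (t + 1)))
  let Q : Reproduction W X Y :=
    { kernel := fun t => (K' t).condKernel.comap
        (fun p : (W × Hist Y t) × Hist X (t + 1) => ((p.1.1, p.2), p.1.2)) (by fun_prop)
      markov := fun t => inferInstance }
  refine ⟨Q, fun t => ?_⟩
  induction t with
  | zero =>
    have : Subsingleton (Hist Y 0) := inferInstanceAs (Subsingleton PUnit)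
    exact Kernel.ext fun a => Measure.ext fun s _ =>
      Subsingleton.set_cases (p := fun s => Q.causal 0 a s = K 0 a s) (by simp) (by simp) s
  | succ t ih =>
    have hfst : (K' t).fst = (Q.causal t).comap (fun a : W × Hist X (t + 1) => (a.1, a.2.init))
        (by fun_prop) := by
      ext a : 1
      rw [ih, Kernel.fst_apply, Kernel.comap_apply]
      exact hK t a.1 a.2
    refine Eq.trans ?_ ((K' t).disintegrate (K' t).condKernel)
    rw [hfst]
    rfl

theorem exists_reproduction_mix {ε : ℝ} (h0 : 0 ≤ ε) (h1 : ε ≤ 1) (Q₁ Q₂ : Reproduction W X Y) :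
    ∃ Q : Reproduction W X Y, ∀ t, Q.causal t = mix ε (Q₁.causal t) (Q₂.causal t) := by
  have (t : ℕ) : IsMarkovKernel (mix ε (Q₁.causal t) (Q₂.causal t)) :=
    isMarkovKernel_mix _ _ h0 h1
  refine exists_reproduction_of_consistent _ fun t w x => ?_
  rw [mix_apply, mix_apply, Measure.map_add _ _ (by fun_prop), Measure.map_smul, Measure.map_smul,
    Q₁.causal_succ_map_init, Q₂.causal_succ_map_init]

variable (μ : Measure W) [IsProbabilityMeasure μ] (P : Source X) (Q : Reproduction W X Y)

theorem outputRep_boundedDensity (N : ℕ) :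
    BoundedDensity μ P (Q.causal N) ((outputRep μ P Q).causal N) := by
  refine ⟨1, ?_⟩
  have hjoint : (μ.prod (P.law N)) ⊗ₘ (outputRep μ P Q).causal N =
      (μ.prod (P.law N)) ⊗ₘ (outputLaw P (Q.causal N)).comap Prod.fst measurable_fst := by
    refine MeasurableEquiv.prodAssoc.map_measurableEquiv_injective ?_
    rw [← compProd_jointKernel, ← compProd_jointKernel, ← jointLaw, jointLaw_outputRep,
      productKernel_eq_jointKernel]
  filter_upwards [Kernel.ae_eq_of_compProd_eq hjoint] with a ha
  simp [ha]

theorem compProd_outputLaw_outputRep (N : ℕ) :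
    μ ⊗ₘ outputLaw P ((outputRep μ P Q).causal N) = μ ⊗ₘ outputLaw P (Q.causal N) := by
  rw [← map_compProd_jointKernel, ← jointLaw, jointLaw_outputRep, compProd_productKernel,
    Measure.map_map (by fun_prop) (outputEquiv N).symm.measurable]
  exact Measure.fst_prod

theorem info_mix_outputRep {ε : ℝ} (h0 : 0 ≤ ε) (h1 : ε ≤ 1) (N : ℕ) :
    info μ P (mix ε (Q.causal N) ((outputRep μ P Q).causal N)) =
      klDiv (ENNReal.ofReal (1 - ε) • jointLaw μ P Q N +
        ENNReal.ofReal ε • jointLaw μ P (outputRep μ P Q) N)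
        (jointLaw μ P (outputRep μ P Q) N) := by
  have hprod : μ ⊗ₘ productKernel P ((outputRep μ P Q).causal N) =
      μ ⊗ₘ productKernel P (Q.causal N) := by
    rw [compProd_productKernel, compProd_productKernel, compProd_outputLaw_outputRep]
  unfold info
  rw [compProd_productKernel_mix μ P _ _ h0 h1, hprod, ← add_smul,
    ← ENNReal.ofReal_add (sub_nonneg.mpr h1) h0, sub_add_cancel, ENNReal.ofReal_one, one_smul,
    compProd_jointKernel_mix, jointLaw_outputRep, jointLaw, ← jointLaw_outputRep, jointLaw]

variable {μ P Q} {n : ℕ}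

theorem GateauxDifferentiableAt.info_ne_top (h : GateauxDifferentiableAt μ P n Q) :
    info μ P (Q.causal (n + 1)) ≠ ∞ := by
  simpa only [mix_zero] using (h _ (outputRep_boundedDensity μ P Q (n + 1))).1.self_of_nhdsWithin
    (Set.mem_Ici.mpr le_rfl)

theorem GateauxDifferentiableAt.absolutelyContinuous (h : GateauxDifferentiableAt μ P n Q) :
    jointLaw μ P (outputRep μ P Q) (n + 1) ≪ jointLaw μ P Q (n + 1) := by
  obtain ⟨-, δ, hδ⟩ := h _ (outputRep_boundedDensity μ P Q (n + 1))
  have hI := h.info_ne_top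
  rw [info_eq_klDiv_jointLaw] at hI
  refine absolutelyContinuous_of_tendsto_klDiv_segment hI (hδ.congr' ?_)
  filter_upwards [Ioo_mem_nhdsGT one_pos] with ε hε
  rw [info_eq_klDiv_jointLaw, info_mix_outputRep μ P Q hε.1.le hε.2.le]

end Reproductions

end Mixtures

section Multiplier

theorem chord_slope_le_of_convex {S : Set (ℝ × ℝ)} {B R : ℝ} (hS : Convex ℝ S)
    (hR : ∀ p ∈ S, p.1 ≤ B → R ≤ p.2) {p q : ℝ × ℝ} (hp : p ∈ S) (hpB : p.1 < B) (hq : q ∈ S)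
    (hqB : B < q.1) : (R - q.2) / (q.1 - B) ≤ (p.2 - R) / (B - p.1) := by
  have hpos : 0 < q.1 - p.1 := by linarith
  have hmem := hS hp hq (a := (q.1 - B) / (q.1 - p.1)) (b := (B - p.1) / (q.1 - p.1))
    (div_nonneg (by linarith) hpos.le) (div_nonneg (by linarith) hpos.le) (by field_simp; ring)
  have hle := hR _ hmem <| by
    simp only [Prod.fst_add, Prod.smul_fst, smul_eq_mul]
    exact le_of_eq (by field_simp; ring)
  simp only [Prod.snd_add, Prod.smul_snd, smul_eq_mul] at hle
  rw [div_mul_eq_mul_div, div_mul_eq_mul_div, ← add_div, le_div_iff₀ hpos] at hle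
  rw [div_le_div_iff₀ (by linarith) (by linarith)]
  linarith

theorem exists_pos_multiplier_of_convex {S : Set (ℝ × ℝ)} {B R : ℝ} (hS : Convex ℝ S)
    (hR : ∀ p ∈ S, p.1 ≤ B → R ≤ p.2) (hslater : ∃ p ∈ S, p.1 < B) (hlt : ∃ p ∈ S, p.2 < R) :
    ∃ m > 0, ∀ p ∈ S, R + m * B ≤ p.2 + m * p.1 := by
  obtain ⟨p₀, hp₀, hp₀B⟩ := hslater
  obtain ⟨p₁, hp₁, hp₁R⟩ := hlt
  have hp₁B : B < p₁.1 := not_le.mp fun h => (hR p₁ hp₁ h).not_gt hp₁R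
  let slopes : Set ℝ := (fun p : ℝ × ℝ => (p.2 - R) / (B - p.1)) '' {p ∈ S | p.1 < B}
  have hne : slopes.Nonempty := ⟨_, p₀, ⟨hp₀, hp₀B⟩, rfl⟩
  have hbdd : BddBelow slopes := ⟨0, by
    rintro _ ⟨p, ⟨hp, hpB⟩, rfl⟩
    exact div_nonneg (sub_nonneg.mpr (hR p hp hpB.le)) (sub_nonneg.mpr hpB.le)⟩
  have hslope_le {q : ℝ × ℝ} (hq : q ∈ S) (hqB : B < q.1) :
      (R - q.2) / (q.1 - B) ≤ sInf slopes := le_csInf hne <| by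
    rintro _ ⟨p, ⟨hp, hpB⟩, rfl⟩
    exact chord_slope_le_of_convex hS hR hp hpB hq hqB
  refine ⟨sInf slopes, (div_pos (by linarith) (by linarith)).trans_le (hslope_le hp₁ hp₁B),
    fun p hp => ?_⟩
  rcases lt_trichotomy p.1 B with h | h | h
  · have := csInf_le hbdd ⟨p, ⟨hp, h⟩, rfl⟩
    rw [le_div_iff₀ (by linarith)] at this
    linarith
  · have := hR p hp h.le
    rw [h]
    linarith
  · have := hslope_le hp h
    rw [div_le_iff₀ (by linarith)] at this
    linarith

variable {W : Type w} {X : ℕ → Type u} {Y : ℕ → Type v} [MeasurableSpace W]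
  [∀ t, MeasurableSpace (X t)] [∀ t, MeasurableSpace (Y t)]

@[fun_prop]
theorem Distortion.measurable_total (d : Distortion X Y) (t : ℕ) :
    Measurable fun q : Hist X t × Hist Y t => d.total t q.1 q.2 := by
  induction t with
  | zero => exact measurable_const
  | succ t ih =>
    exact (ih.comp (by fun_prop : Measurable fun q : Hist X (t + 1) × Hist Y (t + 1) =>
      (q.1.init, q.2.init))).add (d.measurable t)

variable {μ : Measure W} {P : Source X} {d : Distortion X Y} {n : ℕ} {D : ℝ≥0}

theorem feasible_iff {Q : Reproduction W X Y} :
    Feasible μ P d n D Q ↔ expectedDistortion μ P d n Q ≤ ((n : ℝ≥0∞) + 1) * D := by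
  unfold Feasible
  rw [mul_comm, ← div_eq_mul_inv, ENNReal.div_le_iff' (by simp) (by simp)]

theorem Feasible.nrdf_le_info {Q : Reproduction W X Y} (h : Feasible μ P d n D Q) :
    nrdf μ P d n D ≤ info μ P (Q.causal (n + 1)) :=
  iInf₂_le Q h

theorem expectedDistortion_mix [SFinite μ] {ε : ℝ} {Q Q₁ Q₂ : Reproduction W X Y}
    (h : Q.causal (n + 1) = mix ε (Q₁.causal (n + 1)) (Q₂.causal (n + 1))) :
    expectedDistortion μ P d n Q = ENNReal.ofReal (1 - ε) * expectedDistortion μ P d n Q₁ +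
      ENNReal.ofReal ε * expectedDistortion μ P d n Q₂ := by
  unfold expectedDistortion jointLaw
  rw [h, compProd_jointKernel_mix, lintegral_add_measure, lintegral_smul_measure,
    lintegral_smul_measure, smul_eq_mul, smul_eq_mul]

variable (μ P d n) in
/-- The set of pairs `(e, r)` such that some causal reproduction has expected total distortion at
most `e` and information at most `r`. -/
def achievableSet : Set (ℝ × ℝ) :=
  {p | 0 ≤ p.1 ∧ 0 ≤ p.2 ∧ ∃ Q : Reproduction W X Y,
    expectedDistortion μ P d n Q ≤ ENNReal.ofReal p.1 ∧
      info μ P (Q.causal (n + 1)) ≤ ENNReal.ofReal p.2}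

theorem mem_achievableSet_toReal {Q : Reproduction W X Y} (hE : expectedDistortion μ P d n Q ≠ ∞)
    (hI : info μ P (Q.causal (n + 1)) ≠ ∞) :
    ((expectedDistortion μ P d n Q).toReal, (info μ P (Q.causal (n + 1))).toReal) ∈
      achievableSet μ P d n :=
  ⟨ENNReal.toReal_nonneg, ENNReal.toReal_nonneg, Q, (ENNReal.ofReal_toReal hE).ge,
    (ENNReal.ofReal_toReal hI).ge⟩

theorem convex_achievableSet [∀ t, StandardBorelSpace (Y t)] [∀ t, Nonempty (Y t)]
    [IsProbabilityMeasure μ] : Convex ℝ (achievableSet μ P d n) := by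
  rintro p ⟨hp₁, hp₂, Q₁, hE₁, hI₁⟩ q ⟨hq₁, hq₂, Q₂, hE₂, hI₂⟩ a b ha hb hab
  obtain rfl : a = 1 - b := by linarith
  obtain ⟨Q, hQ⟩ := exists_reproduction_mix hb (sub_nonneg.mp ha) Q₁ Q₂
  have hcombo {u v : ℝ} (hu : 0 ≤ u) (hv : 0 ≤ v) : ENNReal.ofReal ((1 - b) * u + b * v) =
      ENNReal.ofReal (1 - b) * ENNReal.ofReal u + ENNReal.ofReal b * ENNReal.ofReal v := by
    rw [ENNReal.ofReal_add (by positivity) (by positivity), ENNReal.ofReal_mul ha,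
      ENNReal.ofReal_mul hb]
  simp only [achievableSet, Set.mem_ofPred_eq, Prod.fst_add, Prod.snd_add, Prod.smul_fst,
    Prod.smul_snd, smul_eq_mul]
  refine ⟨by positivity, by positivity, Q, ?_, ?_⟩
  · rw [expectedDistortion_mix (hQ (n + 1)), hcombo hp₁ hq₁]
    gcongr
  · rw [hQ, hcombo hp₂ hq₂]
    exact (info_mix_le μ P _ _ hb (sub_nonneg.mp ha)).trans (by gcongr)

theorem exists_isLagrangeMultiplier_of_slater [∀ t, StandardBorelSpace (Y t)]
    [∀ t, Nonempty (Y t)] [IsProbabilityMeasure μ] (hR : nrdf (W := W) μ P d n D ≠ ∞)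
    (hslater : ∃ Q : Reproduction W X Y, info μ P (Q.causal (n + 1)) ≠ ∞ ∧
      expectedDistortion μ P d n Q < ((n : ℝ≥0∞) + 1) * D)
    (hlt : ∃ Q : Reproduction W X Y, info μ P (Q.causal (n + 1)) < nrdf (W := W) μ P d n D ∧
      expectedDistortion μ P d n Q ≠ ∞) :
    ∃ s, IsLagrangeMultiplier (W := W) (X := X) (Y := Y) μ P d n D s := by
  obtain ⟨Q₀, hI₀, hE₀⟩ := hslater
  obtain ⟨Q₁, hI₁, hE₁⟩ := hlt
  have hB : ((n : ℝ≥0∞) + 1) * D ≠ ∞ := by finiteness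
  obtain ⟨m, hm, hmul⟩ := exists_pos_multiplier_of_convex
    (B := (((n : ℝ≥0∞) + 1) * D).toReal) (R := (nrdf (W := W) μ P d n D).toReal)
    (convex_achievableSet (μ := μ) (P := P) (d := d) (n := n))
    (by
      rintro p ⟨-, hp₂, Q, hE, hI⟩ hpB
      refine ENNReal.toReal_le_of_le_ofReal hp₂ (le_trans (Feasible.nrdf_le_info ?_) hI)
      exact feasible_iff.mpr (hE.trans (ENNReal.ofReal_le_of_le_toReal hpB)))
    ⟨_, mem_achievableSet_toReal hE₀.ne_top hI₀, ENNReal.toReal_strict_mono hB hE₀⟩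
    ⟨_, mem_achievableSet_toReal hE₁ hI₁.ne_top, ENNReal.toReal_strict_mono hR hI₁⟩
  refine ⟨-m, neg_nonpos.mpr hm.le, fun Q => ?_⟩
  rw [neg_neg]
  by_cases hI : info μ P (Q.causal (n + 1)) = ∞
  · simp [hI]
  by_cases hE : expectedDistortion μ P d n Q = ∞
  · simp [hE, hm]
  have := hmul _ (mem_achievableSet_toReal hE hI)
  rw [← ENNReal.toReal_le_toReal (by finiteness) (by finiteness),
    ENNReal.toReal_add hR (by finiteness), ENNReal.toReal_add hI (by finiteness),
    ENNReal.toReal_mul (a := ENNReal.ofReal m), ENNReal.toReal_mul (a := ENNReal.ofReal m),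
    ENNReal.toReal_ofReal hm.le]
  exact this

end Multiplier

section Redraw

variable {α β : Type*} [MeasurableSpace α] [MeasurableSpace β]

theorem compProd_le_smul_compProd {M M' : Measure α} [SFinite M] [SFinite M'] {κ κ' : Kernel α β}
    [IsSFiniteKernel κ] [IsSFiniteKernel κ'] {c c' : ℝ≥0} (hM : M' ≤ c • M)
    (hκ : ∀ a, κ' a ≤ c' • κ a) : M' ⊗ₘ κ' ≤ (c * c') • (M ⊗ₘ κ) := by
  refine Measure.le_iff.mpr fun s hs => ?_
  have hm : Measurable fun a => κ a (Prod.mk a ⁻¹' s) := Kernel.measurable_kernel_prodMk_left hs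
  calc (M' ⊗ₘ κ') s
      = ∫⁻ a, κ' a (Prod.mk a ⁻¹' s) ∂M' := Measure.compProd_apply hs
    _ ≤ ∫⁻ a, c' * κ a (Prod.mk a ⁻¹' s) ∂(c • M) := lintegral_mono' hM fun a => hκ a _
    _ = ((c * c') • (M ⊗ₘ κ)) s := by
        rw [lintegral_const_mul _ hm, lintegral_smul_measure, Measure.smul_apply,
          Measure.compProd_apply hs, mul_smul, smul_comm]
        rfl

variable (κ : Kernel α β) (v : α → β → ℝ≥0∞)

/-- The points whose cost does not exceed the mean cost under `κ p`. -/
def belowMean (p : α) : Set β := {y | v p y ≤ ∫⁻ y', v p y' ∂κ p}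

/-- The density of `redraw κ v p` with respect to `κ p`. -/
def redrawDensity (p : α) (y : β) : ℝ≥0∞ :=
  (belowMean κ v p).indicator 1 y + κ p (belowMean κ v p)ᶜ

/-- Draw a point according to `κ p`, and once more if its cost exceeds the mean cost: the
expected cost becomes that of the minimum of the cost and its mean. -/
def redraw [IsSFiniteKernel κ] : Kernel α β := κ.withDensity (redrawDensity κ v)

variable {κ v}

variable (κ) in
theorem measurableSet_belowMean (hv : Measurable (Function.uncurry v)) (p : α) :
    MeasurableSet (belowMean κ v p) :=
  measurableSet_le hv.of_uncurry_left measurable_const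

variable [IsMarkovKernel κ] (hv : Measurable (Function.uncurry v))
include hv

theorem measurable_redrawDensity : Measurable (Function.uncurry (redrawDensity κ v)) := by
  have hset : MeasurableSet {q : α × β | q.2 ∈ belowMean κ v q.1} :=
    measurableSet_le hv ((by fun_prop : Measurable fun p => ∫⁻ y, v p y ∂κ p).comp measurable_fst)
  exact (measurable_one.indicator hset).add
    ((Kernel.measurable_kernel_prodMk_left hset.compl).comp measurable_fst)

theorem redraw_apply (p : α) : redraw κ v p = (κ p).withDensity (redrawDensity κ v p) :=
  Kernel.withDensity_apply _ (measurable_redrawDensity hv) p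

theorem redraw_le (p : α) : redraw κ v p ≤ (2 : ℝ≥0) • κ p := by
  rw [redraw_apply hv, ENNReal.smul_def, ← withDensity_const]
  refine withDensity_mono (ae_of_all _ fun y => ?_)
  calc redrawDensity κ v p y ≤ 1 + 1 :=
        add_le_add (Set.indicator_le_self' (f := 1) (fun _ _ => zero_le) y) prob_le_one
    _ = ((2 : ℝ≥0) : ℝ≥0∞) := by norm_num

theorem lintegral_redraw (p : α) {f : β → ℝ≥0∞} (hf : Measurable f) :
    ∫⁻ y, f y ∂redraw κ v p =
      ∫⁻ y in belowMean κ v p, f y ∂κ p + κ p (belowMean κ v p)ᶜ * ∫⁻ y, f y ∂κ p := by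
  have hset := measurableSet_belowMean κ hv p
  rw [redraw_apply hv, lintegral_withDensity_eq_lintegral_mul _
    (measurable_redrawDensity hv).of_uncurry_left hf]
  simp only [redrawDensity, Pi.mul_apply, add_mul, ← Set.indicator_mul_left, Pi.one_apply, one_mul]
  rw [lintegral_add_left (hf.indicator hset), lintegral_indicator hset, lintegral_const_mul _ hf]

theorem isMarkovKernel_redraw : IsMarkovKernel (redraw κ v) := by
  refine ⟨fun p => ⟨?_⟩⟩
  rw [← lintegral_one, lintegral_redraw hv p measurable_const, setLIntegral_one, lintegral_one,
    measure_univ, mul_one, measure_add_measure_compl (measurableSet_belowMean κ hv p), measure_univ]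

theorem lintegral_redraw_self (p : α) :
    ∫⁻ y, v p y ∂redraw κ v p = ∫⁻ y, min (v p y) (∫⁻ y', v p y' ∂κ p) ∂κ p := by
  have hset := measurableSet_belowMean κ hv p
  rw [lintegral_redraw hv p hv.of_uncurry_left, mul_comm, ← setLIntegral_const,
    ← lintegral_add_compl (fun y => min (v p y) _) hset]
  congr 1
  · exact setLIntegral_congr_fun hset fun y hy => (min_eq_left hy).symm
  · exact setLIntegral_congr_fun hset.compl fun y hy =>
      (min_eq_right (le_of_not_ge ((Set.mem_compl_iff _ _).mp hy))).symm

end Redraw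

theorem ae_eq_lintegral_of_le_lintegral_min {β : Type*} [MeasurableSpace β] {ν : Measure β}
    [IsProbabilityMeasure ν] {f : β → ℝ≥0∞} (hf : Measurable f) (hfin : ∫⁻ y, f y ∂ν ≠ ∞)
    (h : ∫⁻ y, f y ∂ν ≤ ∫⁻ y, min (f y) (∫⁻ y', f y' ∂ν) ∂ν) :
    f =ᵐ[ν] fun _ => ∫⁻ y, f y ∂ν := by
  have hmin := ae_eq_of_ae_le_of_lintegral_le (ae_of_all ν fun y => min_le_left (f y) _)
    (ne_top_of_le_ne_top hfin (lintegral_mono fun y => min_le_left _ _)) hf.aemeasurable h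
  refine (ae_eq_of_ae_le_of_lintegral_le ?_ hfin aemeasurable_const (by simp))
  filter_upwards [hmin] with y hy
  exact min_eq_left_iff.mp hy

section CostToGo

variable {W : Type w} {X : ℕ → Type u} {Y : ℕ → Type v} [MeasurableSpace W]
  [∀ t, MeasurableSpace (X t)] [∀ t, MeasurableSpace (Y t)]

/-- Replace the kernel of a reproduction at one time. -/
def Reproduction.update (Q : Reproduction W X Y) (t : ℕ)
    (κ : Kernel ((W × Hist Y t) × Hist X (t + 1)) (Y t)) [IsMarkovKernel κ] :
    Reproduction W X Y where
  kernel := Function.update Q.kernel t κ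
  markov s := by
    rcases eq_or_ne s t with rfl | h
    · rwa [Function.update_self]
    · rw [Function.update_of_ne h]; infer_instance

theorem Reproduction.update_kernel_self (Q : Reproduction W X Y) (t : ℕ)
    (κ : Kernel ((W × Hist Y t) × Hist X (t + 1)) (Y t)) [IsMarkovKernel κ] :
    (Q.update t κ).kernel t = κ := Function.update_self ..

theorem Reproduction.update_kernel_of_ne (Q : Reproduction W X Y) {s t : ℕ} (h : s ≠ t)
    (κ : Kernel ((W × Hist Y t) × Hist X (t + 1)) (Y t)) [IsMarkovKernel κ] :
    (Q.update t κ).kernel s = Q.kernel s := Function.update_of_ne h ..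

variable {μ : Measure W} [IsProbabilityMeasure μ] {P : Source X} {Q Q' : Reproduction W X Y} {t : ℕ}

theorem jointLaw_congr (h : ∀ s < t, Q.kernel s = Q'.kernel s) :
    jointLaw μ P Q t = jointLaw μ P Q' t := by
  induction t with
  | zero => exact jointLaw_zero μ P Q Q'
  | succ t ih =>
    rw [jointLaw_succ, jointLaw_succ, h t t.lt_succ_self,
      pastLaw_congr (ih fun s hs => h s (hs.trans t.lt_succ_self))]

variable (μ P Q t) in
theorem jointLaw_succ_map_symm :
    (jointLaw μ P Q (t + 1)).map (jointEquiv t).symm = pastLaw μ P Q t ⊗ₘ Q.kernel t := by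
  rw [jointLaw_succ, MeasurableEquiv.map_symm_map]

theorem jointLaw_succ_le_smul {c c' : ℝ≥0} (h : jointLaw μ P Q' t ≤ c • jointLaw μ P Q t)
    (hker : ∀ p, Q'.kernel t p ≤ c' • Q.kernel t p) :
    jointLaw μ P Q' (t + 1) ≤ (c * c') • jointLaw μ P Q (t + 1) := by
  have hpast : pastLaw μ P Q' t ≤ c • pastLaw μ P Q t := by
    rw [pastLaw_eq_map, pastLaw_eq_map, ← Measure.map_smul]
    refine Measure.map_mono ?_ (pastEquiv t).measurable
    simpa using compProd_le_smul_compProd h (c' := 1) fun a => by rw [one_smul]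
  rw [jointLaw_succ, jointLaw_succ, ← Measure.map_smul]
  exact Measure.map_mono (compProd_le_smul_compProd hpast hker) (jointEquiv t).measurable

variable (Q) in
theorem jointLaw_update_le {κ : Kernel ((W × Hist Y t) × Hist X (t + 1)) (Y t)} [IsMarkovKernel κ]
    {c : ℝ≥0} (hκ : ∀ p, κ p ≤ c • Q.kernel t p) {s : ℕ} (hs : t < s) :
    jointLaw μ P (Q.update t κ) s ≤ c • jointLaw μ P Q s := by
  induction s, hs using Nat.le_induction with
  | base =>
    have hpre : jointLaw μ P (Q.update t κ) t = jointLaw μ P Q t :=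
      jointLaw_congr fun r hr => Q.update_kernel_of_ne hr.ne κ
    simpa using jointLaw_succ_le_smul (c := 1) (c' := c) (by rw [hpre, one_smul]) fun p => by
      rw [Q.update_kernel_self]; exact hκ p
  | succ s hs ih =>
    simpa using jointLaw_succ_le_smul (c' := 1) ih fun p => by
      rw [Q.update_kernel_of_ne (by omega), one_smul]

variable (P Q) in
/-- The conditional expectation, under `Q`, of the total distortion before time `t + k` given the
history before time `t`. -/
def costToGo (d : Distortion X Y) : ∀ _k t : ℕ, W × (Hist X t × Hist Y t) → ℝ≥0∞
  | 0, t => fun a => d.total t a.2.1 a.2.2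
  | k + 1, t => fun a => ∫⁻ x', ∫⁻ y, costToGo d k (t + 1) (a.1, (a.2.1.snoc x', a.2.2.snoc y))
      ∂Q.kernel t ((a.1, a.2.2), a.2.1.snoc x') ∂P.kernel t a.2.1

variable (d : Distortion X Y) (k : ℕ)

@[fun_prop]
theorem measurable_costToGo (t : ℕ) : Measurable (costToGo P Q d k t) := by
  induction k generalizing t with
  | zero => exact (d.measurable_total t).comp measurable_snd
  | succ k ih =>
    have := ih (t + 1)
    unfold costToGo
    fun_prop

theorem lintegral_costToGo_succ (Q' : Reproduction W X Y) (t : ℕ) :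
    ∫⁻ a, costToGo P Q d (k + 1) t a ∂jointLaw μ P Q' t =
      ∫⁻ p, ∫⁻ y, costToGo P Q d k (t + 1) (p.1.1, (p.2, p.1.2.snoc y)) ∂Q.kernel t p
        ∂pastLaw μ P Q' t := by
  rw [lintegral_pastLaw μ P Q' t (by fun_prop)]
  rfl

theorem lintegral_costToGo (t : ℕ) :
    ∫⁻ a, costToGo P Q d k t a ∂jointLaw μ P Q t =
      ∫⁻ a, d.total (t + k) a.2.1 a.2.2 ∂jointLaw μ P Q (t + k) := by
  induction k generalizing t with
  | zero => rfl
  | succ k ih =>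
    rw [lintegral_costToGo_succ, ← lintegral_jointLaw_succ μ P Q t (by fun_prop), ih,
      show t + 1 + k = t + (k + 1) by omega]

theorem costToGo_congr (t : ℕ) (h : ∀ s, t ≤ s → Q.kernel s = Q'.kernel s) :
    costToGo P Q d k t = costToGo P Q' d k t := by
  induction k generalizing t with
  | zero => rfl
  | succ k ih =>
    funext a
    simp only [costToGo]
    rw [ih (t + 1) (fun s hs => h s (by omega)), h t le_rfl]

theorem lintegral_total_update (κ : Kernel ((W × Hist Y t) × Hist X (t + 1)) (Y t))
    [IsMarkovKernel κ] :
    ∫⁻ a, d.total (t + 1 + k) a.2.1 a.2.2 ∂jointLaw μ P (Q.update t κ) (t + 1 + k) =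
      ∫⁻ p, ∫⁻ y, costToGo P Q d k (t + 1) (p.1.1, (p.2, p.1.2.snoc y)) ∂κ p
        ∂pastLaw μ P Q t := by
  have hlaw : jointLaw μ P (Q.update t κ) t = jointLaw μ P Q t :=
    jointLaw_congr fun s hs => Q.update_kernel_of_ne hs.ne κ
  rw [← lintegral_costToGo, costToGo_congr (Q' := Q) d k (t + 1)
    fun s hs => Q.update_kernel_of_ne (by omega) κ, lintegral_jointLaw_succ μ P _ t (by fun_prop),
    pastLaw_congr hlaw, Q.update_kernel_self]

theorem costToGo_ae_eq_mean
    (hfin : ∫⁻ a, d.total (t + 1 + k) a.2.1 a.2.2 ∂jointLaw μ P Q (t + 1 + k) ≠ ∞)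
    (hmin : ∀ Q' : Reproduction W X Y,
      jointLaw μ P Q' (t + 1 + k) ≤ (2 : ℝ≥0) • jointLaw μ P Q (t + 1 + k) →
      ∫⁻ a, d.total (t + 1 + k) a.2.1 a.2.2 ∂jointLaw μ P Q (t + 1 + k) ≤
        ∫⁻ a, d.total (t + 1 + k) a.2.1 a.2.2 ∂jointLaw μ P Q' (t + 1 + k)) :
    ∀ᵐ p ∂pastLaw μ P Q t, ∀ᵐ y ∂Q.kernel t p,
      costToGo P Q d k (t + 1) (p.1.1, (p.2, p.1.2.snoc y)) =
        ∫⁻ y, costToGo P Q d k (t + 1) (p.1.1, (p.2, p.1.2.snoc y)) ∂Q.kernel t p := by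
  set v : (W × Hist Y t) × Hist X (t + 1) → Y t → ℝ≥0∞ := fun p y =>
    costToGo P Q d k (t + 1) (p.1.1, (p.2, p.1.2.snoc y))
  have hv : Measurable (Function.uncurry v) :=
    (measurable_costToGo d k (t + 1)).comp (jointEquiv t).measurable
  have := isMarkovKernel_redraw (κ := Q.kernel t) hv
  have hold : ∫⁻ a, d.total (t + 1 + k) a.2.1 a.2.2 ∂jointLaw μ P Q (t + 1 + k) =
      ∫⁻ p, ∫⁻ y, v p y ∂Q.kernel t p ∂pastLaw μ P Q t := by
    rw [← lintegral_costToGo, ← lintegral_jointLaw_succ μ P Q t (by fun_prop)]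
  have hle := hmin _ (jointLaw_update_le Q (redraw_le (κ := Q.kernel t) hv) (by omega))
  rw [hold, lintegral_total_update, lintegral_congr (lintegral_redraw_self hv)] at hle
  rw [hold] at hfin
  have hmean : Measurable fun p => ∫⁻ y, v p y ∂Q.kernel t p := by fun_prop
  have hmin_le (p) : ∫⁻ y, min (v p y) (∫⁻ y', v p y' ∂Q.kernel t p) ∂Q.kernel t p ≤
      ∫⁻ y, v p y ∂Q.kernel t p := lintegral_mono fun y => min_le_left _ _
  have heq := ae_eq_of_ae_le_of_lintegral_le (ae_of_all _ hmin_le)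
    (ne_top_of_le_ne_top hfin (lintegral_mono hmin_le)) hmean.aemeasurable hle
  filter_upwards [heq, ae_lt_top hmean hfin] with p hp hpfin
  exact ae_eq_lintegral_of_le_lintegral_min hv.of_uncurry_left hpfin.ne hp.ge

theorem lintegral_costToGo_step (hac : jointLaw μ P Q' (t + 1) ≪ jointLaw μ P Q (t + 1))
    (hmean : ∀ᵐ p ∂pastLaw μ P Q t, ∀ᵐ y ∂Q.kernel t p,
      costToGo P Q d k (t + 1) (p.1.1, (p.2, p.1.2.snoc y)) =
        ∫⁻ y, costToGo P Q d k (t + 1) (p.1.1, (p.2, p.1.2.snoc y)) ∂Q.kernel t p) :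
    ∫⁻ a, costToGo P Q d (k + 1) t a ∂jointLaw μ P Q' t =
      ∫⁻ a, costToGo P Q d k (t + 1) a ∂jointLaw μ P Q' (t + 1) := by
  replace hac := hac.map (jointEquiv t).symm.measurable
  rw [jointLaw_succ_map_symm, jointLaw_succ_map_symm] at hac
  rw [lintegral_costToGo_succ, lintegral_jointLaw_succ μ P Q' t (by fun_prop)]
  have hmeas : MeasurableSet {q : ((W × Hist Y t) × Hist X (t + 1)) × Y t |
      costToGo P Q d k (t + 1) (q.1.1.1, (q.1.2, q.1.1.2.snoc q.2)) =
        ∫⁻ y, costToGo P Q d k (t + 1) (q.1.1.1, (q.1.2, q.1.1.2.snoc y)) ∂Q.kernel t q.1} :=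
    measurableSet_eq_fun (by fun_prop) (by fun_prop)
  refine lintegral_congr_ae ?_
  filter_upwards [Measure.ae_ae_of_ae_compProd
    (hac.ae_le (Measure.ae_compProd_of_ae_ae hmeas hmean))] with p hp
  rw [lintegral_congr_ae hp, lintegral_const, measure_univ, mul_one]

/-- Backward induction: since no modification of `Q` at one time decreases the distortion, the
cost to go does not depend on the last letter drawn. -/
theorem expectedDistortion_eq_of_absolutelyContinuous {n : ℕ}
    (hfin : expectedDistortion μ P d n Q ≠ ∞)
    (hmin : ∀ Q' : Reproduction W X Y,
      jointLaw μ P Q' (n + 1) ≤ (2 : ℝ≥0) • jointLaw μ P Q (n + 1) →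
        expectedDistortion μ P d n Q ≤ expectedDistortion μ P d n Q')
    (hac : jointLaw μ P Q' (n + 1) ≪ jointLaw μ P Q (n + 1)) :
    expectedDistortion μ P d n Q' = expectedDistortion μ P d n Q := by
  have hcost (k t : ℕ) (ht : t + k = n + 1) :
      ∫⁻ a, costToGo P Q d k t a ∂jointLaw μ P Q' t = expectedDistortion μ P d n Q' := by
    induction k generalizing t with
    | zero =>
      obtain rfl : t = n + 1 := ht
      rfl
    | succ k ih =>
      have hN : t + 1 + k = n + 1 := by omega
      rw [← ih (t + 1) hN]
      refine lintegral_costToGo_step d k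
        (jointLaw_absolutelyContinuous_of_le (by omega : t + 1 ≤ n + 1) hac)
        (costToGo_ae_eq_mean d k ?_ ?_)
      · rwa [hN]
      · rwa [hN]
  rw [← hcost (n + 1) 0 (by omega), jointLaw_zero μ P Q' Q, lintegral_costToGo, zero_add]
  rfl

end CostToGo

section Exponential

/-- `exp (-c)` for a cost `c ∈ [0, ∞]`, with `exp (-∞) = 0`. -/
def expNeg (c : ℝ≥0∞) : ℝ≥0∞ := EReal.exp (-(c : EReal))

/-- `-log z ∈ [0, ∞]` for `z ∈ [0, 1]`, with `-log 0 = ∞`; the value is `0` for `z > 1`. -/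
def negLog (z : ℝ≥0∞) : ℝ≥0∞ := (-ENNReal.log z).toENNReal

@[fun_prop]
theorem measurable_expNeg : Measurable expNeg :=
  EReal.measurable_exp.comp (by fun_prop)

@[fun_prop]
theorem measurable_negLog : Measurable negLog :=
  measurable_ereal_toENNReal.comp (by fun_prop)

@[simp]
theorem expNeg_top : expNeg ∞ = 0 := by simp [expNeg]

@[simp]
theorem expNeg_zero : expNeg 0 = 1 := by simp [expNeg]

theorem expNeg_of_ne_top {c : ℝ≥0∞} (hc : c ≠ ∞) :
    expNeg c = ENNReal.ofReal (Real.exp (-c.toReal)) := by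
  lift c to ℝ≥0 using hc
  rw [expNeg, ENNReal.coe_toReal, ← EReal.exp_coe]
  rfl

@[simp]
theorem expNeg_eq_zero_iff {c : ℝ≥0∞} : expNeg c = 0 ↔ c = ∞ := by simp [expNeg]

theorem antitone_expNeg : Antitone expNeg := fun _ _ h =>
  EReal.exp_monotone (EReal.neg_le_neg_iff.mpr (EReal.coe_ennreal_le_coe_ennreal_iff.mpr h))

theorem expNeg_le_one (c : ℝ≥0∞) : expNeg c ≤ 1 :=
  expNeg_zero ▸ antitone_expNeg zero_le

theorem antitone_negLog : Antitone negLog := fun _ _ h =>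
  EReal.toENNReal_le_toENNReal (EReal.neg_le_neg_iff.mpr (ENNReal.log_monotone h))

@[simp]
theorem negLog_one : negLog 1 = 0 := by simp [negLog]

@[simp]
theorem negLog_eq_top_iff {z : ℝ≥0∞} : negLog z = ∞ ↔ z = 0 := by simp [negLog]

theorem toReal_negLog {z : ℝ≥0∞} (h0 : z ≠ 0) (h1 : z ≤ 1) :
    (negLog z).toReal = -Real.log z.toReal := by
  have hz : z.toReal ≤ 1 := ENNReal.toReal_le_of_le_ofReal zero_le_one (by simpa using h1)
  rw [negLog, ENNReal.log_pos_real h0 (h1.trans_lt ENNReal.one_lt_top).ne, ← EReal.coe_neg,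
    EReal.real_coe_toENNReal, ENNReal.toReal_ofReal
      (neg_nonneg.mpr (Real.log_nonpos ENNReal.toReal_nonneg hz))]

theorem expNeg_negLog {z : ℝ≥0∞} (h1 : z ≤ 1) : expNeg (negLog z) = z := by
  rw [expNeg, negLog, EReal.coe_toENNReal (EReal.neg_nonneg.mpr (ENNReal.log_le_zero_iff.mpr h1)),
    neg_neg, ENNReal.exp_log]

end Exponential

section GibbsStep

open InformationTheory

variable {α β : Type*} [MeasurableSpace α] [MeasurableSpace β]

theorem klDiv_withDensity_right {M N : Measure α} [IsFiniteMeasure M] [IsFiniteMeasure N]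
    (hMN : M ≪ N) {v : α → ℝ≥0∞} (hv : Measurable v) [IsFiniteMeasure (N.withDensity v)]
    (hv0 : ∀ᵐ a ∂M, v a ≠ 0) (hvtop : ∀ᵐ a ∂N, v a ≠ ∞) :
    klDiv M (N.withDensity v) =
      ∫⁻ a, v a * ENNReal.ofReal (klFun (M.rnDeriv N a / v a).toReal) ∂N := by
  have hdm : Measurable fun a => M.rnDeriv N a / v a := by fun_prop
  have hzero : ∀ᵐ a ∂N, v a = 0 → M.rnDeriv N a = 0 := by
    rw [← Measure.withDensity_rnDeriv_eq M N hMN,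
      ae_withDensity_iff (Measure.measurable_rnDeriv M N)] at hv0
    filter_upwards [hv0] with a ha using not_imp_not.mp ha
  have hM : M = (N.withDensity v).withDensity fun a => M.rnDeriv N a / v a := by
    rw [← withDensity_mul _ hv hdm]
    nth_rw 1 [← Measure.withDensity_rnDeriv_eq M N hMN]
    refine withDensity_congr_ae ?_
    filter_upwards [hzero, hvtop] with a h0 htop
    exact (ENNReal.mul_div_cancel' h0 fun h => absurd h htop).symm
  have hac : M ≪ N.withDensity v := by
    rw [hM]
    exact withDensity_absolutelyContinuous _ _
  have hrn : M.rnDeriv (N.withDensity v) =ᵐ[N.withDensity v] fun a => M.rnDeriv N a / v a := by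
    conv_lhs => rw [hM]
    exact Measure.rnDeriv_withDensity _ hdm
  calc klDiv M (N.withDensity v)
      = ∫⁻ a, ENNReal.ofReal (klFun (M.rnDeriv N a / v a).toReal) ∂N.withDensity v := by
        rw [klDiv_eq_lintegral_klFun_of_ac hac]
        exact lintegral_congr_ae (hrn.fun_comp fun r => ENNReal.ofReal (klFun r.toReal))
    _ = _ := lintegral_withDensity_eq_lintegral_mul _ hv (by fun_prop)

theorem klFun_add_mul_add_exp {x : ℝ} (hx : 0 ≤ x) (c l : ℝ) :
    klFun x + x * c + Real.exp (l - c) =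
      Real.exp (l - c) * klFun (x * Real.exp (c - l)) + x * l + 1 := by
  rcases hx.eq_or_lt with rfl | hx
  · simp only [klFun_zero, zero_mul, mul_one]
    ring
  · rw [klFun_apply, klFun_apply, Real.log_mul hx.ne' (Real.exp_ne_zero _), Real.log_exp]
    have hexp : Real.exp (l - c) * Real.exp (c - l) = 1 := by rw [← Real.exp_add]; simp
    linear_combination (-x * (Real.log x + (c - l)) + x) * hexp

theorem expNeg_div_expNeg {c l : ℝ≥0∞} (hc : c ≠ ∞) (hl : l ≠ ∞) :
    expNeg c / expNeg l = ENNReal.ofReal (Real.exp (l.toReal - c.toReal)) := by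
  rw [expNeg_of_ne_top hc, expNeg_of_ne_top hl, ← ENNReal.ofReal_div_of_pos (Real.exp_pos _),
    ← Real.exp_sub]
  congr 2
  ring

theorem ofReal_klFun_add_mul_add_expNeg {f c l : ℝ≥0∞} (hf : f ≠ ∞) (hl : l ≠ ∞)
    (hc : c = ∞ → f = 0) :
    ENNReal.ofReal (klFun f.toReal) + f * c + expNeg c / expNeg l =
      expNeg c / expNeg l * ENNReal.ofReal (klFun (f / (expNeg c / expNeg l)).toReal) +
        f * l + 1 := by
  by_cases hctop : c = ∞
  · simp [hctop, hc hctop, klFun_zero]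
  have hdiv : (f / (expNeg c / expNeg l)).toReal =
      f.toReal * Real.exp (c.toReal - l.toReal) := by
    rw [expNeg_div_expNeg hctop hl, ENNReal.toReal_div,
      ENNReal.toReal_ofReal (Real.exp_nonneg _), div_eq_mul_inv, ← Real.exp_neg, neg_sub]
  have hkl := klFun_nonneg (x := f.toReal) ENNReal.toReal_nonneg
  have hkl' := klFun_nonneg (x := f.toReal * Real.exp (c.toReal - l.toReal)) (by positivity)
  have key := congrArg ENNReal.ofReal
    (klFun_add_mul_add_exp (x := f.toReal) ENNReal.toReal_nonneg c.toReal l.toReal)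
  rw [hdiv, expNeg_div_expNeg hctop hl]
  rwa [ENNReal.ofReal_add (by positivity) (by positivity),
    ENNReal.ofReal_add (by positivity) (by positivity),
    ENNReal.ofReal_add (by positivity) (by positivity),
    ENNReal.ofReal_add (by positivity) (by positivity), ENNReal.ofReal_mul (by positivity),
    ENNReal.ofReal_mul (by positivity), ENNReal.ofReal_mul (by positivity),
    ENNReal.ofReal_toReal hctop, ENNReal.ofReal_toReal hl, ENNReal.ofReal_toReal hf,
    ENNReal.ofReal_one] at key

theorem ae_ne_top_of_absolutelyContinuous_withDensity {M N : Measure α} {c l : α → ℝ≥0∞}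
    (hc : Measurable c) (hac : M ≪ N.withDensity fun a => expNeg (c a) / expNeg (l a)) :
    ∀ᵐ a ∂M, c a ≠ ∞ := by
  have hs : MeasurableSet {a | c a = ∞} := hc (measurableSet_singleton ∞)
  rw [ae_iff]
  refine hac ?_
  simp only [ne_eq, not_not]
  rw [withDensity_apply _ hs]
  exact setLIntegral_eq_zero hs fun a ha => by
    have : c a = ∞ := ha
    simp [this]

/-- The Gibbs variational principle. -/
theorem klDiv_add_lintegral_eq_klDiv_tilted (M N : Measure α) [IsFiniteMeasure M]
    [IsFiniteMeasure N] {c l : α → ℝ≥0∞} (hc : Measurable c) (hl : Measurable l)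
    (hltop : ∀ᵐ a ∂N, l a ≠ ∞) (h_int : ∫⁻ a, expNeg (c a) / expNeg (l a) ∂N ≠ ∞) :
    klDiv M N + ∫⁻ a, c a ∂M + ∫⁻ a, expNeg (c a) / expNeg (l a) ∂N =
      klDiv M (N.withDensity fun a => expNeg (c a) / expNeg (l a)) + ∫⁻ a, l a ∂M +
        N Set.univ := by
  have hvm : Measurable fun a => expNeg (c a) / expNeg (l a) := by fun_prop
  by_cases hMN : M ≪ N
  swap
  · rw [klDiv_of_not_ac hMN,
      klDiv_of_not_ac fun h => hMN (h.trans (withDensity_absolutelyContinuous _ _))]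
    simp
  by_cases hcM : ∀ᵐ a ∂M, c a ≠ ∞
  swap
  · have hctop : ∫⁻ a, c a ∂M = ∞ := by
      by_contra h
      exact hcM ((ae_lt_top hc h).mono fun _ => LT.lt.ne)
    rw [hctop, klDiv_of_not_ac fun h => hcM (ae_ne_top_of_absolutelyContinuous_withDensity hc h)]
    simp
  have := isFiniteMeasure_withDensity h_int
  have hv0 : ∀ᵐ a ∂M, expNeg (c a) / expNeg (l a) ≠ 0 := by
    filter_upwards [hcM] with a ha
    exact ENNReal.div_ne_zero.mpr ⟨expNeg_eq_zero_iff.not.mpr ha,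
      ((expNeg_le_one _).trans_lt ENNReal.one_lt_top).ne⟩
  have hcf : ∀ᵐ a ∂N, c a = ∞ → M.rnDeriv N a = 0 := by
    rw [← Measure.withDensity_rnDeriv_eq M N hMN,
      ae_withDensity_iff (Measure.measurable_rnDeriv M N)] at hcM
    filter_upwards [hcM] with a ha using not_imp_comm.mp ha ∘ not_not.mpr
  have hpointwise := lintegral_congr_ae (μ := N) <| by
    filter_upwards [Measure.rnDeriv_ne_top M N, hltop, hcf] with a hf hl hc using
      ofReal_klFun_add_mul_add_expNeg hf hl hc
  rw [lintegral_add_right _ hvm, lintegral_add_left (by fun_prop),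
    lintegral_add_right _ measurable_const, lintegral_add_left (by fun_prop),
    lintegral_one] at hpointwise
  rwa [klDiv_withDensity_right hMN hvm hv0 (ae_lt_top hvm h_int |>.mono fun _ => LT.lt.ne),
    klDiv_eq_lintegral_klFun_of_ac hMN, ← lintegral_rnDeriv_mul hMN hc.aemeasurable,
    ← lintegral_rnDeriv_mul hMN hl.aemeasurable]

/-- The partition function of the cost `c` for the reference kernel `η`. -/
def stepPartition (η : Kernel α β) (c : α → β → ℝ≥0∞) (a : α) : ℝ≥0∞ :=
  ∫⁻ b, expNeg (c a b) ∂η a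

/-- The density of the Gibbs kernel `stepGibbs η c` with respect to `η`. It is set to `1` where
the partition function vanishes, so that the Gibbs kernel is a Markov kernel. -/
def stepDensity (η : Kernel α β) (c : α → β → ℝ≥0∞) (a : α) (b : β) : ℝ≥0∞ :=
  if stepPartition η c a = 0 then 1 else expNeg (c a b) / stepPartition η c a

/-- The Gibbs kernel of the cost `c` for the reference kernel `η`. -/
def stepGibbs (η : Kernel α β) [IsSFiniteKernel η] (c : α → β → ℝ≥0∞) : Kernel α β :=
  η.withDensity (stepDensity η c)

variable (η : Kernel α β) {c : α → β → ℝ≥0∞}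

theorem measurable_stepPartition [IsSFiniteKernel η] (hc : Measurable (Function.uncurry c)) :
    Measurable (stepPartition η c) :=
  Measurable.lintegral_kernel_prod_right' (κ := η)
    (f := fun q => expNeg (Function.uncurry c q)) (by fun_prop)

theorem measurable_stepDensity [IsSFiniteKernel η] (hc : Measurable (Function.uncurry c)) :
    Measurable (Function.uncurry (stepDensity η c)) := by
  have hZ : Measurable fun q : α × β => stepPartition η c q.1 :=
    (measurable_stepPartition η hc).comp measurable_fst
  exact Measurable.ite (hZ (measurableSet_singleton 0)) measurable_const
    ((measurable_expNeg.comp hc).div hZ)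

theorem ae_eq_top_of_stepPartition_eq_zero (hc : Measurable (Function.uncurry c)) {a : α}
    (ha : stepPartition η c a = 0) : ∀ᵐ b ∂η a, c a b = ∞ := by
  filter_upwards [(lintegral_eq_zero_iff (measurable_expNeg.comp
    (hc.comp measurable_prodMk_left))).mp ha] with b hb using expNeg_eq_zero_iff.mp hb

variable [IsMarkovKernel η]

theorem stepPartition_le_one (c : α → β → ℝ≥0∞) (a : α) : stepPartition η c a ≤ 1 :=
  (lintegral_mono fun _ => expNeg_le_one _).trans (by simp)

theorem lintegral_stepDensity (hc : Measurable (Function.uncurry c)) (a : α) :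
    ∫⁻ b, stepDensity η c a b ∂η a = 1 := by
  unfold stepDensity
  split_ifs with h
  · simp
  · have hm : Measurable fun b => expNeg (c a b) :=
      measurable_expNeg.comp (hc.comp measurable_prodMk_left)
    simp_rw [div_eq_mul_inv]
    rw [lintegral_mul_const _ hm]
    exact ENNReal.mul_inv_cancel h
      (ne_top_of_le_ne_top ENNReal.one_ne_top (stepPartition_le_one η c a))

theorem isMarkovKernel_stepGibbs (hc : Measurable (Function.uncurry c)) :
    IsMarkovKernel (stepGibbs η c) := by
  refine ⟨fun a => ⟨?_⟩⟩
  rw [stepGibbs, Kernel.withDensity_apply _ (measurable_stepDensity η hc),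
    withDensity_apply _ MeasurableSet.univ, Measure.restrict_univ, lintegral_stepDensity η hc]

theorem ae_stepPartition_ne_zero (ν : Measure α) [SFinite ν] (κ : Kernel α β)
    [IsMarkovKernel κ] (hc : Measurable (Function.uncurry c)) (hac : ν ⊗ₘ κ ≪ ν ⊗ₘ η)
    (h_int : ∫⁻ q, c q.1 q.2 ∂(ν ⊗ₘ κ) ≠ ∞) : ∀ᵐ a ∂ν, stepPartition η c a ≠ 0 := by
  have hη : ∀ᵐ q ∂(ν ⊗ₘ η), stepPartition η c q.1 = 0 → c q.1 q.2 = ∞ := by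
    have hZ : MeasurableSet {q : α × β | stepPartition η c q.1 = 0} :=
      ((measurable_stepPartition η hc).comp measurable_fst) (measurableSet_singleton 0)
    have hctop : MeasurableSet {q : α × β | c q.1 q.2 = ∞} := hc (measurableSet_singleton ∞)
    refine (Measure.ae_compProd_iff (hZ.imp hctop)).mpr (ae_of_all _ fun a => ?_)
    exact ae_imp_of_ae_restrict (s := {_b | stepPartition η c a = 0}) <| by
      by_cases ha : stepPartition η c a = 0
      · exact ae_restrict_of_ae (ae_eq_top_of_stepPartition_eq_zero η hc ha)
      · simp [ha]
  have hκ : ∀ᵐ q ∂(ν ⊗ₘ κ), stepPartition η c q.1 ≠ 0 := by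
    filter_upwards [hac.ae_le hη, ae_lt_top hc h_int] with q htop hlt h0
    exact hlt.ne (htop h0)
  filter_upwards [Measure.ae_ae_of_ae_compProd hκ] with a ha
  exact ha.exists.choose_spec

theorem compProd_stepGibbs (ν : Measure α) [SFinite ν] (hc : Measurable (Function.uncurry c))
    (hZ : ∀ᵐ a ∂ν, stepPartition η c a ≠ 0) :
    ν ⊗ₘ stepGibbs η c = (ν ⊗ₘ η).withDensity
      fun q => expNeg (c q.1 q.2) / expNeg (negLog (stepPartition η c q.1)) := by
  have : IsMarkovKernel (η.withDensity (stepDensity η c)) := isMarkovKernel_stepGibbs η hc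
  have hZη : ∀ᵐ q ∂(ν ⊗ₘ η), stepPartition η c q.1 ≠ 0 :=
    Measure.ae_compProd_of_ae_fst _
      (measurable_stepPartition η hc (measurableSet_singleton 0).compl) hZ
  refine (Measure.compProd_withDensity (measurable_stepDensity η hc)).trans
    (withDensity_congr_ae ?_)
  filter_upwards [hZη] with q hq
  rw [stepDensity, if_neg hq, expNeg_negLog (stepPartition_le_one η c q.1)]

theorem klDiv_add_lintegral_eq_klDiv_stepGibbs (ν : Measure α) [IsFiniteMeasure ν]
    (κ : Kernel α β) [IsMarkovKernel κ] (hc : Measurable (Function.uncurry c)) :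
    klDiv (ν ⊗ₘ κ) (ν ⊗ₘ η) + ∫⁻ q, c q.1 q.2 ∂(ν ⊗ₘ κ) =
      klDiv (ν ⊗ₘ κ) (ν ⊗ₘ stepGibbs η c) + ∫⁻ a, negLog (stepPartition η c a) ∂ν := by
  have := isMarkovKernel_stepGibbs η hc
  have hZm := measurable_stepPartition η hc
  by_cases hZ : ∀ᵐ a ∂ν, stepPartition η c a ≠ 0
  swap
  · have hleft : klDiv (ν ⊗ₘ κ) (ν ⊗ₘ η) + ∫⁻ q, c q.1 q.2 ∂(ν ⊗ₘ κ) = ∞ := by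
      by_contra h
      obtain ⟨hkl, h_int⟩ := ENNReal.add_ne_top.mp h
      exact hZ (ae_stepPartition_ne_zero η ν κ hc (klDiv_ne_top_iff.mp hkl).1 h_int)
    have hright : ∫⁻ a, negLog (stepPartition η c a) ∂ν = ∞ := by
      by_contra h
      exact hZ ((ae_lt_top (by fun_prop) h).mono fun a ha => negLog_eq_top_iff.not.mp ha.ne)
    rw [hleft, hright, add_top]
  have hmass : ∫⁻ q, expNeg (c q.1 q.2) / expNeg (negLog (stepPartition η c q.1)) ∂(ν ⊗ₘ η) =
      (ν ⊗ₘ η) Set.univ := by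
    rw [← setLIntegral_univ, ← withDensity_apply _ MeasurableSet.univ,
      ← compProd_stepGibbs η ν hc hZ]
    simp
  have hfst : ∫⁻ q, negLog (stepPartition η c q.1) ∂(ν ⊗ₘ κ) =
      ∫⁻ a, negLog (stepPartition η c a) ∂ν := by
    rw [Measure.lintegral_compProd (by fun_prop)]
    simp
  have key := klDiv_add_lintegral_eq_klDiv_tilted (ν ⊗ₘ κ) (ν ⊗ₘ η) (c := fun q => c q.1 q.2)
    (l := fun q => negLog (stepPartition η c q.1)) hc (by fun_prop)
    (Measure.ae_compProd_of_ae_fst _ (measurable_negLog.comp hZm (measurableSet_singleton ∞).compl)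
      (hZ.mono fun a ha => negLog_eq_top_iff.not.mpr ha))
    (hmass ▸ measure_ne_top _ _)
  rwa [hmass, ← compProd_stepGibbs η ν hc hZ, hfst,
    ENNReal.add_left_inj (measure_ne_top _ _)] at key

end GibbsStep

section GibbsReproduction

open InformationTheory

variable {W : Type w} {X : ℕ → Type u} {Y : ℕ → Type v} [MeasurableSpace W]
  [∀ t, MeasurableSpace (X t)] [∀ t, MeasurableSpace (Y t)]

@[fun_prop]
theorem measurable_extend {α : Type*} [MeasurableSpace α] {t : ℕ} {f : α → W × Hist Y t}
    {g : α → Y t} (hf : Measurable f) (hg : Measurable g) :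
    Measurable fun a => extend (f a) (g a) := by
  unfold extend
  fun_prop

@[fun_prop]
theorem Distortion.measurable_rho {α : Type*} [MeasurableSpace α] (d : Distortion X Y) (t : ℕ)
    {f : α → Hist X (t + 1)} {g : α → Hist Y (t + 1)} (hf : Measurable f) (hg : Measurable g) :
    Measurable fun a => d.rho t (f a) (g a) :=
  (d.measurable t).comp (hf.prodMk hg)

/-- The exponent `-s ρ_t + g` of the Gibbs kernel at time `t`, where `l = -s`. -/
def stepCost (d : Distortion X Y) (l : ℝ≥0∞) (t : ℕ)
    (g : W × Hist Y (t + 1) → Hist X (t + 1) → ℝ≥0∞) (p : (W × Hist Y t) × Hist X (t + 1))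
    (yt : Y t) : ℝ≥0∞ :=
  l * d.rho t p.2 (extend p.1 yt).2 + g (extend p.1 yt) p.2

/-- The function `g_{t,n}` with values in `[0, ∞]`, where `k = n - t` and `l = -s`, for the
kernels of `R` as reference kernels. -/
def gibbsCost (P : Source X) (d : Distortion X Y) (R : Reproduction W X Y) (l : ℝ≥0∞) :
    ∀ _k t : ℕ, W × Hist Y (t + 1) → Hist X (t + 1) → ℝ≥0∞
  | 0, _ => fun _ _ => 0
  | k + 1, t => fun y x => ∫⁻ x', negLog (stepPartition (R.kernel (t + 1))
      (stepCost d l (t + 1) (gibbsCost P d R l k (t + 1))) (y, x.snoc x')) ∂P.kernel (t + 1) x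

/-- Minus the logarithm of the partition function at time `t`. -/
def gibbsLoss (P : Source X) (d : Distortion X Y) (R : Reproduction W X Y) (l : ℝ≥0∞) (k t : ℕ)
    (p : (W × Hist Y t) × Hist X (t + 1)) : ℝ≥0∞ :=
  negLog (stepPartition (R.kernel t) (stepCost d l t (gibbsCost P d R l k t)) p)

theorem gibbsCost_succ (P : Source X) (d : Distortion X Y) (R : Reproduction W X Y) (l : ℝ≥0∞)
    (k t : ℕ) (y : W × Hist Y (t + 1)) (x : Hist X (t + 1)) :
    gibbsCost P d R l (k + 1) t y x =
      ∫⁻ x', gibbsLoss P d R l k (t + 1) (y, x.snoc x') ∂P.kernel (t + 1) x := rfl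

theorem measurable_stepCost (d : Distortion X Y) (l : ℝ≥0∞) (t : ℕ)
    {g : W × Hist Y (t + 1) → Hist X (t + 1) → ℝ≥0∞} (hg : Measurable (Function.uncurry g)) :
    Measurable (Function.uncurry (stepCost d l t g)) :=
  .add (by fun_prop) (hg.comp (by fun_prop :
    Measurable fun q : ((W × Hist Y t) × Hist X (t + 1)) × Y t => (extend q.1.1 q.2, q.1.2)))

theorem measurable_uncurry_gibbsCost (P : Source X) (d : Distortion X Y)
    (R : Reproduction W X Y) (l : ℝ≥0∞) (k t : ℕ) :
    Measurable (Function.uncurry (gibbsCost P d R l k t)) := by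
  induction k generalizing t with
  | zero => exact measurable_const
  | succ k ih =>
    have hloss : Measurable (gibbsLoss P d R l k (t + 1)) := measurable_negLog.comp
      (measurable_stepPartition (R.kernel (t + 1)) (measurable_stepCost d l (t + 1) (ih (t + 1))))
    exact measurable_lintegral_kernel_comp measurable_snd (hloss.comp (by fun_prop :
      Measurable fun r : ((W × Hist Y (t + 1)) × Hist X (t + 1)) × X (t + 1) =>
        (r.1.1, r.1.2.snoc r.2)))

@[fun_prop]
theorem measurable_gibbsCost {α : Type*} [MeasurableSpace α] (P : Source X) (d : Distortion X Y)
    (R : Reproduction W X Y) (l : ℝ≥0∞) (k t : ℕ) {f : α → W × Hist Y (t + 1)}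
    {g : α → Hist X (t + 1)} (hf : Measurable f) (hg : Measurable g) :
    Measurable fun a => gibbsCost P d R l k t (f a) (g a) :=
  (measurable_uncurry_gibbsCost P d R l k t).comp (hf.prodMk hg)

@[fun_prop]
theorem measurable_gibbsLoss (P : Source X) (d : Distortion X Y) (R : Reproduction W X Y)
    (l : ℝ≥0∞) (k t : ℕ) : Measurable (gibbsLoss P d R l k t) :=
  measurable_negLog.comp (measurable_stepPartition _
    (measurable_stepCost d l t (measurable_uncurry_gibbsCost P d R l k t)))

/-- The reproduction that consists of the Gibbs kernels `(1)`, for the kernels of `R` as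
reference kernels. -/
def gibbsRep (P : Source X) (d : Distortion X Y) (R : Reproduction W X Y) (l : ℝ≥0∞) (n : ℕ) :
    Reproduction W X Y where
  kernel t := stepGibbs (R.kernel t) (stepCost d l t (gibbsCost P d R l (n - t) t))
  markov t := isMarkovKernel_stepGibbs _
    (measurable_stepCost d l t (measurable_uncurry_gibbsCost P d R l (n - t) t))

variable (μ : Measure W) [IsProbabilityMeasure μ] (P : Source X) (d : Distortion X Y)
  (R : Reproduction W X Y) (l : ℝ≥0∞) (Q : Reproduction W X Y)

/-- The free energy of the first `t` steps of `Q`, relative to `R`: relative entropy plus `l` times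
the expected distortion. -/
def freeEnergy (t : ℕ) : ℝ≥0∞ :=
  klDiv (jointLaw μ P Q t) (jointLaw μ P R t) +
    l * ∫⁻ a, d.total t a.2.1 a.2.2 ∂jointLaw μ P Q t

/-- The least free energy of `n + 1` steps, see `freeEnergy_eq_gibbsValue_add_klDiv`. -/
def gibbsValue (n : ℕ) : ℝ≥0∞ :=
  ∫⁻ p, gibbsLoss P d R l n 0 p ∂pastLaw μ P R 0

theorem freeEnergy_zero : freeEnergy μ P d R l Q 0 = 0 := by
  simp [freeEnergy, jointLaw_zero μ P Q R, Distortion.total]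

theorem lintegral_gibbsLoss_pastLaw_succ (k t : ℕ) :
    ∫⁻ p, gibbsLoss P d R l k (t + 1) p ∂pastLaw μ P Q (t + 1) =
      ∫⁻ a, gibbsCost P d R l (k + 1) t (a.1, a.2.2) a.2.1 ∂jointLaw μ P Q (t + 1) :=
  lintegral_pastLaw μ P Q (t + 1) (measurable_gibbsLoss P d R l k (t + 1))

theorem lintegral_total_succ (t : ℕ) :
    ∫⁻ a, d.total (t + 1) a.2.1 a.2.2 ∂jointLaw μ P Q (t + 1) =
      ∫⁻ a, d.total t a.2.1 a.2.2 ∂jointLaw μ P Q t +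
        ∫⁻ a, d.rho t a.2.1 a.2.2 ∂jointLaw μ P Q (t + 1) := by
  have hm : Measurable fun a : W × (Hist X t × Hist Y t) => d.total t a.2.1 a.2.2 := by fun_prop
  rw [← lintegral_jointLaw_succ_init μ P Q t hm, ← lintegral_add_left (by fun_prop)]
  rfl

theorem lintegral_total_eq_sum (N : ℕ) :
    ∫⁻ a, d.total N a.2.1 a.2.2 ∂jointLaw μ P Q N =
      ∑ t ∈ Finset.range N, ∫⁻ a, d.rho t a.2.1 a.2.2 ∂jointLaw μ P Q (t + 1) := by
  induction N with
  | zero => simp [Distortion.total]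
  | succ N ih => rw [lintegral_total_succ, ih, Finset.sum_range_succ]

theorem lintegral_stepCost_gibbsCost (k t : ℕ) :
    ∫⁻ q, stepCost d l t (gibbsCost P d R l k t) q.1 q.2 ∂(pastLaw μ P Q t ⊗ₘ Q.kernel t) =
      l * ∫⁻ a, d.rho t a.2.1 a.2.2 ∂jointLaw μ P Q (t + 1) +
        ∫⁻ a, gibbsCost P d R l k t (a.1, a.2.2) a.2.1 ∂jointLaw μ P Q (t + 1) := by
  have hm : Measurable fun a : W × (Hist X (t + 1) × Hist Y (t + 1)) =>
    d.rho t a.2.1 a.2.2 := by fun_prop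
  have hg : Measurable fun a : W × (Hist X (t + 1) × Hist Y (t + 1)) =>
    gibbsCost P d R l k t (a.1, a.2.2) a.2.1 := by fun_prop
  rw [← lintegral_const_mul _ hm, ← lintegral_add_left (hm.const_mul l), jointLaw_succ]
  exact (lintegral_map ((hm.const_mul l).add hg) (jointEquiv t).measurable).symm

theorem freeEnergy_succ_add_lintegral_gibbsCost (k t : ℕ) :
    freeEnergy μ P d R l Q (t + 1) +
        ∫⁻ a, gibbsCost P d R l k t (a.1, a.2.2) a.2.1 ∂jointLaw μ P Q (t + 1) =
      freeEnergy μ P d R l Q t + ∫⁻ p, gibbsLoss P d R l k t p ∂pastLaw μ P Q t +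
        klDiv (pastLaw μ P Q t ⊗ₘ Q.kernel t) (pastLaw μ P Q t ⊗ₘ
          stepGibbs (R.kernel t) (stepCost d l t (gibbsCost P d R l k t))) := by
  have hstep := klDiv_add_lintegral_eq_klDiv_stepGibbs (R.kernel t) (pastLaw μ P Q t)
    (Q.kernel t) (measurable_stepCost d l t (measurable_uncurry_gibbsCost P d R l k t))
  rw [lintegral_stepCost_gibbsCost] at hstep
  calc freeEnergy μ P d R l Q (t + 1) +
        ∫⁻ a, gibbsCost P d R l k t (a.1, a.2.2) a.2.1 ∂jointLaw μ P Q (t + 1)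
      = freeEnergy μ P d R l Q t +
          (klDiv (pastLaw μ P Q t ⊗ₘ Q.kernel t) (pastLaw μ P Q t ⊗ₘ R.kernel t) +
            (l * ∫⁻ a, d.rho t a.2.1 a.2.2 ∂jointLaw μ P Q (t + 1) +
              ∫⁻ a, gibbsCost P d R l k t (a.1, a.2.2) a.2.1 ∂jointLaw μ P Q (t + 1))) := by
        unfold freeEnergy
        rw [klDiv_jointLaw_succ, lintegral_total_succ, mul_add]
        ring
    _ = _ := by
        rw [hstep, add_comm (klDiv _ _), ← add_assoc]
        rfl

variable {n t : ℕ}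

theorem freeEnergy_succ_add_lintegral_gibbsCost_eq (ht : t ≤ n) :
    freeEnergy μ P d R l Q (t + 1) +
        ∫⁻ a, gibbsCost P d R l (n - t) t (a.1, a.2.2) a.2.1 ∂jointLaw μ P Q (t + 1) =
      gibbsValue μ P d R l n +
        klDiv (jointLaw μ P Q (t + 1)) (jointLaw μ P (gibbsRep P d R l n) (t + 1)) := by
  rw [freeEnergy_succ_add_lintegral_gibbsCost, klDiv_jointLaw_succ, ← add_assoc]
  congr 1
  induction t with
  | zero =>
    rw [freeEnergy_zero, jointLaw_zero μ P Q, klDiv_self, zero_add, add_zero,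
      pastLaw_congr (jointLaw_zero μ P Q R), Nat.sub_zero]
    rfl
  | succ t ih =>
    rw [lintegral_gibbsLoss_pastLaw_succ, show n - (t + 1) + 1 = n - t by omega,
      freeEnergy_succ_add_lintegral_gibbsCost, klDiv_jointLaw_succ, ← add_assoc, ih (by omega)]
    rfl

/-- A Pythagorean identity, by which the Gibbs reproduction minimizes the free energy. -/
theorem freeEnergy_eq_gibbsValue_add_klDiv (n : ℕ) :
    freeEnergy μ P d R l Q (n + 1) = gibbsValue μ P d R l n +
      klDiv (jointLaw μ P Q (n + 1)) (jointLaw μ P (gibbsRep P d R l n) (n + 1)) := by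
  rw [← freeEnergy_succ_add_lintegral_gibbsCost_eq μ P d R l Q le_rfl]
  simp [gibbsCost]

theorem gibbsValue_le_freeEnergy (n : ℕ) :
    gibbsValue μ P d R l n ≤ freeEnergy μ P d R l Q (n + 1) :=
  freeEnergy_eq_gibbsValue_add_klDiv μ P d R l Q n ▸ le_self_add

theorem freeEnergy_gibbsRep (n : ℕ) :
    freeEnergy μ P d R l (gibbsRep P d R l n) (n + 1) = gibbsValue μ P d R l n := by
  rw [freeEnergy_eq_gibbsValue_add_klDiv, klDiv_self, add_zero]

variable {μ P d R l Q}

theorem klDiv_jointLaw_mono {Q' : Reproduction W X Y} :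
    Monotone fun t => klDiv (jointLaw μ P Q t) (jointLaw μ P Q' t) :=
  monotone_nat_of_le_succ fun _ => by simp only [klDiv_jointLaw_succ, le_self_add]

theorem freeEnergy_succ_add_lintegral_gibbsCost_ne_top
    (hfin : freeEnergy μ P d R l Q (n + 1) ≠ ∞) (ht : t ≤ n) :
    freeEnergy μ P d R l Q (t + 1) +
      ∫⁻ a, gibbsCost P d R l (n - t) t (a.1, a.2.2) a.2.1 ∂jointLaw μ P Q (t + 1) ≠ ∞ := by
  refine ne_top_of_le_ne_top hfin ?_
  rw [freeEnergy_succ_add_lintegral_gibbsCost_eq μ P d R l Q ht,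
    freeEnergy_eq_gibbsValue_add_klDiv]
  gcongr
  exact klDiv_jointLaw_mono (by omega)

theorem lintegral_gibbsCost_ne_top (hfin : freeEnergy μ P d R l Q (n + 1) ≠ ∞) (ht : t ≤ n) :
    ∫⁻ a, gibbsCost P d R l (n - t) t (a.1, a.2.2) a.2.1 ∂jointLaw μ P Q (t + 1) ≠ ∞ :=
  (ENNReal.add_ne_top.mp (freeEnergy_succ_add_lintegral_gibbsCost_ne_top hfin ht)).2

theorem lintegral_gibbsLoss_ne_top (hfin : freeEnergy μ P d R l Q (n + 1) ≠ ∞) (ht : t ≤ n) :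
    ∫⁻ p, gibbsLoss P d R l (n - t) t p ∂pastLaw μ P Q t ≠ ∞ := by
  have h := freeEnergy_succ_add_lintegral_gibbsCost_ne_top hfin ht
  rw [freeEnergy_succ_add_lintegral_gibbsCost] at h
  exact (ENNReal.add_ne_top.mp (ENNReal.add_ne_top.mp h).1).2

theorem kernel_ae_eq_stepGibbs_of_freeEnergy_le [∀ t, StandardBorelSpace (Y t)]
    (hfin : freeEnergy μ P d R l Q (n + 1) ≠ ∞)
    (hmin : freeEnergy μ P d R l Q (n + 1) ≤ gibbsValue μ P d R l n) (ht : t ≤ n) :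
    Q.kernel t =ᵐ[pastLaw μ P Q t]
      stepGibbs (R.kernel t) (stepCost d l t (gibbsCost P d R l (n - t) t)) := by
  rw [freeEnergy_eq_gibbsValue_add_klDiv] at hfin hmin
  have hkl : klDiv (jointLaw μ P Q (n + 1)) (jointLaw μ P (gibbsRep P d R l n) (n + 1)) = 0 :=
    nonpos_iff_eq_zero.mp <| (ENNReal.add_le_add_iff_left (ENNReal.add_ne_top.mp hfin).1).mp <|
      hmin.trans_eq (add_zero _).symm
  have hstep := klDiv_jointLaw_mono (Nat.succ_le_succ ht) |>.trans_eq hkl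
  simp only [Nat.succ_eq_add_one] at hstep
  rw [nonpos_iff_eq_zero, klDiv_jointLaw_succ, add_eq_zero] at hstep
  exact Kernel.ae_eq_of_compProd_eq (η := (gibbsRep P d R l n).kernel t)
    (klDiv_eq_zero_iff.mp hstep.2)

end GibbsReproduction

section SmallMultiplier

open InformationTheory

variable {W : Type w} {X : ℕ → Type u} {Y : ℕ → Type v} [MeasurableSpace W]
  [∀ t, MeasurableSpace (X t)] [∀ t, MeasurableSpace (Y t)]
  {μ : Measure W} [IsProbabilityMeasure μ] {P : Source X} {d : Distortion X Y}
  {R Q : Reproduction W X Y} {n t : ℕ}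

theorem ae_compProd_of_ae_jointLaw {p : W × (Hist X (t + 1) × Hist Y (t + 1)) → Prop}
    (h : ∀ᵐ a ∂jointLaw μ P Q (t + 1), p a) :
    ∀ᵐ q ∂(pastLaw μ P Q t ⊗ₘ Q.kernel t), p (jointEquiv t q) := by
  rw [jointLaw_succ] at h
  exact ae_of_ae_map (jointEquiv t).measurable.aemeasurable h

theorem ae_ae_of_ae_pastLaw {p : (W × Hist Y t) × Hist X (t + 1) → Prop}
    (h : ∀ᵐ q ∂pastLaw μ P Q t, p q) :
    ∀ᵐ a ∂jointLaw μ P Q t, ∀ᵐ x' ∂P.kernel t a.2.1, p ((a.1, a.2.2), a.2.1.snoc x') := by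
  have hcomp := ae_of_ae_map (measurable_pastLaw_aux t).aemeasurable h
  filter_upwards [Measure.ae_ae_of_ae_compProd hcomp] with a ha
  exact ha

theorem compProd_kernel_absolutelyContinuous {N : ℕ} (htN : t < N)
    (hQR : jointLaw μ P Q N ≪ jointLaw μ P R N) (hRQ : jointLaw μ P R N ≪ jointLaw μ P Q N) :
    pastLaw μ P Q t ⊗ₘ R.kernel t ≪ pastLaw μ P Q t ⊗ₘ Q.kernel t := by
  have hpast : pastLaw μ P Q t ≪ pastLaw μ P R t :=
    pastLaw_absolutelyContinuous (jointLaw_absolutelyContinuous_of_le htN.le hQR)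
  have hjoint := (jointLaw_absolutelyContinuous_of_le htN hRQ).map
    (jointEquiv (W := W) (X := X) (Y := Y) t).symm.measurable
  rw [jointLaw_succ_map_symm, jointLaw_succ_map_symm] at hjoint
  exact (hpast.compProd_left _).trans hjoint

theorem stepPartition_le_stepPartition {α β : Type*} [MeasurableSpace α] [MeasurableSpace β]
    (η : Kernel α β) {c c' : α → β → ℝ≥0∞} {a : α} (h : ∀ b, c a b ≤ c' a b) :
    stepPartition η c' a ≤ stepPartition η c a :=
  lintegral_mono fun b => antitone_expNeg (h b)

theorem monotone_gibbsCost (P : Source X) (d : Distortion X Y) (R : Reproduction W X Y)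
    (k t : ℕ) : Monotone fun l => gibbsCost P d R l k t := by
  intro l l' hl
  induction k generalizing t with
  | zero => exact le_rfl
  | succ k ih =>
    exact fun y x => lintegral_mono fun x' => antitone_negLog <|
      stepPartition_le_stepPartition _ fun yt => add_le_add (mul_le_mul_left hl _) (ih _ _ _)

theorem monotone_gibbsLoss (P : Source X) (d : Distortion X Y) (R : Reproduction W X Y)
    (k t : ℕ) : Monotone fun l => gibbsLoss P d R l k t := fun _ _ hl _ =>
  antitone_negLog <| stepPartition_le_stepPartition _ fun _ =>
    add_le_add (mul_le_mul_left hl _) (monotone_gibbsCost P d R k t hl _ _)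

theorem continuous_expNeg : Continuous expNeg :=
  ENNReal.continuous_exp.comp (continuous_neg.comp continuous_coe_ennreal_ereal)

theorem continuous_negLog : Continuous negLog :=
  EReal.continuous_toENNReal.comp (continuous_neg.comp ENNReal.continuous_log)

theorem tendsto_stepPartition_one {α β ι : Type*} [MeasurableSpace α] [MeasurableSpace β]
    (η : Kernel α β) [IsMarkovKernel η] {F : Filter ι} [F.IsCountablyGenerated]
    {c : ι → α → β → ℝ≥0∞} (hc : ∀ i, Measurable (Function.uncurry (c i))) {a : α}
    (h : ∀ᵐ b ∂η a, Tendsto (fun i => c i a b) F (𝓝 0)) :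
    Tendsto (fun i => stepPartition η (c i) a) F (𝓝 1) := by
  have hone : ∫⁻ _, (1 : ℝ≥0∞) ∂η a = 1 := by simp
  refine hone ▸ tendsto_lintegral_filter_of_dominated_convergence (fun _ => 1)
    (.of_forall fun i => measurable_expNeg.comp ((hc i).comp measurable_prodMk_left))
    (.of_forall fun _ => ae_of_all _ fun _ => expNeg_le_one _) (by simp) ?_
  filter_upwards [h] with b hb
  exact expNeg_zero ▸ (continuous_expNeg.tendsto 0).comp hb

theorem lintegral_rho_ne_top (hd : expectedDistortion μ P d n Q ≠ ∞) (ht : t ≤ n) :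
    ∫⁻ a, d.rho t a.2.1 a.2.2 ∂jointLaw μ P Q (t + 1) ≠ ∞ := by
  have hmono : Monotone fun t => ∫⁻ a, d.total t a.2.1 a.2.2 ∂jointLaw μ P Q t :=
    monotone_nat_of_le_succ fun t => lintegral_total_succ μ P d Q t ▸ le_self_add
  have htotal := ne_top_of_le_ne_top hd (hmono (Nat.succ_le_succ ht))
  simp only [Nat.succ_eq_add_one, lintegral_total_succ] at htotal
  exact (ENNReal.add_ne_top.mp htotal).2

theorem ae_rho_ne_top (hd : expectedDistortion μ P d n Q ≠ ∞) (ht : t ≤ n) :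
    ∀ᵐ a ∂jointLaw μ P Q (t + 1), d.rho t a.2.1 a.2.2 ≠ ∞ :=
  (ae_lt_top (by fun_prop) (lintegral_rho_ne_top hd ht)).mono fun _ => LT.lt.ne

theorem tendsto_gibbsLoss_of_tendsto_gibbsCost {k : ℕ}
    (hac : pastLaw μ P Q t ⊗ₘ R.kernel t ≪ pastLaw μ P Q t ⊗ₘ Q.kernel t)
    (hrho : ∀ᵐ a ∂jointLaw μ P Q (t + 1), d.rho t a.2.1 a.2.2 ≠ ∞)
    (hcost : ∀ᵐ a ∂jointLaw μ P Q (t + 1),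
      Tendsto (fun l => gibbsCost P d R l k t (a.1, a.2.2) a.2.1) (𝓝 0) (𝓝 0)) :
    ∀ᵐ p ∂pastLaw μ P Q t, Tendsto (fun l => gibbsLoss P d R l k t p) (𝓝 0) (𝓝 0) := by
  have hae := hac.ae_le (ae_compProd_of_ae_jointLaw (hrho.and hcost))
  filter_upwards [Measure.ae_ae_of_ae_compProd hae] with p hp
  have hcost : ∀ᵐ y ∂(R.kernel t p),
      Tendsto (fun l => stepCost d l t (gibbsCost P d R l k t) p y) (𝓝 0) (𝓝 0) := by
    filter_upwards [hp] with y ⟨hrho, hcost⟩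
    have hsum := (ENNReal.Tendsto.mul_const (tendsto_id (x := 𝓝 0)) (Or.inr hrho)).add hcost
    rwa [zero_mul, add_zero] at hsum
  have h := (continuous_negLog.tendsto 1).comp (tendsto_stepPartition_one _
    (fun l => measurable_stepCost d l t (measurable_uncurry_gibbsCost P d R l k t)) hcost)
  rwa [negLog_one] at h

theorem tendsto_gibbsCost_of_tendsto_gibbsLoss {k : ℕ}
    (hfin : ∫⁻ a, gibbsCost P d R 1 (k + 1) t (a.1, a.2.2) a.2.1 ∂jointLaw μ P Q (t + 1) ≠ ∞)
    (hloss : ∀ᵐ p ∂pastLaw μ P Q (t + 1),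
      Tendsto (fun l => gibbsLoss P d R l k (t + 1) p) (𝓝 0) (𝓝 0)) :
    ∀ᵐ a ∂jointLaw μ P Q (t + 1),
      Tendsto (fun l => gibbsCost P d R l (k + 1) t (a.1, a.2.2) a.2.1) (𝓝 0) (𝓝 0) := by
  filter_upwards [ae_ae_of_ae_pastLaw hloss, ae_lt_top (by fun_prop) hfin] with a hlim hlt
  have h := tendsto_lintegral_filter_of_dominated_convergence
    (F := fun l x' => gibbsLoss P d R l k (t + 1) ((a.1, a.2.2), a.2.1.snoc x'))
    (fun x' => gibbsLoss P d R 1 k (t + 1) ((a.1, a.2.2), a.2.1.snoc x'))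
    (.of_forall fun l => by fun_prop)
    ((eventually_le_nhds one_pos).mono fun l hl => ae_of_all _ fun x' =>
      monotone_gibbsLoss P d R k (t + 1) hl _) hlt.ne hlim
  rwa [lintegral_zero] at h

theorem ae_tendsto_gibbsLoss (hfin : freeEnergy μ P d R 1 Q (n + 1) ≠ ∞)
    (hd : expectedDistortion μ P d n Q ≠ ∞)
    (hQR : jointLaw μ P Q (n + 1) ≪ jointLaw μ P R (n + 1))
    (hRQ : jointLaw μ P R (n + 1) ≪ jointLaw μ P Q (n + 1)) (ht : t ≤ n) :
    ∀ᵐ p ∂pastLaw μ P Q t, Tendsto (fun l => gibbsLoss P d R l (n - t) t p) (𝓝 0) (𝓝 0) := by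
  induction ht using Nat.decreasingInduction with
  | self =>
    rw [Nat.sub_self]
    exact tendsto_gibbsLoss_of_tendsto_gibbsCost
      (compProd_kernel_absolutelyContinuous n.lt_succ_self hQR hRQ) (ae_rho_ne_top hd le_rfl)
      (ae_of_all _ fun _ => tendsto_const_nhds)
  | of_succ t ht ih =>
    have hcost := lintegral_gibbsCost_ne_top hfin ht.le
    rw [show n - t = n - (t + 1) + 1 by omega] at hcost ⊢
    exact tendsto_gibbsLoss_of_tendsto_gibbsCost
      (compProd_kernel_absolutelyContinuous (ht.trans n.lt_succ_self) hQR hRQ)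
      (ae_rho_ne_top hd ht.le) (tendsto_gibbsCost_of_tendsto_gibbsLoss hcost ih)

theorem tendsto_gibbsValue (hkl : klDiv (jointLaw μ P Q (n + 1)) (jointLaw μ P R (n + 1)) ≠ ∞)
    (hRQ : jointLaw μ P R (n + 1) ≪ jointLaw μ P Q (n + 1))
    (hd : expectedDistortion μ P d n Q ≠ ∞) :
    Tendsto (fun l => gibbsValue μ P d R l n) (𝓝 0) (𝓝 0) := by
  have hfin : freeEnergy μ P d R 1 Q (n + 1) ≠ ∞ :=
    ENNReal.add_ne_top.mpr ⟨hkl, by rwa [one_mul]⟩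
  have hlim := ae_tendsto_gibbsLoss hfin hd (klDiv_ne_top_iff.mp hkl).1 hRQ n.zero_le
  have hlt := lintegral_gibbsLoss_ne_top hfin n.zero_le
  rw [pastLaw_congr (jointLaw_zero μ P Q R)] at hlim hlt
  have h := tendsto_lintegral_filter_of_dominated_convergence
    (F := fun l => gibbsLoss P d R l n 0) (gibbsLoss P d R 1 n 0)
    (.of_forall fun l => by fun_prop)
    ((eventually_le_nhds one_pos).mono fun l hl => ae_of_all _ <| monotone_gibbsLoss P d R n 0 hl)
    hlt hlim
  rwa [lintegral_zero] at h

/-- The product law itself may have infinite distortion, which is why the witness is a Gibbs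
reproduction with a small multiplier. -/
theorem exists_info_lt [∀ t, StandardBorelSpace (X t)] [∀ t, StandardBorelSpace (Y t)]
    [∀ t, Nonempty (Y t)] (hI : info μ P (Q.causal (n + 1)) ≠ ∞)
    (hac : jointLaw μ P (outputRep μ P Q) (n + 1) ≪ jointLaw μ P Q (n + 1))
    (hd : expectedDistortion μ P d n Q ≠ ∞) {r : ℝ≥0∞} (hr : 0 < r) :
    ∃ Q' : Reproduction W X Y, expectedDistortion μ P d n Q' ≠ ∞ ∧
      info μ P (Q'.causal (n + 1)) < r := by
  have hlim := tendsto_gibbsValue (d := d) (info_eq_klDiv_jointLaw μ P Q (n + 1) ▸ hI) hac hd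
  obtain ⟨l, hl, hlr, hltop⟩ : ∃ l : ℝ≥0∞, 0 < l ∧
      gibbsValue μ P d (outputRep μ P Q) l n < r ∧
      gibbsValue μ P d (outputRep μ P Q) l n < ∞ :=
    ((eventually_mem_nhdsWithin (s := Set.Ioi 0)).and (nhdsWithin_le_nhds
      ((hlim.eventually (gt_mem_nhds hr)).and
        (hlim.eventually (gt_mem_nhds ENNReal.zero_lt_top))))).exists
  rw [← freeEnergy_gibbsRep] at hlr hltop
  refine ⟨gibbsRep P d (outputRep μ P Q) l n, ?_, ?_⟩
  · exact fun htop => (ENNReal.add_ne_top.mp hltop.ne).2 <|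
      (congrArg (l * ·) htop).trans (ENNReal.mul_top hl.ne')
  · exact ((info_le_klDiv_jointLaw μ P Q _ (n + 1)).trans le_self_add).trans_lt hlr

end SmallMultiplier

section Optimum

open InformationTheory

variable {W : Type w} {X : ℕ → Type u} {Y : ℕ → Type v} [MeasurableSpace W]
  [∀ t, MeasurableSpace (X t)] [∀ t, MeasurableSpace (Y t)]
  {μ : Measure W} {P : Source X} {d : Distortion X Y} {Q : Reproduction W X Y} {n : ℕ}
  {D : ℝ≥0} {s : ℝ}

theorem IsOptimal.expectedDistortion_le (hopt : IsOptimal μ P d n D Q) :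
    expectedDistortion μ P d n Q ≤ ((n : ℝ≥0∞) + 1) * D :=
  feasible_iff.mp hopt.1

theorem IsOptimal.expectedDistortion_ne_top (hopt : IsOptimal μ P d n D Q) :
    expectedDistortion μ P d n Q ≠ ∞ :=
  ne_top_of_le_ne_top (by finiteness) hopt.expectedDistortion_le

theorem IsLagrangeMultiplier.mul_expectedDistortion_eq
    (hs : IsLagrangeMultiplier (W := W) μ P d n D s) (hopt : IsOptimal μ P d n D Q)
    (hI : info μ P (Q.causal (n + 1)) ≠ ∞) :
    ENNReal.ofReal (-s) * expectedDistortion μ P d n Q =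
      ENNReal.ofReal (-s) * (((n : ℝ≥0∞) + 1) * D) := by
  refine le_antisymm (mul_le_mul_right hopt.expectedDistortion_le _) ?_
  rw [← ENNReal.add_le_add_iff_left hI, hopt.2]
  exact hopt.2 ▸ hs.2 Q

theorem IsLagrangeMultiplier.expectedDistortion_eq (hs : IsLagrangeMultiplier (W := W) μ P d n D s)
    (hopt : IsOptimal μ P d n D Q) (hI : info μ P (Q.causal (n + 1)) ≠ ∞) (hneg : s < 0) :
    expectedDistortion μ P d n Q = ((n : ℝ≥0∞) + 1) * D :=
  (ENNReal.mul_right_inj (by simpa using hneg) ENNReal.ofReal_ne_top).mp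
    (hs.mul_expectedDistortion_eq hopt hI)

theorem IsLagrangeMultiplier.inv_mul_sum_lintegral_rho [IsProbabilityMeasure μ]
    (hs : IsLagrangeMultiplier (W := W) μ P d n D s) (hopt : IsOptimal μ P d n D Q)
    (hI : info μ P (Q.causal (n + 1)) ≠ ∞) (hneg : s < 0) :
    ((n : ℝ≥0∞) + 1)⁻¹ * ∑ t ∈ Finset.range (n + 1),
      ∫⁻ a, d.rho t a.2.1 a.2.2 ∂jointLaw μ P Q (t + 1) = D := by
  have htotal := hs.expectedDistortion_eq hopt hI hneg
  rw [expectedDistortion, lintegral_total_eq_sum] at htotal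
  rw [htotal, ← mul_assoc, ENNReal.inv_mul_cancel (by simp) (by finiteness), one_mul]

variable [∀ t, StandardBorelSpace (Y t)] [∀ t, Nonempty (Y t)] [IsProbabilityMeasure μ]

theorem IsOptimal.freeEnergy_ne_top (hopt : IsOptimal μ P d n D Q)
    (hI : info μ P (Q.causal (n + 1)) ≠ ∞) (s : ℝ) :
    freeEnergy μ P d (outputRep μ P Q) (ENNReal.ofReal (-s)) Q (n + 1) ≠ ∞ := by
  rw [info_eq_klDiv_jointLaw] at hI
  exact ENNReal.add_ne_top.mpr
    ⟨hI, ENNReal.mul_ne_top ENNReal.ofReal_ne_top hopt.expectedDistortion_ne_top⟩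

variable [∀ t, StandardBorelSpace (X t)]

theorem IsLagrangeMultiplier.lt_zero (hs : IsLagrangeMultiplier (W := W) μ P d n D s)
    (hpos : 0 < nrdf (W := W) μ P d n D) (Q : Reproduction W X Y) : s < 0 := by
  refine hs.1.lt_of_ne fun h => hpos.not_ge ?_
  have hle := hs.2 (outputRep μ P Q)
  rwa [info_outputRep, h, neg_zero, ENNReal.ofReal_zero, zero_mul, zero_mul, add_zero,
    add_zero] at hle

theorem IsOptimal.expectedDistortion_le_of_jointLaw_le_smul (hopt : IsOptimal μ P d n D Q)
    (hI : info μ P (Q.causal (n + 1)) ≠ ∞)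
    (hslater : ¬∃ Q' : Reproduction W X Y, info μ P (Q'.causal (n + 1)) ≠ ∞ ∧
      expectedDistortion μ P d n Q' < ((n : ℝ≥0∞) + 1) * D)
    {Q' : Reproduction W X Y} {c : ℝ≥0}
    (hle : jointLaw μ P Q' (n + 1) ≤ c • jointLaw μ P Q (n + 1)) :
    expectedDistortion μ P d n Q ≤ expectedDistortion μ P d n Q' := by
  rw [info_eq_klDiv_jointLaw] at hI
  refine hopt.expectedDistortion_le.trans (not_lt.mp fun hlt => hslater ⟨Q', ?_, hlt⟩)
  exact ne_top_of_le_ne_top (klDiv_ne_top_of_le_smul hle hI) (info_le_klDiv_jointLaw μ P Q Q' _)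

/-- Without a reproduction of finite information in the interior of the constraint, `Q` and
`outputRep μ P Q` have the same distortion, so that the rate is zero. -/
theorem IsOptimal.exists_isLagrangeMultiplier (hopt : IsOptimal μ P d n D Q)
    (hI : info μ P (Q.causal (n + 1)) ≠ ∞)
    (hac : jointLaw μ P (outputRep μ P Q) (n + 1) ≪ jointLaw μ P Q (n + 1)) :
    ∃ s, IsLagrangeMultiplier (W := W) (X := X) (Y := Y) μ P d n D s := by
  rcases eq_or_ne (nrdf (W := W) μ P d n D) 0 with hzero | hpos
  · exact ⟨0, le_rfl, fun Q' => by simp [hzero]⟩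
  have hd := hopt.expectedDistortion_ne_top
  obtain ⟨Q₁, hd₁, hI₁⟩ := exists_info_lt (d := d) hI hac hd (pos_iff_ne_zero.mpr hpos)
  by_cases hslater : ∃ Q' : Reproduction W X Y, info μ P (Q'.causal (n + 1)) ≠ ∞ ∧
      expectedDistortion μ P d n Q' < ((n : ℝ≥0∞) + 1) * D
  · exact exists_isLagrangeMultiplier_of_slater (hopt.2 ▸ hI) hslater ⟨Q₁, hI₁, hd₁⟩
  have heq := expectedDistortion_eq_of_absolutelyContinuous d hd
    (fun Q' => hopt.expectedDistortion_le_of_jointLaw_le_smul hI hslater) hac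
  have hfeas : Feasible μ P d n D (outputRep μ P Q) :=
    feasible_iff.mpr (heq.trans_le hopt.expectedDistortion_le)
  exact absurd (nonpos_iff_eq_zero.mp (info_outputRep μ P Q _ ▸ hfeas.nrdf_le_info)) hpos

theorem IsLagrangeMultiplier.freeEnergy_le_gibbsValue
    (hs : IsLagrangeMultiplier (W := W) μ P d n D s) (hopt : IsOptimal μ P d n D Q) :
    freeEnergy μ P d (outputRep μ P Q) (ENNReal.ofReal (-s)) Q (n + 1) ≤
      gibbsValue μ P d (outputRep μ P Q) (ENNReal.ofReal (-s)) n := by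
  set G := gibbsRep P d (outputRep μ P Q) (ENNReal.ofReal (-s)) n
  calc freeEnergy μ P d (outputRep μ P Q) (ENNReal.ofReal (-s)) Q (n + 1)
      = nrdf μ P d n D + ENNReal.ofReal (-s) * expectedDistortion μ P d n Q := by
        rw [← hopt.2, info_eq_klDiv_jointLaw]
        rfl
    _ ≤ nrdf μ P d n D + ENNReal.ofReal (-s) * (((n : ℝ≥0∞) + 1) * D) := by
        gcongr
        exact hopt.expectedDistortion_le
    _ ≤ info μ P (G.causal (n + 1)) + ENNReal.ofReal (-s) * expectedDistortion μ P d n G := hs.2 G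
    _ ≤ freeEnergy μ P d (outputRep μ P Q) (ENNReal.ofReal (-s)) G (n + 1) :=
        add_le_add_left (info_le_klDiv_jointLaw μ P Q G (n + 1)) _
    _ = _ := freeEnergy_gibbsRep μ P d _ _ n

theorem IsLagrangeMultiplier.gibbsValue_eq
    (hs : IsLagrangeMultiplier (W := W) μ P d n D s) (hopt : IsOptimal μ P d n D Q)
    (hI : info μ P (Q.causal (n + 1)) ≠ ∞) :
    gibbsValue μ P d (outputRep μ P Q) (ENNReal.ofReal (-s)) n =
      nrdf (W := W) μ P d n D + ENNReal.ofReal (-s) * (((n : ℝ≥0∞) + 1) * D) := by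
  rw [← hs.mul_expectedDistortion_eq hopt hI, ← hopt.2, info_eq_klDiv_jointLaw]
  exact (gibbsValue_le_freeEnergy μ P d _ _ Q n).antisymm (hs.freeEnergy_le_gibbsValue hopt)

theorem IsLagrangeMultiplier.inv_mul_toReal_nrdf
    (hs : IsLagrangeMultiplier (W := W) μ P d n D s) (hopt : IsOptimal μ P d n D Q)
    (hI : info μ P (Q.causal (n + 1)) ≠ ∞) :
    ((n : ℝ) + 1)⁻¹ * (nrdf (W := W) μ P d n D).toReal = s * D + ((n : ℝ) + 1)⁻¹ *
      (gibbsValue μ P d (outputRep μ P Q) (ENNReal.ofReal (-s)) n).toReal := by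
  have hs0 := hs.1
  have hR : nrdf (W := W) μ P d n D ≠ ∞ := hopt.2 ▸ hI
  rw [hs.gibbsValue_eq hopt hI, ENNReal.toReal_add hR (by finiteness), ENNReal.toReal_mul,
    ENNReal.toReal_mul, ENNReal.toReal_ofReal (by linarith),
    ENNReal.toReal_add (by finiteness) (by finiteness), ENNReal.toReal_natCast,
    ENNReal.toReal_one, ENNReal.coe_toReal]
  field_simp
  ring

end Optimum

section RealValued

open InformationTheory

variable {W : Type w} {X : ℕ → Type u} {Y : ℕ → Type v} [∀ t, MeasurableSpace (X t)]
  [∀ t, MeasurableSpace (Y t)] {d : Distortion X Y} {s : ℝ} {k t : ℕ}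

theorem weight_eq_expNeg (hs : s ≤ 0) {g : W × Hist Y (t + 1) → Hist X (t + 1) → ℝ}
    {y : W × Hist Y (t + 1)} {x : Hist X (t + 1)} {c : ℝ≥0∞} (hg : (g y x : EReal) = c) :
    weight d s t g y x = expNeg (ENNReal.ofReal (-s) * d.rho t x y.2 + c) := by
  have hcoe : ((ENNReal.ofReal (-s) : ℝ≥0∞) : EReal) = -(s : EReal) := by
    rw [EReal.coe_ennreal_ofReal, max_eq_left (by linarith), EReal.coe_neg]
  rw [weight, expNeg, EReal.coe_ennreal_add, EReal.coe_ennreal_mul, hcoe, ← hg, EReal.neg_mul,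
    EReal.neg_add (Or.inr (by simp)) (Or.inr (by simp)), neg_neg]

variable [MeasurableSpace W]

/-- The function `g_{t,n}`, where `k = n - t`, for the reference kernels `Pi`. -/
def realCost (P : Source X) (d : Distortion X Y) (s : ℝ) (Pi : ∀ t, Kernel (W × Hist Y t) (Y t)) :
    ∀ _k t : ℕ, W × Hist Y (t + 1) → Hist X (t + 1) → ℝ
  | 0, _ => fun _ _ => 0
  | k + 1, t => fun y x => -∫ x', logPartition d s (t + 1) (realCost P d s Pi k (t + 1))
      (Pi (t + 1)) (y, x.snoc x') ∂P.kernel (t + 1) x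

theorem realCost_succ (P : Source X) (d : Distortion X Y) (s : ℝ)
    (Pi : ∀ t, Kernel (W × Hist Y t) (Y t)) (k t : ℕ) (y : W × Hist Y (t + 1))
    (x : Hist X (t + 1)) :
    realCost P d s Pi (k + 1) t y x = -∫ x', logPartition d s (t + 1)
      (realCost P d s Pi k (t + 1)) (Pi (t + 1)) (y, x.snoc x') ∂P.kernel (t + 1) x := rfl

theorem backwardRecursion_realCost (P : Source X) (d : Distortion X Y) (n : ℕ) (s : ℝ)
    (Pi : ∀ t, Kernel (W × Hist Y t) (Y t)) :
    BackwardRecursion P d n s Pi fun t => realCost P d s Pi (n - t) t := by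
  refine ⟨fun y x => ?_, fun t ht y x => ?_⟩ <;> dsimp only
  · rw [Nat.sub_self]
    rfl
  · rw [show n - t = n - (t + 1) + 1 by omega]
    rfl

variable {P : Source X}

theorem partition_eq_stepPartition (hs : s ≤ 0) {Pi : Kernel (W × Hist Y t) (Y t)}
    {g : W × Hist Y (t + 1) → Hist X (t + 1) → ℝ} {c : W × Hist Y (t + 1) → Hist X (t + 1) → ℝ≥0∞}
    {p : (W × Hist Y t) × Hist X (t + 1)}
    (hg : ∀ᵐ yt ∂Pi p.1, (g (extend p.1 yt) p.2 : EReal) = c (extend p.1 yt) p.2) :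
    partition d s t g Pi p = stepPartition (Pi.comap Prod.fst measurable_fst)
      (stepCost d (ENNReal.ofReal (-s)) t c) p :=
  lintegral_congr_ae (hg.mono fun _ hy => weight_eq_expNeg hs hy)

theorem logPartition_eq_neg_toReal_negLog (hs : s ≤ 0) {Pi : Kernel (W × Hist Y t) (Y t)}
    [IsMarkovKernel Pi] {g : W × Hist Y (t + 1) → Hist X (t + 1) → ℝ}
    {c : W × Hist Y (t + 1) → Hist X (t + 1) → ℝ≥0∞} {p : (W × Hist Y t) × Hist X (t + 1)}
    (hg : ∀ᵐ yt ∂Pi p.1, (g (extend p.1 yt) p.2 : EReal) = c (extend p.1 yt) p.2)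
    (hfin : negLog (stepPartition (Pi.comap Prod.fst measurable_fst)
      (stepCost d (ENNReal.ofReal (-s)) t c) p) ≠ ∞) :
    logPartition d s t g Pi p = -(negLog (stepPartition (Pi.comap Prod.fst measurable_fst)
      (stepCost d (ENNReal.ofReal (-s)) t c) p)).toReal := by
  rw [toReal_negLog (negLog_eq_top_iff.not.mp hfin) (stepPartition_le_one _ _ _), neg_neg,
    logPartition, partition_eq_stepPartition hs hg]

variable {Pi : ∀ t, Kernel (W × Hist Y t) (Y t)} [∀ t, IsMarkovKernel (Pi t)]

theorem ae_logPartition_realCost_eq (hs : s ≤ 0) {α : Type*} [MeasurableSpace α] {ν : Measure α}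
    {f : α → (W × Hist Y t) × Hist X (t + 1)} (hf : Measurable f)
    (hg : ∀ᵐ a ∂ν, ∀ᵐ yt ∂Pi t (f a).1,
      (realCost P d s Pi k t (extend (f a).1 yt) (f a).2 : EReal) =
        gibbsCost P d (sourceFreeRep Pi) (ENNReal.ofReal (-s)) k t (extend (f a).1 yt) (f a).2)
    (hfin : ∫⁻ a, gibbsLoss P d (sourceFreeRep Pi) (ENNReal.ofReal (-s)) k t (f a) ∂ν ≠ ∞) :
    ∀ᵐ a ∂ν, logPartition d s t (realCost P d s Pi k t) (Pi t) (f a) =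
      -(gibbsLoss P d (sourceFreeRep Pi) (ENNReal.ofReal (-s)) k t (f a)).toReal := by
  filter_upwards [hg, ae_lt_top ((measurable_gibbsLoss P d _ _ k t).comp hf) hfin] with a hga hfa
  exact logPartition_eq_neg_toReal_negLog hs hga hfa.ne

theorem realCost_succ_eq_gibbsCost (hs : s ≤ 0) {y : W × Hist Y (t + 1)} {x : Hist X (t + 1)}
    (hg : ∀ᵐ x' ∂P.kernel (t + 1) x, ∀ᵐ yt ∂Pi (t + 1) y,
      (realCost P d s Pi k (t + 1) (extend y yt) (x.snoc x') : EReal) =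
        gibbsCost P d (sourceFreeRep Pi) (ENNReal.ofReal (-s)) k (t + 1) (extend y yt)
          (x.snoc x'))
    (hfin : gibbsCost P d (sourceFreeRep Pi) (ENNReal.ofReal (-s)) (k + 1) t y x ≠ ∞) :
    (realCost P d s Pi (k + 1) t y x : EReal) =
      gibbsCost P d (sourceFreeRep Pi) (ENNReal.ofReal (-s)) (k + 1) t y x := by
  have hm : Measurable fun x' : X (t + 1) => (y, x.snoc x') := by fun_prop
  have hae := ae_logPartition_realCost_eq hs hm hg hfin
  have hml := (measurable_gibbsLoss P d (sourceFreeRep Pi) (ENNReal.ofReal (-s)) k (t + 1)).comp hm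
  rw [← EReal.coe_ennreal_toReal hfin, realCost_succ, integral_congr_ae hae, integral_neg, neg_neg,
    gibbsCost_succ]
  exact congrArg _ (integral_toReal hml.aemeasurable (ae_lt_top hml hfin))

variable {μ : Measure W} [IsProbabilityMeasure μ] {Q : Reproduction W X Y} {n : ℕ}

theorem ae_ae_of_ae_compProd_of_freeEnergy_ne_top {l : ℝ≥0∞} {R : Reproduction W X Y}
    (hfin : freeEnergy μ P d R l Q (n + 1) ≠ ∞)
    (hRQ : jointLaw μ P R (n + 1) ≪ jointLaw μ P Q (n + 1)) (ht : t ≤ n)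
    {q : ((W × Hist Y t) × Hist X (t + 1)) × Y t → Prop}
    (hq : ∀ᵐ a ∂(pastLaw μ P Q t ⊗ₘ Q.kernel t), q a) :
    ∀ᵐ p ∂pastLaw μ P Q t, ∀ᵐ yt ∂(R.kernel t p), q (p, yt) := by
  have hQR := (klDiv_ne_top_iff.mp (ENNReal.add_ne_top.mp hfin).1).1
  exact Measure.ae_ae_of_ae_compProd <|
    (compProd_kernel_absolutelyContinuous (Nat.lt_succ_of_le ht) hQR hRQ).ae_le hq

theorem ae_compProd_realCost_eq_gibbsCost (hs : s ≤ 0)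
    (hfin : freeEnergy μ P d (sourceFreeRep Pi) (ENNReal.ofReal (-s)) Q (n + 1) ≠ ∞)
    (hRQ : jointLaw μ P (sourceFreeRep Pi) (n + 1) ≪ jointLaw μ P Q (n + 1)) (ht : t ≤ n) :
    ∀ᵐ q ∂(pastLaw μ P Q t ⊗ₘ Q.kernel t),
      (realCost P d s Pi (n - t) t (extend q.1.1 q.2) q.1.2 : EReal) =
        gibbsCost P d (sourceFreeRep Pi) (ENNReal.ofReal (-s)) (n - t) t (extend q.1.1 q.2)
          q.1.2 := by
  induction ht using Nat.decreasingInduction with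
  | self => exact ae_of_all _ fun q => by simp [realCost, gibbsCost]
  | of_succ t htn ih =>
    have hg := ae_ae_of_ae_pastLaw (ae_ae_of_ae_compProd_of_freeEnergy_ne_top hfin hRQ htn ih)
    have hlt := ae_lt_top (by fun_prop) (lintegral_gibbsCost_ne_top hfin htn.le)
    filter_upwards [ae_compProd_of_ae_jointLaw hg, ae_compProd_of_ae_jointLaw hlt] with q hgq hltq
    rw [show n - t = n - (t + 1) + 1 by omega] at hltq ⊢
    exact realCost_succ_eq_gibbsCost hs hgq hltq.ne

theorem ae_ae_realCost_eq_gibbsCost (hs : s ≤ 0)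
    (hfin : freeEnergy μ P d (sourceFreeRep Pi) (ENNReal.ofReal (-s)) Q (n + 1) ≠ ∞)
    (hRQ : jointLaw μ P (sourceFreeRep Pi) (n + 1) ≪ jointLaw μ P Q (n + 1)) (ht : t ≤ n) :
    ∀ᵐ p ∂pastLaw μ P Q t, ∀ᵐ yt ∂Pi t p.1,
      (realCost P d s Pi (n - t) t (extend p.1 yt) p.2 : EReal) =
        gibbsCost P d (sourceFreeRep Pi) (ENNReal.ofReal (-s)) (n - t) t (extend p.1 yt) p.2 :=
  ae_ae_of_ae_compProd_of_freeEnergy_ne_top hfin hRQ ht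
    (ae_compProd_realCost_eq_gibbsCost hs hfin hRQ ht)

theorem logPartition_ae_eq (hs : s ≤ 0)
    (hfin : freeEnergy μ P d (sourceFreeRep Pi) (ENNReal.ofReal (-s)) Q (n + 1) ≠ ∞)
    (hRQ : jointLaw μ P (sourceFreeRep Pi) (n + 1) ≪ jointLaw μ P Q (n + 1)) (ht : t ≤ n) :
    logPartition d s t (realCost P d s Pi (n - t) t) (Pi t) =ᵐ[pastLaw μ P Q t] fun p =>
      -(gibbsLoss P d (sourceFreeRep Pi) (ENNReal.ofReal (-s)) (n - t) t p).toReal :=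
  ae_logPartition_realCost_eq hs measurable_id (ae_ae_realCost_eq_gibbsCost hs hfin hRQ ht)
    (lintegral_gibbsLoss_ne_top hfin ht)

theorem integrable_logPartition (hs : s ≤ 0)
    (hfin : freeEnergy μ P d (sourceFreeRep Pi) (ENNReal.ofReal (-s)) Q (n + 1) ≠ ∞)
    (hRQ : jointLaw μ P (sourceFreeRep Pi) (n + 1) ≪ jointLaw μ P Q (n + 1)) (ht : t ≤ n) :
    Integrable (logPartition d s t (realCost P d s Pi (n - t) t) (Pi t)) (pastLaw μ P Q t) :=
  (integrable_toReal_of_lintegral_ne_top (by fun_prop)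
    (lintegral_gibbsLoss_ne_top hfin ht)).neg.congr
      (logPartition_ae_eq hs hfin hRQ ht).symm

theorem integral_logPartition (hs : s ≤ 0)
    (hfin : freeEnergy μ P d (sourceFreeRep Pi) (ENNReal.ofReal (-s)) Q (n + 1) ≠ ∞)
    (hRQ : jointLaw μ P (sourceFreeRep Pi) (n + 1) ≪ jointLaw μ P Q (n + 1)) (ht : t ≤ n) :
    ∫ p, logPartition d s t (realCost P d s Pi (n - t) t) (Pi t) p ∂pastLaw μ P Q t =
      -(∫⁻ p, gibbsLoss P d (sourceFreeRep Pi) (ENNReal.ofReal (-s)) (n - t) t p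
        ∂pastLaw μ P Q t).toReal := by
  rw [integral_congr_ae (logPartition_ae_eq hs hfin hRQ ht), integral_neg,
    integral_toReal (by fun_prop) (ae_lt_top (by fun_prop) (lintegral_gibbsLoss_ne_top hfin ht))]

theorem ae_integrable_logPartition_snoc (hs : s ≤ 0)
    (hfin : freeEnergy μ P d (sourceFreeRep Pi) (ENNReal.ofReal (-s)) Q (n + 1) ≠ ∞)
    (hRQ : jointLaw μ P (sourceFreeRep Pi) (n + 1) ≪ jointLaw μ P Q (n + 1)) (ht : t < n) :
    ∀ᵐ p ∂pastLaw μ P Q t, ∀ᵐ yt ∂(Q.kernel t p), Integrable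
      (fun x' => logPartition d s (t + 1) (realCost P d s Pi (n - (t + 1)) (t + 1)) (Pi (t + 1))
        (extend p.1 yt, p.2.snoc x')) (P.kernel (t + 1) p.2) := by
  have h_int := (integrable_logPartition hs hfin hRQ ht).comp_measurable
    (measurable_pastLaw_aux (t + 1))
  exact Measure.ae_ae_of_ae_compProd (ae_compProd_of_ae_jointLaw h_int.ae_of_compProd)

theorem lintegral_gibbsCost_compProd (μ : Measure W) [IsProbabilityMeasure μ] (P : Source X)
    (d : Distortion X Y) (R : Reproduction W X Y) (l : ℝ≥0∞) (Q : Reproduction W X Y) (k t : ℕ) :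
    ∫⁻ q, gibbsCost P d R l k t (extend q.1.1 q.2) q.1.2 ∂(pastLaw μ P Q t ⊗ₘ Q.kernel t) =
      ∫⁻ a, gibbsCost P d R l k t (a.1, a.2.2) a.2.1 ∂jointLaw μ P Q (t + 1) := by
  have hm : Measurable fun a : W × (Hist X (t + 1) × Hist Y (t + 1)) =>
    gibbsCost P d R l k t (a.1, a.2.2) a.2.1 := by fun_prop
  rw [jointLaw_succ]
  exact (lintegral_map hm (jointEquiv t).measurable).symm

theorem realCost_ae_eq (hs : s ≤ 0)
    (hfin : freeEnergy μ P d (sourceFreeRep Pi) (ENNReal.ofReal (-s)) Q (n + 1) ≠ ∞)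
    (hRQ : jointLaw μ P (sourceFreeRep Pi) (n + 1) ≪ jointLaw μ P Q (n + 1)) (ht : t ≤ n) :
    (fun q => realCost P d s Pi (n - t) t (extend q.1.1 q.2) q.1.2)
      =ᵐ[pastLaw μ P Q t ⊗ₘ Q.kernel t] fun q =>
        (gibbsCost P d (sourceFreeRep Pi) (ENNReal.ofReal (-s)) (n - t) t (extend q.1.1 q.2)
          q.1.2).toReal := by
  filter_upwards [ae_compProd_realCost_eq_gibbsCost hs hfin hRQ ht] with q hq
  simpa using congrArg EReal.toReal hq

theorem integrable_realCost (hs : s ≤ 0)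
    (hfin : freeEnergy μ P d (sourceFreeRep Pi) (ENNReal.ofReal (-s)) Q (n + 1) ≠ ∞)
    (hRQ : jointLaw μ P (sourceFreeRep Pi) (n + 1) ≪ jointLaw μ P Q (n + 1)) (ht : t ≤ n) :
    Integrable (fun q => realCost P d s Pi (n - t) t (extend q.1.1 q.2) q.1.2)
      (pastLaw μ P Q t ⊗ₘ Q.kernel t) := by
  refine (integrable_toReal_of_lintegral_ne_top (by fun_prop) ?_).congr
    (realCost_ae_eq hs hfin hRQ ht).symm
  rw [lintegral_gibbsCost_compProd]
  exact lintegral_gibbsCost_ne_top hfin ht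

theorem integrable_integral_realCost (hs : s ≤ 0)
    (hfin : freeEnergy μ P d (sourceFreeRep Pi) (ENNReal.ofReal (-s)) Q (n + 1) ≠ ∞)
    (hRQ : jointLaw μ P (sourceFreeRep Pi) (n + 1) ≪ jointLaw μ P Q (n + 1)) (ht : t ≤ n) :
    Integrable (fun p => ∫ yt, realCost P d s Pi (n - t) t (extend p.1 yt) p.2 ∂(Q.kernel t p))
      (pastLaw μ P Q t) :=
  (integrable_realCost hs hfin hRQ ht).integral_compProd

theorem integral_realCost (hs : s ≤ 0)
    (hfin : freeEnergy μ P d (sourceFreeRep Pi) (ENNReal.ofReal (-s)) Q (n + 1) ≠ ∞)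
    (hRQ : jointLaw μ P (sourceFreeRep Pi) (n + 1) ≪ jointLaw μ P Q (n + 1)) (ht : t ≤ n) :
    ∫ p, ∫ yt, realCost P d s Pi (n - t) t (extend p.1 yt) p.2 ∂(Q.kernel t p)
        ∂pastLaw μ P Q t =
      (∫⁻ a, gibbsCost P d (sourceFreeRep Pi) (ENNReal.ofReal (-s)) (n - t) t (a.1, a.2.2) a.2.1
        ∂jointLaw μ P Q (t + 1)).toReal := by
  rw [← Measure.integral_compProd (integrable_realCost hs hfin hRQ ht),
    integral_congr_ae (realCost_ae_eq hs hfin hRQ ht), ← lintegral_gibbsCost_compProd]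
  refine integral_toReal (by fun_prop) (ae_lt_top (by fun_prop) ?_)
  rw [lintegral_gibbsCost_compProd]
  exact lintegral_gibbsCost_ne_top hfin ht

theorem kernel_eq_withDensity_weight [∀ t, StandardBorelSpace (Y t)] (hs : s ≤ 0)
    (hfin : freeEnergy μ P d (sourceFreeRep Pi) (ENNReal.ofReal (-s)) Q (n + 1) ≠ ∞)
    (hRQ : jointLaw μ P (sourceFreeRep Pi) (n + 1) ≪ jointLaw μ P Q (n + 1))
    (hmin : freeEnergy μ P d (sourceFreeRep Pi) (ENNReal.ofReal (-s)) Q (n + 1) ≤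
      gibbsValue μ P d (sourceFreeRep Pi) (ENNReal.ofReal (-s)) n) (ht : t ≤ n) :
    ∀ᵐ p ∂pastLaw μ P Q t,
      partition d s t (realCost P d s Pi (n - t) t) (Pi t) p ≠ 0 ∧
      partition d s t (realCost P d s Pi (n - t) t) (Pi t) p ≠ ∞ ∧
      Q.kernel t p = (Pi t p.1).withDensity fun yt =>
        weight d s t (realCost P d s Pi (n - t) t) (extend p.1 yt) p.2 /
          partition d s t (realCost P d s Pi (n - t) t) (Pi t) p := by
  filter_upwards [ae_ae_realCost_eq_gibbsCost hs hfin hRQ ht,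
    ae_lt_top (by fun_prop) (lintegral_gibbsLoss_ne_top hfin ht),
    kernel_ae_eq_stepGibbs_of_freeEnergy_le hfin hmin ht] with p hg hlt hQ
  have h0 := negLog_eq_top_iff.not.mp hlt.ne
  rw [partition_eq_stepPartition hs hg]
  refine ⟨h0, ne_top_of_le_ne_top ENNReal.one_ne_top (stepPartition_le_one _ _ _), ?_⟩
  rw [hQ, stepGibbs, Kernel.withDensity_apply _ (measurable_stepDensity _
    (measurable_stepCost d _ _ (measurable_uncurry_gibbsCost P d _ _ _ _))),
    sourceFreeRep_kernel_apply]
  refine withDensity_congr_ae (hg.mono fun yt hy => ?_)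
  simp only [stepDensity, if_neg h0, weight_eq_expNeg hs hy]
  rfl

theorem integral_realCost_add_logPartition (hs : s ≤ 0)
    (hfin : freeEnergy μ P d (sourceFreeRep Pi) (ENNReal.ofReal (-s)) Q (n + 1) ≠ ∞)
    (hRQ : jointLaw μ P (sourceFreeRep Pi) (n + 1) ≪ jointLaw μ P Q (n + 1)) (ht : t ≤ n) :
    ∫ p, ((∫ yt, realCost P d s Pi (n - t) t (extend p.1 yt) p.2 ∂(Q.kernel t p)) +
        logPartition d s t (realCost P d s Pi (n - t) t) (Pi t) p) ∂pastLaw μ P Q t =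
      (∫⁻ a, gibbsCost P d (sourceFreeRep Pi) (ENNReal.ofReal (-s)) (n - t) t (a.1, a.2.2) a.2.1
        ∂jointLaw μ P Q (t + 1)).toReal -
      (∫⁻ p, gibbsLoss P d (sourceFreeRep Pi) (ENNReal.ofReal (-s)) (n - t) t p
        ∂pastLaw μ P Q t).toReal := by
  rw [integral_add (integrable_integral_realCost hs hfin hRQ ht)
    (integrable_logPartition hs hfin hRQ ht), integral_realCost hs hfin hRQ ht,
    integral_logPartition hs hfin hRQ ht, sub_eq_add_neg]

/-- The expected cost at time `t` is the expected loss at time `t + 1`, hence the sum telescopes. -/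
theorem sum_integral_realCost_add_logPartition (hs : s ≤ 0)
    (hfin : freeEnergy μ P d (sourceFreeRep Pi) (ENNReal.ofReal (-s)) Q (n + 1) ≠ ∞)
    (hRQ : jointLaw μ P (sourceFreeRep Pi) (n + 1) ≪ jointLaw μ P Q (n + 1)) :
    ∑ t ∈ Finset.range (n + 1), ∫ p,
        ((∫ yt, realCost P d s Pi (n - t) t (extend p.1 yt) p.2 ∂(Q.kernel t p)) +
          logPartition d s t (realCost P d s Pi (n - t) t) (Pi t) p) ∂pastLaw μ P Q t =
      -(gibbsValue μ P d (sourceFreeRep Pi) (ENNReal.ofReal (-s)) n).toReal := by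
  have hterm := fun t (ht : t ∈ Finset.range (n + 1)) =>
    integral_realCost_add_logPartition hs hfin hRQ (Finset.mem_range_succ_iff.mp ht)
  have hstep : ∀ t ∈ Finset.range n,
      (∫⁻ a, gibbsCost P d (sourceFreeRep Pi) (ENNReal.ofReal (-s)) (n - t) t (a.1, a.2.2) a.2.1
        ∂jointLaw μ P Q (t + 1)).toReal =
      (∫⁻ p, gibbsLoss P d (sourceFreeRep Pi) (ENNReal.ofReal (-s)) (n - (t + 1)) (t + 1) p
        ∂pastLaw μ P Q (t + 1)).toReal := fun t ht => by
    rw [lintegral_gibbsLoss_pastLaw_succ, Nat.sub_add_eq,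
      Nat.sub_add_cancel (Nat.sub_pos_of_lt (Finset.mem_range.mp ht))]
  rw [Finset.sum_congr rfl hterm, Finset.sum_sub_distrib, Finset.sum_range_succ,
    Finset.sum_range_succ', Finset.sum_congr rfl hstep, Nat.sub_self, Nat.sub_zero, gibbsValue,
    pastLaw_congr (jointLaw_zero μ P (sourceFreeRep Pi) Q)]
  simp [gibbsCost]

end RealValued

end NRDF

end

theorem mainTheorem3_general {W : Type*} {X Y : ℕ → Type*}
    [MeasurableSpace W]
    [∀ t, MeasurableSpace (X t)] [∀ t, StandardBorelSpace (X t)]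
    [∀ t, MeasurableSpace (Y t)] [∀ t, StandardBorelSpace (Y t)] [∀ t, Nonempty (Y t)]
    (μ : Measure W) [IsProbabilityMeasure μ] (P : NRDF.Source X) (d : NRDF.Distortion X Y)
    (n : ℕ) (D : ℝ≥0) (Q : NRDF.Reproduction W X Y)
    (hopt : NRDF.IsOptimal μ P d n D Q)
    (hI : NRDF.info μ P (Q.causal (n + 1)) ≠ ∞)
    (hac : μ ⊗ₘ NRDF.productKernel P (Q.causal (n + 1)) ≪ NRDF.jointLaw μ P Q (n + 1)) :
    ∃ (s : ℝ) (g : ∀ t, W × NRDF.Hist Y (t + 1) → NRDF.Hist X (t + 1) → ℝ),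
      NRDF.IsLagrangeMultiplier μ P d n D s ∧
      NRDF.BackwardRecursion P d n s (NRDF.outputKernel μ P Q) g ∧
      (∀ t < n, ∀ᵐ p ∂(NRDF.pastLaw μ P Q t), ∀ᵐ yt ∂(Q.kernel t p),
        Integrable (fun x' => NRDF.logPartition d s (t + 1) (g (t + 1))
          (NRDF.outputKernel μ P Q (t + 1)) (NRDF.extend p.1 yt, p.2.snoc x'))
          (P.kernel (t + 1) p.2)) ∧
      (∀ t ≤ n,
        (∀ᵐ p ∂(NRDF.pastLaw μ P Q t),
          Integrable (fun yt => g t (NRDF.extend p.1 yt) p.2) (Q.kernel t p)) ∧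
        Integrable (fun p => ∫ yt, g t (NRDF.extend p.1 yt) p.2 ∂(Q.kernel t p))
          (NRDF.pastLaw μ P Q t) ∧
        Integrable (NRDF.logPartition d s t (g t) (NRDF.outputKernel μ P Q t))
          (NRDF.pastLaw μ P Q t)) ∧
      (∀ t ≤ n, ∀ᵐ p ∂(NRDF.pastLaw μ P Q t),
        NRDF.partition d s t (g t) (NRDF.outputKernel μ P Q t) p ≠ 0 ∧
        NRDF.partition d s t (g t) (NRDF.outputKernel μ P Q t) p ≠ ∞ ∧
        Q.kernel t p = (NRDF.outputKernel μ P Q t p.1).withDensity (fun yt =>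
          NRDF.weight d s t (g t) (NRDF.extend p.1 yt) p.2 /
            NRDF.partition d s t (g t) (NRDF.outputKernel μ P Q t) p)) ∧
      NRDF.nrdf (W := W) μ P d n D ≠ ∞ ∧
      ((n : ℝ) + 1)⁻¹ * (NRDF.nrdf (W := W) μ P d n D).toReal =
        s * D - ((n : ℝ) + 1)⁻¹ * ∑ t ∈ Finset.range (n + 1),
          ∫ p, ((∫ yt, g t (NRDF.extend p.1 yt) p.2 ∂(Q.kernel t p)) +
            NRDF.logPartition d s t (g t) (NRDF.outputKernel μ P Q t) p)
            ∂(NRDF.pastLaw μ P Q t) ∧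
      (0 < NRDF.nrdf (W := W) μ P d n D →
        s < 0 ∧
        ((n : ℝ≥0∞) + 1)⁻¹ * ∑ t ∈ Finset.range (n + 1),
          ∫⁻ a, d.rho t a.2.1 a.2.2 ∂(NRDF.jointLaw μ P Q (t + 1)) = D) := by
  rw [← NRDF.jointLaw_outputRep] at hac
  obtain ⟨s, hs⟩ := hopt.exists_isLagrangeMultiplier hI hac
  have hfin := hopt.freeEnergy_ne_top hI s
  have hmin := hs.freeEnergy_le_gibbsValue hopt
  refine ⟨s, fun t => NRDF.realCost P d s (NRDF.outputKernel μ P Q) (n - t) t, hs,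
    NRDF.backwardRecursion_realCost P d n s _,
    fun t ht => NRDF.ae_integrable_logPartition_snoc hs.1 hfin hac ht,
    fun t ht => ⟨(NRDF.integrable_realCost hs.1 hfin hac ht).ae_of_compProd,
      NRDF.integrable_integral_realCost hs.1 hfin hac ht,
      NRDF.integrable_logPartition hs.1 hfin hac ht⟩,
    fun t ht => NRDF.kernel_eq_withDensity_weight hs.1 hfin hac hmin ht,
    hopt.2 ▸ hI, ?_,
    fun hpos => ⟨hs.lt_zero hpos Q, hs.inv_mul_sum_lintegral_rho hopt hI (hs.lt_zero hpos Q)⟩⟩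
  rw [NRDF.sum_integral_realCost_add_logPartition hs.1 hfin hac,
    hs.inv_mul_toReal_nrdf hopt hI]
  ring

theorem mainTheorem3 {W : Type*} {X Y : ℕ → Type*}
    [MeasurableSpace W] [StandardBorelSpace W]
    [∀ t, MeasurableSpace (X t)] [∀ t, StandardBorelSpace (X t)]
    [∀ t, MeasurableSpace (Y t)] [∀ t, StandardBorelSpace (Y t)] [∀ t, Nonempty (Y t)]
    (μ : Measure W) [IsProbabilityMeasure μ] (P : NRDF.Source X) (d : NRDF.Distortion X Y)
    (n : ℕ) (D : ℝ≥0) (Q : NRDF.Reproduction W X Y)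
    (hopt : NRDF.IsOptimal μ P d n D Q)
    (hdiff : NRDF.GateauxDifferentiableAt μ P n Q) :
    ∃ (s : ℝ) (g : ∀ t, W × NRDF.Hist Y (t + 1) → NRDF.Hist X (t + 1) → ℝ),
      NRDF.IsLagrangeMultiplier μ P d n D s ∧
      NRDF.BackwardRecursion P d n s (NRDF.outputKernel μ P Q) g ∧
      -- the integrals in the recursion and in the formula for the NRDF are well defined
      (∀ t < n, ∀ᵐ p ∂(NRDF.pastLaw μ P Q t), ∀ᵐ yt ∂(Q.kernel t p),
        Integrable (fun x' => NRDF.logPartition d s (t + 1) (g (t + 1))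
          (NRDF.outputKernel μ P Q (t + 1)) (NRDF.extend p.1 yt, p.2.snoc x'))
          (P.kernel (t + 1) p.2)) ∧
      (∀ t ≤ n,
        (∀ᵐ p ∂(NRDF.pastLaw μ P Q t),
          Integrable (fun yt => g t (NRDF.extend p.1 yt) p.2) (Q.kernel t p)) ∧
        Integrable (fun p => ∫ yt, g t (NRDF.extend p.1 yt) p.2 ∂(Q.kernel t p))
          (NRDF.pastLaw μ P Q t) ∧
        Integrable (NRDF.logPartition d s t (g t) (NRDF.outputKernel μ P Q t))
          (NRDF.pastLaw μ P Q t)) ∧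
      -- (1) the Gibbs form of the optimal kernels
      (∀ t ≤ n, ∀ᵐ p ∂(NRDF.pastLaw μ P Q t),
        NRDF.partition d s t (g t) (NRDF.outputKernel μ P Q t) p ≠ 0 ∧
        NRDF.partition d s t (g t) (NRDF.outputKernel μ P Q t) p ≠ ∞ ∧
        Q.kernel t p = (NRDF.outputKernel μ P Q t p.1).withDensity (fun yt =>
          NRDF.weight d s t (g t) (NRDF.extend p.1 yt) p.2 /
            NRDF.partition d s t (g t) (NRDF.outputKernel μ P Q t) p)) ∧
      -- (2) the value of the NRDF
      NRDF.nrdf (W := W) μ P d n D ≠ ∞ ∧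
      ((n : ℝ) + 1)⁻¹ * (NRDF.nrdf (W := W) μ P d n D).toReal =
        s * D - ((n : ℝ) + 1)⁻¹ * ∑ t ∈ Finset.range (n + 1),
          ∫ p, ((∫ yt, g t (NRDF.extend p.1 yt) p.2 ∂(Q.kernel t p)) +
            NRDF.logPartition d s t (g t) (NRDF.outputKernel μ P Q t) p)
            ∂(NRDF.pastLaw μ P Q t) ∧
      -- (3) the multiplier is negative and the constraint is tight at positive rate
      (0 < NRDF.nrdf (W := W) μ P d n D →
        s < 0 ∧
        ((n : ℝ≥0∞) + 1)⁻¹ * ∑ t ∈ Finset.range (n + 1),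
          ∫⁻ a, d.rho t a.2.1 a.2.2 ∂(NRDF.jointLaw μ P Q (t + 1)) = D) :=
  mainTheorem3_general μ P d n D Q hopt hdiff.info_ne_top
    (NRDF.jointLaw_outputRep μ P Q (n + 1) ▸ hdiff.absolutelyContinuous)
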